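/- **Setting.** Equip $\mathbb R^2$ with the Euclidean norm and $\mathbb R^{2\times2}$ with the Frobenius norm. Let $\mathscr A:\mathbb R^{2\times2}\to\mathbb R^{2\times2}$ be a linear projection ($\mathscr A^2=\mathscr A$; for instance an orthogonal one) with range $\mathbb R^{2\times2}_{\mathscr A}$, such that the operator $\mathbb A u=\mathscr A[\mathrm Du]$ is $\mathbb C$-elliptic, i.e. for every $\xi\in\mathbb C^2\setminus\{0\}$ the map $\mathbb C^2\ni v\mapsto\mathscr A[v\otimes\xi]$ ($\mathscr A$ extended complex linearly) is injective. Let $\Omega\subset\mathbb R^2$ be open and bounded, and let $W^{\mathbb A,1}(\Omega)$ be the space of $v\in L^1(\Omega;\mathbb R^2)$ whose distributional $\mathscr A[\mathrm Dv]$ is in $L^1$, with norm $\|v\|_{L^1}+\|\mathscr A[\mathrm Dv]\|_{L^1}$, and $W^{\mathbb A,1}_0(\Omega)$ the closure of $C_c^\infty(\Omega;\mathbb R^2)$ in it. Let $W^{-2,1}(\Omega;\mathbb R^2)$ be the space of distributions $T=\sum_{|\alpha|\le2}\partial^\alpha T_\alpha$ with $T_\alpha\in L^1(\Omega;\mathbb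 R^2)$, with the norm $\inf\sum_{|\alpha|\le 2}\|T_\alpha\|_{L^1}$ over all such representations. Let $\Lambda>0$ and let $f\in C^2(\mathbb R^{2\times2}_{\mathscr A})$ satisfy, for some $c_1,c_2>0$, $$c_1|P|\le f(P)\le c_2(1+|P|),\qquad 0\le\langle \mathrm D^2f(P)\xi,\xi\rangle\le\Lambda\frac{|\xi|^2}{(1+|P|^2)^{1/2}}\qquad\text{for all }P,\xi\in\mathbb R^{2\times2}_{\mathscr A}.$$ Write $\mathscr F[v]=\int_\Omega f(\mathscr A[\mathrm Dv])\,dx$. **Ekeland-type approximating sequence.** Let $u_0\in W^{\mathbb A,1}(\Omega)$. For each integer $j\ge1$ let $u_j\in u_0+C_c^\infty(\Omega;\mathbb R^2)$ with $\mathscr F[u_j]\le\inf_{u_0+W^{\mathbb A,1}_0(\Omega)}\mathscr F+\frac1{8j^2}$, let $u_j^{\partial\Omega}\in W^{1,2}(\Omega;\mathbb R^2)$ with $\|u_j^{\partial\Omega}-u_0\|_{W^{\mathbb A,1}(\Omega)}\le\frac1{8\,\mathrm{Lip}(f)j^2}$, and put $\tilde u_j=u_j-u_0+u_j^{\partial\Omega}$,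 $\mathscr D_j=u_j^{\partial\Omega}+W_0^{\mathbb A,1}(\Omega)$, $$A_j=1+\int_\Omega(1+|\mathscr A[\mathrm D\tilde u_j]|^2)\,dx,\qquad f_j(P)=f(P)+\frac1{2A_jj^2}(1+|P|^2),$$ and $\mathscr F_j[v]=\int_\Omega f_j(\mathscr A[\mathrm Dv])\,dx$ if $v\in\mathscr D_j$, $\mathscr F_j[v]=+\infty$ for all other $v\in W^{-2,1}(\Omega;\mathbb R^2)$. Let $v_j\in W^{-2,1}(\Omega;\mathbb R^2)$ satisfy $$\|v_j-\tilde u_j\|_{W^{-2,1}}\le\frac1j,\qquad \mathscr F_j[v_j]\le\mathscr F_j[w]+\frac1j\|v_j-w\|_{W^{-2,1}}\quad\text{for all }w\in W^{-2,1}(\Omega;\mathbb R^2).$$ **Theorem.** For every $\kappa>0$ there is a constant $c=c(\Lambda,\mathscr A,\kappa)>0$, independent of $j$, $\Omega$, $f$, $u_0$ and of the sequences, such that for all $j\ge1$: $v_j\in W^{\mathbb A,1}(\Omega)$, $\mathscr A[\mathrm Dv_j]\in L^2(\Omega)$, the weak derivatives $\partial_k\mathscr A[\mathrm Dv_j]$,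 $k=1,2$, exist in $L^2_{\mathrm{loc}}(\Omega)$, and for every ball $B_{2r}(x_0)\subset\Omega$, $r>0$, and every $\varrho\in C_c^\infty(\Omega)$ with $\chi_{B_r(x_0)}\le\varrho\le\chi_{B_{2r}(x_0)}$, $|\nabla\varrho|\le\frac2r$ and $|\mathrm D^2\varrho|\le\frac{\kappa}{r^2}$, the integrals on the left below converge and $$\sum_{k=1}^2\int_{B_{2r}(x_0)}\varrho^4\langle \mathrm D^2f_j(\mathscr A[\mathrm Dv_j])\,\partial_k\mathscr A[\mathrm Dv_j],\partial_k\mathscr A[\mathrm Dv_j]\rangle\,dx$$ $$\le\frac{c}{r^2}\bigg[\int_{B_{2r}(x_0)}|\mathscr A[\mathrm Dv_j]|\,dx+\frac1{A_jj^2}\int_{B_{2r}(x_0)}(1+|\mathscr A[\mathrm Dv_j]|^2)\,dx+\Big(1+\frac{r^2}j+\frac{r^3}j\Big)\int_{B_{2r}(x_0)}\frac{|v_j|}r\,dx\bigg].$$ -/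

import Mathlib

open MeasureTheory
open scoped ContDiff ENNReal NNReal

noncomputable section

namespace WSO

/-- The plane with the Euclidean norm. -/
abbrev E := EuclideanSpace ℝ (Fin 2)

/-- Real `2 × 2` matrices with the Frobenius norm; the entry in row `i`, column `j` of `P`
is `P (i, j)`. -/
abbrev Mat := EuclideanSpace ℝ (Fin 2 × Fin 2)

/-- The matrix `v ⊗ ξ = v ξᵀ`. -/
def tens (v ξ : E) : Mat := WithLp.toLp 2 fun p => v p.1 * ξ p.2

/-- The real part of the complex matrix `v ⊗ ξ = v ξᵀ`. -/
def tensRe (v ξ : Fin 2 → ℂ) : Mat := WithLp.toLp 2 fun p => (v p.1 * ξ p.2).re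

/-- The imaginary part of the complex matrix `v ⊗ ξ = v ξᵀ`. -/
def tensIm (v ξ : Fin 2 → ℂ) : Mat := WithLp.toLp 2 fun p => (v p.1 * ξ p.2).im

/-- The symbol at `ξ ∈ ℂ²` of the operator `u ↦ 𝒜[Du]`: the complexification of `𝒜`, applied
to `v ⊗ ξ`. -/
def complexSymbol (A : Mat →L[ℝ] Mat) (ξ v : Fin 2 → ℂ) : Fin 2 × Fin 2 → ℂ :=
  fun p => (A (tensRe v ξ) p : ℂ) + Complex.I * (A (tensIm v ξ) p : ℂ)

/-- `ℂ`-ellipticity of the first order operator `u ↦ 𝒜[Du]`. -/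
def IsCElliptic (A : Mat →L[ℝ] Mat) : Prop :=
  ∀ ξ : Fin 2 → ℂ, ξ ≠ 0 → Function.Injective (complexSymbol A ξ)

/-- The space `{P : 𝒜[P] = P}` of a projection `𝒜`, that is, its range. -/
abbrev RA (A : Mat →L[ℝ] Mat) : Submodule ℝ Mat := LinearMap.range A.toLinearMap

/-- `𝒜`, as a map onto its range. -/
def part (A : Mat →L[ℝ] Mat) (P : Mat) : RA A := A.toLinearMap.rangeRestrict P

section Calculus

variable {F : Type*} [NormedAddCommGroup F] [NormedSpace ℝ F]

/-- The classical partial derivative `∂ₖ φ`. -/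
def pd (k : Fin 2) (φ : E → F) (x : E) : F := fderiv ℝ φ x (EuclideanSpace.single k 1)

/-- The classical derivative `∂^α φ` for a multi-index `α = (α₁, α₂)`. -/
def pdMulti (α : ℕ × ℕ) (φ : E → F) : E → F := (pd 0)^[α.1] ((pd 1)^[α.2] φ)

/-- `φ ∈ C_c^∞(Ω; F)`. -/
def IsTest (Ω : Set E) (φ : E → F) : Prop :=
  ContDiff ℝ ∞ φ ∧ HasCompactSupport φ ∧ tsupport φ ⊆ Ω

/-- `g` is the weak partial derivative `∂ₖ u` in `Ω`. -/
def HasWeakPartial (Ω : Set E) (k : Fin 2) (u g : E → F) : Prop :=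
  LocallyIntegrableOn u Ω ∧ LocallyIntegrableOn g Ω ∧
    ∀ φ : E → ℝ, IsTest Ω φ → ∫ x in Ω, φ x • g x = -∫ x in Ω, pd k φ x • u x

/-- `u ∈ L²_loc(Ω; F)`. -/
def MemL2loc (Ω : Set E) (u : E → F) : Prop :=
  ∀ K : Set E, IsCompact K → K ⊆ Ω → MemLp u 2 (volume.restrict K)

/-- `u ∈ W^{1,2}(Ω; F)`. -/
def MemW12 (Ω : Set E) (u : E → F) : Prop :=
  MemLp u 2 (volume.restrict Ω) ∧
    ∀ k, ∃ g : E → F, MemLp g 2 (volume.restrict Ω) ∧ HasWeakPartial Ω k u g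

/-- The multi-indices of length at most `k`. -/
def multiIdx (k : ℕ) : Finset (ℕ × ℕ) :=
  (Finset.range (k + 1) ×ˢ Finset.range (k + 1)).filter fun α => α.1 + α.2 ≤ k

/-- `w = ∑_{|α| ≤ k} ∂^α T_α` in the sense of distributions on `Ω`, with all `T_α ∈ L¹(Ω; F)`. -/
def IsNegSobRep (k : ℕ) (Ω : Set E) (w : E → F) (T : ℕ × ℕ → E → F) : Prop :=
  LocallyIntegrableOn w Ω ∧ (∀ α ∈ multiIdx k, IntegrableOn (T α) Ω) ∧
    ∀ φ : E → ℝ, IsTest Ω φ →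
      ∫ x in Ω, φ x • w x =
        ∑ α ∈ multiIdx k, (-1 : ℝ) ^ (α.1 + α.2) • ∫ x in Ω, pdMulti α φ x • T α x

/-- The norm of (the distribution given by) `w` in `W^{-k,1}(Ω; F)`; it is `∞` if `w` is not in
that space. -/
def negSobNorm (k : ℕ) (Ω : Set E) (w : E → F) : ℝ≥0∞ :=
  ⨅ (T : ℕ × ℕ → E → F) (_ : IsNegSobRep k Ω w T),
    ∑ α ∈ multiIdx k, eLpNorm (T α) 1 (volume.restrict Ω)

end Calculus

/-- `P = 𝒜[Dv]` in the sense of distributions on `Ω`. -/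
def HasWeakA (A : Mat →L[ℝ] Mat) (Ω : Set E) (v : E → E) (P : E → RA A) : Prop :=
  LocallyIntegrableOn v Ω ∧ LocallyIntegrableOn P Ω ∧
    ∀ φ : E → ℝ, IsTest Ω φ →
      ∫ x in Ω, φ x • P x = -∫ x in Ω, part A (tens (v x) (gradient φ x))

open Classical in
/-- The function `𝒜[Dv]` on `Ω` (unique up to null sets), if it exists, and `0` otherwise. -/
def AD (A : Mat →L[ℝ] Mat) (Ω : Set E) (v : E → E) : E → RA A :=
  if h : ∃ P, HasWeakA A Ω v P then h.choose else 0

/-- `v ∈ W^{𝔸,1}(Ω)`. -/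
def MemWA1 (A : Mat →L[ℝ] Mat) (Ω : Set E) (v : E → E) : Prop :=
  IntegrableOn v Ω ∧ HasWeakA A Ω v (AD A Ω v) ∧ IntegrableOn (AD A Ω v) Ω

/-- The norm of `W^{𝔸,1}(Ω)`. -/
def normWA1 (A : Mat →L[ℝ] Mat) (Ω : Set E) (v : E → E) : ℝ≥0∞ :=
  eLpNorm v 1 (volume.restrict Ω) + eLpNorm (AD A Ω v) 1 (volume.restrict Ω)

/-- `v ∈ W^{𝔸,1}_0(Ω)`, the closure of `C_c^∞(Ω; ℝ²)` in `W^{𝔸,1}(Ω)`. -/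
def MemWA10 (A : Mat →L[ℝ] Mat) (Ω : Set E) (v : E → E) : Prop :=
  MemWA1 A Ω v ∧ ∀ ε : ℝ≥0∞, 0 < ε → ∃ φ : E → E, IsTest Ω φ ∧ normWA1 A Ω (v - φ) < ε

/-- The Dirichlet class `u₀ + W^{𝔸,1}_0(Ω)`. -/
def dirichletClass (A : Mat →L[ℝ] Mat) (Ω : Set E) (u₀ : E → E) : Set (E → E) :=
  {v | MemWA10 A Ω (v - u₀)}

/-- The functional `∫_Ω g(𝒜[Dv])` for a nonnegative integrand `g`. -/
def energy (A : Mat →L[ℝ] Mat) (Ω : Set E) (g : RA A → ℝ) (v : E → E) : ℝ≥0∞ :=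
  ∫⁻ x in Ω, ENNReal.ofReal (g (AD A Ω v x))

/-- The best Lipschitz constant of `f`. -/
def lipConst {A : Mat →L[ℝ] Mat} (f : RA A → ℝ) : ℝ≥0 := sInf {K : ℝ≥0 | LipschitzWith K f}

/-- `⟨D²g(P)ξ, ξ⟩`. -/
def hessForm {A : Mat →L[ℝ] Mat} (g : RA A → ℝ) (P ξ : RA A) : ℝ :=
  fderiv ℝ (fderiv ℝ g) P ξ ξ

/-- The assumptions on the integrand: it is `C²` and of linear growth, with
`0 ≤ ⟨D²f(P)ξ, ξ⟩ ≤ Λ |ξ|² (1 + |P|²)^{-1/2}`. -/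
structure IsAdmissible {A : Mat →L[ℝ] Mat} (Λ : ℝ) (f : RA A → ℝ) : Prop where
  contDiff : ContDiff ℝ 2 f
  growth : ∃ c₁ c₂ : ℝ, 0 < c₁ ∧ 0 < c₂ ∧ ∀ P, c₁ * ‖P‖ ≤ f P ∧ f P ≤ c₂ * (1 + ‖P‖)
  hess : ∀ P ξ, 0 ≤ hessForm f P ξ ∧ hessForm f P ξ ≤ Λ * (‖ξ‖ ^ 2 / Real.sqrt (1 + ‖P‖ ^ 2))

/-- `A_j = 1 + ∫_Ω (1 + |𝒜[Dũ_j]|²)`. -/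
def Aconst (A : Mat →L[ℝ] Mat) (Ω : Set E) (ut : E → E) : ℝ :=
  1 + ∫ x in Ω, (1 + ‖AD A Ω ut x‖ ^ 2)

/-- The regularised integrand `f(P) + (1 + |P|²) / (2 a j²)`. -/
def regIntegrand {A : Mat →L[ℝ] Mat} (f : RA A → ℝ) (a : ℝ) (j : ℕ) (P : RA A) : ℝ :=
  f P + 1 / (2 * a * (j : ℝ) ^ 2) * (1 + ‖P‖ ^ 2)

open Classical in
/-- The regularised functional, extended by `+∞` outside the Dirichlet class of `ub`. (The
distributions in `W^{-2,1}(Ω; ℝ²)` that are not functions get the value `+∞` as well and play no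
role.) -/
def regEnergy (A : Mat →L[ℝ] Mat) (Ω : Set E) (f : RA A → ℝ) (a : ℝ) (j : ℕ) (ub v : E → E) :
    ℝ≥0∞ :=
  if v ∈ dirichletClass A Ω ub then energy A Ω (regIntegrand f a j) v else ⊤

/-- The functions `ũ_j = u_j - u₀ + u_j^{∂Ω}`. -/
def utilde (u₀ : E → E) (u ub : ℕ → E → E) (j : ℕ) : E → E := u j - u₀ + ub j

/-- `v` is an Ekeland-type approximating sequence, built from the Dirichlet datum `u₀`, the
minimising sequence `u` in `u₀ + C_c^∞(Ω; ℝ²)` and the regularised boundary data `ub`. -/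
structure IsEkelandSequence (A : Mat →L[ℝ] Mat) (Ω : Set E) (f : RA A → ℝ) (u₀ : E → E)
    (u ub v : ℕ → E → E) : Prop where
  datum : MemWA1 A Ω u₀
  smooth : ∀ j, 1 ≤ j → IsTest Ω (u j - u₀)
  minimising : ∀ j, 1 ≤ j →
    energy A Ω f (u j) ≤
      (⨅ w ∈ dirichletClass A Ω u₀, energy A Ω f w) + ENNReal.ofReal (1 / (8 * (j : ℝ) ^ 2))
  boundary_mem : ∀ j, 1 ≤ j → MemW12 Ω (ub j)
  boundary_close : ∀ j, 1 ≤ j →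
    normWA1 A Ω (ub j - u₀) ≤ ENNReal.ofReal (1 / (8 * (lipConst f : ℝ) * (j : ℝ) ^ 2))
  ekeland_close : ∀ j, 1 ≤ j →
    negSobNorm 2 Ω (v j - utilde u₀ u ub j) ≤ ENNReal.ofReal (1 / (j : ℝ))
  ekeland_min : ∀ j, 1 ≤ j → ∀ w : E → E,
    regEnergy A Ω f (Aconst A Ω (utilde u₀ u ub j)) j (ub j) (v j) ≤
      regEnergy A Ω f (Aconst A Ω (utilde u₀ u ub j)) j (ub j) w +
        ENNReal.ofReal (1 / (j : ℝ)) * negSobNorm 2 Ω (v j - w)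

/-- `ρ ∈ C_c^∞(Ω)` is a localisation function for the balls `B_r(x₀) ⊆ B_{2r}(x₀)`, with
`|∇ρ| ≤ 2/r` and `|D²ρ| ≤ κ/r²`. -/
structure IsCutoff (κ : ℝ) (Ω : Set E) (x₀ : E) (r : ℝ) (ρ : E → ℝ) : Prop where
  test : IsTest Ω ρ
  lower : ∀ x, (Metric.ball x₀ r).indicator 1 x ≤ ρ x
  upper : ∀ x, ρ x ≤ (Metric.ball x₀ (2 * r)).indicator 1 x
  grad : ∀ x, ‖gradient ρ x‖ ≤ 2 / r
  hess : ∀ x, Real.sqrt (∑ k, ∑ l, pd k (pd l ρ) x ^ 2) ≤ κ / r ^ 2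

end WSO

end

/-! The proof rests on an algebraic fact about 2×2 matrices. By ℂ-ellipticity the complexified
kernel of 𝒜 contains no matrix of rank one, while the determinant has a nontrivial zero on every
two-dimensional complex space of matrices. Hence the kernel of 𝒜 is trivial or a line spanned by an
invertible M. The cofactor matrix of a gradient is divergence free, so for every constant matrix K
the maps Q ↦ Q eₖ - K cof(Q) eₖ turn Du into fields whose divergence is Δu. With K = M Mᵀ / det M
they annihilate M and therefore factor through 𝒜. This gives constant linear maps bₖ with ∑ₖ ∂ₖ
bₖ(𝒜[Du]) = Δu (`exists_factorsLaplacian`). Korn's inequality in L² follows by integration by parts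
(`FactorsLaplacian.korn`).

Write P for 𝒜[Dv_j]. The Ekeland inequality says that v_j solves the Euler-Lagrange system of f_j up
to an error (1/j)‖φ‖ in the norm of W^{-2,1} (`abs_integral_stress_le`). The decisive test field is
φ = ∑ₖ ∂ₖ(q bₖ P) with q = ρ⁴. On the one hand φ = Δ(q v) - ∑ₖ ∂ₖ bₖ(∑ₗ ∂ₗq aₗ v), where 𝒜[Dv] = ∑ₗ
aₗ ∂ₗv. So φ consists of derivatives of order at most two of expressions in v alone, and the Ekeland
error costs only ∫|v|; the full gradient of v, which 𝒜[Dv] does not control in L¹, never enters. On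
the other hand 𝒜[Dφ] is expressed by P: it is ∑ₖ ∂ₖ(q ∂ₖP) up to terms carrying derivatives of q
(`gradA_testField`).

An integration by parts then produces the Hessian form of the theorem and two remainders. The one
with ∂q is absorbed by the Cauchy-Schwarz inequality for the Hessian, and the decay Λ(1+|P|²)^{-1/2}
makes what is left linear in |P|. The one with ∂²q needs a bound for the stress that depends on Λ
only. Constants are invisible to compactly supported test fields, so a bound for Df(P) - Df(0)
suffices. It is obtained by integrating D²f along half circles and using convexity
(`norm_fderiv_sub_fderiv_zero_le`); this needs the range of 𝒜 to have dimension at least two, which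
ellipticity guarantees.

Before this, ∂ₖP has to be shown to exist in L²_loc. The quadratic term in f_j gives strong
monotonicity, so difference quotients can be used (`IsAlmostSolution.exists_difference_bound`). The
Ekeland error, which is merely linear in the test field, is made quadratic in the step size by
Young's and Korn's inequalities. Test fields must be smooth, so v is mollified throughout. The local
bounds for the gradients of these mollifications come from Korn's inequality for v - u^{∂Ω} and from
u^{∂Ω} ∈ W^{1,2} (`FactorsLaplacian.exists_grad_bound`). -/

namespace WSO

/-! ### Calculus of partial derivatives -/

section PartialDerivatives

variable {F : Type*} [NormedAddCommGroup F] [NormedSpace ℝ F]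
variable {F' : Type*} [NormedAddCommGroup F'] [NormedSpace ℝ F']
variable {F'' : Type*} [NormedAddCommGroup F''] [NormedSpace ℝ F'']

theorem contDiff_pd {φ : E → F} (hφ : ContDiff ℝ ∞ φ) (k : Fin 2) : ContDiff ℝ ∞ (pd k φ) :=
  (hφ.fderiv_right (m := ∞) (by simp)).clm_apply contDiff_const

theorem differentiable_of_smooth {φ : E → F} (hφ : ContDiff ℝ ∞ φ) : Differentiable ℝ φ :=
  hφ.differentiable (by simp)

theorem continuous_pd {φ : E → F} (hφ : ContDiff ℝ 1 φ) (k : Fin 2) : Continuous (pd k φ) :=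
  (hφ.continuous_fderiv one_ne_zero).clm_apply continuous_const

theorem pd_add {φ ψ : E → F} {x : E} (hφ : DifferentiableAt ℝ φ x) (hψ : DifferentiableAt ℝ ψ x)
    (k : Fin 2) : pd k (fun y => φ y + ψ y) x = pd k φ x + pd k ψ x := by
  simp [pd, fderiv_fun_add hφ hψ]

theorem pd_sub {φ ψ : E → F} {x : E} (hφ : DifferentiableAt ℝ φ x) (hψ : DifferentiableAt ℝ ψ x)
    (k : Fin 2) : pd k (fun y => φ y - ψ y) x = pd k φ x - pd k ψ x := by
  simp [pd, fderiv_fun_sub hφ hψ]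

theorem pd_sum {ι : Type*} {s : Finset ι} {φ : ι → E → F} {x : E}
    (hφ : ∀ i ∈ s, DifferentiableAt ℝ (φ i) x) (k : Fin 2) :
    pd k (fun y => ∑ i ∈ s, φ i y) x = ∑ i ∈ s, pd k (φ i) x := by
  simp [pd, fderiv_fun_sum hφ]

theorem pd_smul {φ : E → ℝ} {ψ : E → F} {x : E} (hφ : DifferentiableAt ℝ φ x)
    (hψ : DifferentiableAt ℝ ψ x) (k : Fin 2) :
    pd k (fun y => φ y • ψ y) x = pd k φ x • ψ x + φ x • pd k ψ x := by
  simp [pd, fderiv_fun_smul hφ hψ, add_comm]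

theorem pd_clm (T : F →L[ℝ] F') {φ : E → F} {x : E} (hφ : DifferentiableAt ℝ φ x) (k : Fin 2) :
    pd k (fun y => T (φ y)) x = T (pd k φ x) := by
  have h := (T.hasFDerivAt.comp x hφ.hasFDerivAt).fderiv
  simp only [Function.comp_def] at h
  simp [pd, h]

theorem pd_const_smul (c : ℝ) {φ : E → F} {x : E} (hφ : DifferentiableAt ℝ φ x) (k : Fin 2) :
    pd k (fun y => c • φ y) x = c • pd k φ x := by
  simp [pd, fderiv_fun_const_smul hφ]

theorem pd_comp_add_right (φ : E → F) (h x : E) (k : Fin 2) :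
    pd k (fun y => φ (y + h)) x = pd k φ (x + h) := by
  simp [pd, fderiv_comp_add_right]

theorem pd_comm {φ : E → F} (hφ : ContDiff ℝ ∞ φ) (k l : Fin 2) (x : E) :
    pd k (pd l φ) x = pd l (pd k φ) x := by
  have h2 : ∀ m n : Fin 2, pd m (pd n φ) x =
      fderiv ℝ (fderiv ℝ φ) x (EuclideanSpace.single m 1) (EuclideanSpace.single n 1) := by
    intro m n
    have hd : DifferentiableAt ℝ (fderiv ℝ φ) x :=
      (hφ.fderiv_right (m := ∞) (by simp)).differentiable (by simp) x
    have := hd.hasFDerivAt.clm_apply (hasFDerivAt_const (EuclideanSpace.single n (1 : ℝ)) x)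
    change fderiv ℝ (fun y => fderiv ℝ φ y (EuclideanSpace.single n 1)) x _ = _
    rw [this.fderiv]
    simp
  rw [h2, h2]
  exact (hφ.contDiffAt.isSymmSndFDerivAt (by simpa using ENat.LEInfty.out)) _ _

theorem pd_eq_zero_of_notMem {φ : E → F} {x : E} (hx : x ∉ tsupport φ) (k : Fin 2) :
    pd k φ x = 0 := by
  have : fderiv ℝ φ x = 0 := by
    by_contra h
    exact hx (support_fderiv_subset ℝ h)
  simp [pd, this]

theorem tsupport_pd_subset (φ : E → F) (k : Fin 2) : tsupport (pd k φ) ⊆ tsupport φ := by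
  refine closure_minimal (fun x hx => ?_) (isClosed_tsupport _)
  by_contra h
  exact hx (pd_eq_zero_of_notMem h k)

theorem hasCompactSupport_pd {φ : E → F} (hφ : HasCompactSupport φ) (k : Fin 2) :
    HasCompactSupport (pd k φ) :=
  hφ.of_isClosed_subset (isClosed_tsupport _) (tsupport_pd_subset φ k)

theorem IsTest.pd {Ω : Set E} {φ : E → F} (hφ : IsTest Ω φ) (k : Fin 2) : IsTest Ω (pd k φ) :=
  ⟨contDiff_pd hφ.1 k, hasCompactSupport_pd hφ.2.1 k, (tsupport_pd_subset φ k).trans hφ.2.2⟩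

theorem IsTest.mono {Ω Ω' : Set E} {φ : E → F} (hφ : IsTest Ω φ) (h : Ω ⊆ Ω') : IsTest Ω' φ :=
  ⟨hφ.1, hφ.2.1, hφ.2.2.trans h⟩

theorem IsTest.continuous {Ω : Set E} {φ : E → F} (hφ : IsTest Ω φ) : Continuous φ :=
  hφ.1.continuous

theorem IsTest.of_tsupport {Ω : Set E} {φ : E → F} {ψ : E → F'} (hφ : IsTest Ω φ)
    (hψ : ContDiff ℝ ∞ ψ) (h : ∀ x, x ∉ tsupport φ → ψ x = 0) : IsTest Ω ψ := by
  have hs : tsupport ψ ⊆ tsupport φ := by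
    refine closure_minimal (fun x hx => ?_) (isClosed_tsupport _)
    by_contra hx'
    exact hx (h x hx')
  exact ⟨hψ, hφ.2.1.of_isClosed_subset (isClosed_tsupport _) hs, hs.trans hφ.2.2⟩

theorem IsTest.add {Ω : Set E} {φ ψ : E → F} (hφ : IsTest Ω φ) (hψ : IsTest Ω ψ) :
    IsTest Ω (fun x => φ x + ψ x) :=
  ⟨hφ.1.add hψ.1, hφ.2.1.add hψ.2.1,
    (tsupport_add φ ψ).trans (Set.union_subset hφ.2.2 hψ.2.2)⟩

theorem IsTest.clm {Ω : Set E} {φ : E → F} (hφ : IsTest Ω φ) (T : F →L[ℝ] F') :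
    IsTest Ω (fun x => T (φ x)) :=
  hφ.of_tsupport (T.contDiff.comp hφ.1) fun x hx => by simp [image_eq_zero_of_notMem_tsupport hx]

theorem IsTest.smul_left {Ω : Set E} {φ : E → ℝ} {ψ : E → F} (hφ : IsTest Ω φ)
    (hψ : ContDiff ℝ ∞ ψ) : IsTest Ω (fun x => φ x • ψ x) :=
  hφ.of_tsupport (hφ.1.smul hψ) fun x hx => by simp [image_eq_zero_of_notMem_tsupport hx]

theorem IsTest.const_smul {Ω : Set E} {φ : E → F} (hφ : IsTest Ω φ) (c : ℝ) :
    IsTest Ω (fun x => c • φ x) :=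
  hφ.of_tsupport (contDiff_const.smul hφ.1) fun x hx => by
    simp [image_eq_zero_of_notMem_tsupport hx]

theorem IsTest.sub {Ω : Set E} {φ ψ : E → F} (hφ : IsTest Ω φ) (hψ : IsTest Ω ψ) :
    IsTest Ω (fun x => φ x - ψ x) := by
  simpa [sub_eq_add_neg] using hφ.add (hψ.const_smul (-1))

theorem isTest_zero (Ω : Set E) : IsTest Ω (fun _ : E => (0 : F)) :=
  ⟨contDiff_const, HasCompactSupport.zero, by
    have : tsupport (fun _ : E => (0 : F)) = ∅ := tsupport_eq_empty_iff.2 rfl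
    simp [this]⟩

theorem IsTest.sum {Ω : Set E} {ι : Type*} (s : Finset ι) {φ : ι → E → F}
    (hφ : ∀ i, IsTest Ω (φ i)) : IsTest Ω (fun x => ∑ i ∈ s, φ i x) := by
  classical
  induction s using Finset.induction_on with
  | empty => simpa using isTest_zero Ω
  | insert i s hi ih =>
    simp only [Finset.sum_insert hi]
    exact (hφ i).add ih

theorem IsTest.eq_zero_of_notMem {Ω : Set E} {φ : E → F} (hφ : IsTest Ω φ) {x : E} (hx : x ∉ Ω) :
    φ x = 0 :=
  image_eq_zero_of_notMem_tsupport fun h => hx (hφ.2.2 h)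

theorem IsTest.integrable {Ω : Set E} {φ : E → F} (hφ : IsTest Ω φ) : Integrable φ :=
  hφ.continuous.integrable_of_hasCompactSupport hφ.2.1

theorem IsTest.memLp {Ω : Set E} {φ : E → F} (hφ : IsTest Ω φ) (p : ℝ≥0∞) : MemLp φ p :=
  hφ.continuous.memLp_of_hasCompactSupport hφ.2.1

theorem IsTest.bounded {Ω : Set E} {φ : E → F} (hφ : IsTest Ω φ) : ∃ C : ℝ, 0 ≤ C ∧ ∀ x, ‖φ x‖ ≤ C := by
  obtain ⟨C, hC⟩ := hφ.2.1.exists_bound_of_continuous hφ.continuous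
  exact ⟨C, (norm_nonneg _).trans (hC 0), hC⟩

/-- Integration by parts, if the first factor has compact support. -/
theorem integral_bilin_pd (B : F →L[ℝ] F' →L[ℝ] F'') {φ : E → F} {ψ : E → F'}
    (hφ : ContDiff ℝ 1 φ) (hψ : ContDiff ℝ 1 ψ) (hc : HasCompactSupport φ) (k : Fin 2) :
    ∫ x, B (φ x) (pd k ψ x) = -∫ x, B (pd k φ x) (ψ x) := by
  refine integral_bilinear_fderiv_right_eq_neg_left_of_integrable (μ := volume)
    (v := EuclideanSpace.single k (1 : ℝ)) ?_ ?_ ?_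
    (fun x _ => hφ.differentiable one_ne_zero x) (fun x _ => hψ.differentiable one_ne_zero x)
  · refine Continuous.integrable_of_hasCompactSupport ?_ ?_
    · exact (B.continuous.comp (continuous_pd hφ k)).clm_apply hψ.continuous
    · exact (hasCompactSupport_pd hc k).mono (fun x hx h => hx (by
        have h' : fderiv ℝ φ x (EuclideanSpace.single k 1) = 0 := h
        simp [h']))
  · refine Continuous.integrable_of_hasCompactSupport ?_ ?_
    · exact (B.continuous.comp hφ.continuous).clm_apply (continuous_pd hψ k)
    · exact hc.mono (fun x hx h => hx (by simp [h]))
  · refine Continuous.integrable_of_hasCompactSupport ?_ ?_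
    · exact (B.continuous.comp hφ.continuous).clm_apply hψ.continuous
    · exact hc.mono (fun x hx h => hx (by simp [h]))

theorem integral_pd_eq_zero {φ : E → F} (hφ : ContDiff ℝ 1 φ)
    (hc : HasCompactSupport φ) (k : Fin 2) : ∫ x, pd k φ x = 0 := by
  have h := integral_bilin_pd (ContinuousLinearMap.lsmul ℝ ℝ (E := F)).flip hφ
    (contDiff_const (c := (1 : ℝ))) hc k
  have h0 : ∀ x, pd k (fun _ : E => (1 : ℝ)) x = 0 := fun x => by simp [pd]
  simp [h0] at h
  exact h

theorem integral_smul_pd {φ : E → ℝ} {ψ : E → F} (hφ : ContDiff ℝ 1 φ) (hψ : ContDiff ℝ 1 ψ)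
    (hc : HasCompactSupport φ) (k : Fin 2) :
    ∫ x, φ x • pd k ψ x = -∫ x, pd k φ x • ψ x :=
  integral_bilin_pd (ContinuousLinearMap.lsmul ℝ ℝ) hφ hψ hc k

theorem gradient_apply_eq_pd {φ : E → ℝ} {x : E} (k : Fin 2) : gradient φ x k = pd k φ x := by
  have h1 : inner ℝ (gradient φ x) (EuclideanSpace.single k (1 : ℝ)) = pd k φ x := by
    simp [gradient, pd, InnerProductSpace.toDual_symm_apply]
  rw [← h1, EuclideanSpace.inner_single_right]
  simp

end PartialDerivatives

/-! ### Bilinear maps of square integrable functions -/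

section Bilinear

variable {F : Type*} [NormedAddCommGroup F] [NormedSpace ℝ F]
variable {F' : Type*} [NormedAddCommGroup F'] [NormedSpace ℝ F']
variable {F'' : Type*} [NormedAddCommGroup F''] [NormedSpace ℝ F'']
variable {X : Type*} [MeasurableSpace X] {μ : Measure X}

theorem integrable_bilin (B : F →L[ℝ] F' →L[ℝ] F'') {f : X → F} {g : X → F'}
    (hf : MemLp f 2 μ) (hg : MemLp g 2 μ) : Integrable (fun x => B (f x) (g x)) μ := by
  rw [← memLp_one_iff_integrable]
  refine MemLp.of_bilin (p := 2) (q := 2) (fun u v => B u v) ‖B‖₊ hf hg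
    (B.aestronglyMeasurable_comp₂ hf.1 hg.1) (Filter.Eventually.of_forall fun x => ?_)
  exact B.le_opNorm₂ _ _

theorem integrable_inner_of_memLp {H : Type*} [NormedAddCommGroup H] [InnerProductSpace ℝ H]
    {f g : X → H} (hf : MemLp f 2 μ) (hg : MemLp g 2 μ) :
    Integrable (fun x => inner ℝ (f x) (g x)) μ :=
  integrable_bilin (innerSL ℝ) hf hg

theorem integrable_norm_sq {H : Type*} [NormedAddCommGroup H] {f : X → H}
    (hf : MemLp f 2 μ) : Integrable (fun x => ‖f x‖ ^ 2) μ :=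
  hf.integrable_norm_pow (by norm_num)

end Bilinear

/-! ### Elliptic systems of first order -/

section Elliptic

variable {W : Type*} [NormedAddCommGroup W] [InnerProductSpace ℝ W]

/-- The first order operator `∑ₖ aₖ ∂ₖ`. -/
noncomputable def gradA (a : Fin 2 → E →L[ℝ] W) (u : E → E) (x : E) : W := ∑ k, a k (pd k u x)

/-- `∑ₖ bₖ ∂ₖ` is a left factor of the Laplacian with right factor `∑ₖ aₖ ∂ₖ`. -/
def FactorsLaplacian (a : Fin 2 → E →L[ℝ] W) (b : Fin 2 → W →L[ℝ] E) : Prop :=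
  ∀ k l x, b k (a l x) + b l (a k x) = if k = l then (2 : ℝ) • x else 0

variable {a : Fin 2 → E →L[ℝ] W} {b : Fin 2 → W →L[ℝ] E}

theorem contDiff_gradA {u : E → E} (hu : ContDiff ℝ ∞ u) : ContDiff ℝ ∞ (gradA a u) :=
  ContDiff.sum fun k _ => (a k).contDiff.comp (contDiff_pd hu k)

theorem IsTest.gradA {Ω : Set E} {φ : E → E} (hφ : IsTest Ω φ) : IsTest Ω (gradA a φ) :=
  IsTest.sum _ fun k => (hφ.pd k).clm (a k)

theorem pd_gradA {u : E → E} (hu : ContDiff ℝ ∞ u) (k : Fin 2) (x : E) :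
    pd k (gradA a u) x = gradA a (pd k u) x := by
  have h : ∀ l, Differentiable ℝ (pd l u) := fun l => differentiable_of_smooth (contDiff_pd hu l)
  unfold gradA
  rw [pd_sum fun l _ => (a l).differentiableAt.fun_comp' x (h l x)]
  refine Finset.sum_congr rfl fun l _ => ?_
  rw [pd_clm _ (h l x), pd_comm hu]

/-- Second derivatives commute, so only the part of b_k a_l that is symmetric in k and l matters,
and that part is prescribed. -/
theorem FactorsLaplacian.sum_pd (hab : FactorsLaplacian a b) {u : E → E} (hu : ContDiff ℝ ∞ u)
    (x : E) : ∑ k, b k (pd k (WSO.gradA a u) x) = ∑ k, pd k (pd k u) x := by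
  simp only [pd_gradA hu, WSO.gradA, Fin.sum_univ_two]
  have h00 := hab 0 0 (pd 0 (pd 0 u) x)
  have h11 := hab 1 1 (pd 1 (pd 1 u) x)
  have h01 := hab 0 1 (pd 0 (pd 1 u) x)
  simp only [if_true, if_neg (show ¬ (0 : Fin 2) = 1 by decide), ← two_smul ℝ] at h00 h11 h01
  have h00' := smul_right_injective E (two_ne_zero (α := ℝ)) h00
  have h11' := smul_right_injective E (two_ne_zero (α := ℝ)) h11
  simp only [map_add]
  rw [h00', h11', pd_comm hu 1 0]
  linear_combination (norm := module) h01

/-- Korn's inequality for compactly supported smooth functions. -/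
theorem FactorsLaplacian.korn (hab : FactorsLaplacian a b) {u : E → E} {Ω : Set E}
    (hu : IsTest Ω u) (l : Fin 2) :
    ∫ x, ‖pd l u x‖ ^ 2 ≤ (∑ k, ‖b k‖ ^ 2) * ∫ x, ‖WSO.gradA a u x‖ ^ 2 := by
  have hG : IsTest Ω (WSO.gradA a u) := hu.gradA
  have hGi : Integrable fun x => ‖WSO.gradA a u x‖ ^ 2 :=
    integrable_norm_sq (hG.memLp 2)
  have hbi : ∀ k, Integrable fun x => inner ℝ (pd k u x) (b k (WSO.gradA a u x)) := fun k =>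
    integrable_inner_of_memLp ((hu.pd k).memLp 2) ((hG.clm (b k)).memLp 2)
  have hi1 : ∀ k, Integrable fun x => inner ℝ (u x) (b k (pd k (WSO.gradA a u) x)) := fun k =>
    integrable_inner_of_memLp (hu.memLp 2) (((hG.pd k).clm (b k)).memLp 2)
  have hi2 : ∀ k, Integrable fun x => inner ℝ (u x) (pd k (pd k u) x) := fun k =>
    integrable_inner_of_memLp (hu.memLp 2) (((hu.pd k).pd k).memLp 2)
  have c1 : ∀ {F : Type _} [NormedAddCommGroup F] [NormedSpace ℝ F] {φ : E → F}, IsTest Ω φ →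
      ContDiff ℝ 1 φ := fun h => h.1.of_le (by simp)
  have h1 : ∀ k, ∫ x, ‖pd k u x‖ ^ 2 = -∫ x, inner ℝ (u x) (pd k (pd k u) x) := fun k => by
    have := integral_bilin_pd (innerSL ℝ) (c1 hu) (c1 (hu.pd k)) hu.2.1 k
    change (∫ x, inner ℝ (u x) (pd k (pd k u) x)) = -∫ x, inner ℝ (pd k u x) (pd k u x) at this
    simp [this]
  have h2 : ∀ k, ∫ x, inner ℝ (pd k u x) (b k (WSO.gradA a u x)) =
      -∫ x, inner ℝ (u x) (b k (pd k (WSO.gradA a u) x)) := fun k => by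
    have := integral_bilin_pd (innerSL ℝ) (c1 hu) (c1 (hG.clm (b k))) hu.2.1 k
    simp only [pd_clm (b k) (differentiable_of_smooth hG.1 _)] at this
    change (∫ x, inner ℝ (u x) (b k (pd k (WSO.gradA a u) x))) =
      -∫ x, inner ℝ (pd k u x) (b k (WSO.gradA a u x)) at this
    linarith
  -- Both sides equal the negative of the integral of ⟨u, Δu⟩, the right one because the maps `b k`
  -- recover the Laplacian from `gradA a u`. Young's inequality then absorbs half of the left side.
  have key : ∑ k, ∫ x, ‖pd k u x‖ ^ 2 =
      ∑ k, ∫ x, inner ℝ (pd k u x) (b k (WSO.gradA a u x)) := by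
    simp only [h1, h2, Finset.sum_neg_distrib]
    rw [← integral_finsetSum _ fun k _ => hi1 k, ← integral_finsetSum _ fun k _ => hi2 k]
    simp only [← inner_sum, hab.sum_pd hu.1]
  have bd : ∀ k, ∫ x, inner ℝ (pd k u x) (b k (WSO.gradA a u x)) ≤
      (1 / 2) * (∫ x, ‖pd k u x‖ ^ 2) + (1 / 2) * ‖b k‖ ^ 2 * ∫ x, ‖WSO.gradA a u x‖ ^ 2 := fun k => by
    rw [← integral_const_mul, ← integral_const_mul,
      ← integral_add ((integrable_norm_sq ((hu.pd k).memLp 2)).const_mul _)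
      (hGi.const_mul _)]
    refine integral_mono (hbi k)
      (((integrable_norm_sq ((hu.pd k).memLp 2)).const_mul _).add (hGi.const_mul _)) fun x => ?_
    have e1 := real_inner_le_norm (pd k u x) (b k (WSO.gradA a u x))
    have e2 := (b k).le_opNorm (WSO.gradA a u x)
    have e3 : ‖b k (WSO.gradA a u x)‖ ^ 2 ≤ (‖b k‖ * ‖WSO.gradA a u x‖) ^ 2 := by gcongr
    simp only
    nlinarith [sq_nonneg (‖pd k u x‖ - ‖b k (WSO.gradA a u x)‖)]
  have hn : ∀ k, 0 ≤ ∫ x, ‖pd k u x‖ ^ 2 := fun k => integral_nonneg fun x => by positivity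
  have hb := Finset.sum_le_sum (s := Finset.univ) fun k _ => bd k
  rw [← key, Finset.sum_add_distrib, ← Finset.mul_sum, ← Finset.sum_mul, ← Finset.mul_sum] at hb
  have hl := Finset.single_le_sum (s := Finset.univ) (fun k _ => hn k) (Finset.mem_univ l)
  linarith

/-- The test function by which the elliptic system is tested in the second order estimate. -/
noncomputable def testField (a : Fin 2 → E →L[ℝ] W) (b : Fin 2 → W →L[ℝ] E)
    (q : E → ℝ) (u : E → E) (x : E) : E :=
  ∑ k, pd k (pd k fun y => q y • u y) x -
    ∑ k, pd k (fun y => b k (∑ l, pd l q y • a l (u y))) x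

/-- The field has two faces. Its definition involves derivatives of expressions in `u` only, which
suits the negative Sobolev norm; the present form involves `u` only through `gradA a u`, which suits
the growth conditions. They differ by the commutator of `gradA a` with multiplication by `q`. -/
theorem testField_eq (hab : FactorsLaplacian a b) {q : E → ℝ} {u : E → E} (hq : ContDiff ℝ ∞ q)
    (hu : ContDiff ℝ ∞ u) (x : E) :
    testField a b q u x = ∑ k, pd k (fun y => q y • b k (gradA a u y)) x := by
  have hqu : ContDiff ℝ ∞ fun y => q y • u y := hq.smul hu
  have hS : ContDiff ℝ ∞ fun y => ∑ l, pd l q y • a l (u y) :=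
    ContDiff.sum fun l _ => (contDiff_pd hq l).smul ((a l).contDiff.comp hu)
  have hG := contDiff_gradA (a := a) hqu
  unfold testField
  rw [← hab.sum_pd hqu, ← Finset.sum_sub_distrib]
  refine Finset.sum_congr rfl fun k _ => ?_
  rw [← pd_clm (b k) (differentiable_of_smooth hG x), ← pd_sub
    ((b k).differentiableAt.fun_comp' x (differentiable_of_smooth hG x))
    ((b k).differentiableAt.fun_comp' x (differentiable_of_smooth hS x))]
  congr 1
  funext y
  rw [← map_sub, ← map_smul]
  congr 1
  unfold gradA
  rw [← Finset.sum_sub_distrib, Finset.smul_sum]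
  refine Finset.sum_congr rfl fun l _ => ?_
  rw [pd_smul (differentiable_of_smooth hq y) (differentiable_of_smooth hu y)]
  simp

/-- The lower order coefficients `Zₖ`. -/
noncomputable def coeffZ (a : Fin 2 → E →L[ℝ] W) (b : Fin 2 → W →L[ℝ] E) (k l : Fin 2) : W →L[ℝ] W :=
  a l ∘L b k + a k ∘L b l - if k = l then ContinuousLinearMap.id ℝ W else 0

/-- The zeroth order coefficients. -/
noncomputable def coeffY (a : Fin 2 → E →L[ℝ] W) (b : Fin 2 → W →L[ℝ] E) (k l : Fin 2) : W →L[ℝ] W :=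
  a l ∘L b k - if k = l then ContinuousLinearMap.id ℝ W else 0

/-- The terms are arranged so that, after one integration by parts, only first derivatives of P =
`gradA a u` remain and the leading one is diagonal in k. Every other term carries a derivative of
`q`; `coeffZ` collects the coefficients that stay in divergence form, and `coeffY` corrects for the
second derivatives of `q` produced in doing so. -/
theorem gradA_testField (hab : FactorsLaplacian a b) {q : E → ℝ} {u : E → E} (hq : ContDiff ℝ ∞ q)
    (hu : ContDiff ℝ ∞ u) (x : E) :
    gradA a (testField a b q u) x =
      ∑ k, pd k (fun y => q y • pd k (gradA a u) y) x
        + ∑ k, pd k (fun y => ∑ l, pd l q y • coeffZ a b k l (gradA a u y)) x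
        - ∑ k, ∑ l, pd k (pd l q) x • coeffY a b k l (gradA a u x) := by
  set P := gradA a u with hP
  have sP : ContDiff ℝ ∞ P := contDiff_gradA hu
  have dq := differentiable_of_smooth hq
  have dP := differentiable_of_smooth sP
  have dq1 : ∀ k, Differentiable ℝ (pd k q) := fun k => differentiable_of_smooth (contDiff_pd hq k)
  have dP1 : ∀ k, Differentiable ℝ (pd k P) := fun k => differentiable_of_smooth (contDiff_pd sP k)
  have dB : ∀ (T : W →L[ℝ] E) {φ : E → W}, Differentiable ℝ φ → Differentiable ℝ fun y => T (φ y) :=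
    fun T φ h => T.differentiable.comp h
  have dC : ∀ (T : W →L[ℝ] W) {φ : E → W}, Differentiable ℝ φ → Differentiable ℝ fun y => T (φ y) :=
    fun T φ h => T.differentiable.comp h
  have hT : testField a b q u = fun y => ∑ k, (pd k q y • b k (P y) + q y • b k (pd k P y)) := by
    funext y
    rw [testField_eq hab hq hu]
    refine Finset.sum_congr rfl fun k _ => ?_
    rw [pd_smul (dq y) (dB (b k) dP y), pd_clm _ (dP y)]
  -- This is not an identity between coefficients: it holds because P is in the range of `gradA a`.
  -- The inner operator turns P into Δu, and `gradA a` commutes with Δ.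
  have hL : ∑ k, ∑ l, a l (b k (pd l (pd k P) x)) = ∑ k, pd k (pd k P) x := by
    rw [Finset.sum_comm]
    have hlap : ContDiff ℝ ∞ fun y => ∑ k, pd k (pd k u) y :=
      ContDiff.sum fun k _ => contDiff_pd (contDiff_pd hu k) k
    have e1 : (fun y => ∑ k, b k (pd k P y)) = fun y => ∑ k, pd k (pd k u) y := by
      funext y
      exact hab.sum_pd hu y
    have e2 : ∀ l, ∑ k, a l (b k (pd l (pd k P) x)) =
        a l (pd l (fun y => ∑ k, pd k (pd k u) y) x) := fun l => by
      rw [← e1, pd_sum fun k _ => dB (b k) (dP1 k) x, map_sum]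
      exact Finset.sum_congr rfl fun k _ => by rw [pd_clm _ (dP1 k x)]
    simp only [e2]
    change gradA a (fun y => ∑ k, pd k (pd k u) y) x = _
    have e3 : ∀ k, pd k (pd k P) x = gradA a (pd k (pd k u)) x := fun k => by
      have : pd k P = gradA a (pd k u) := funext fun y => pd_gradA hu k y
      rw [this, pd_gradA (contDiff_pd hu k)]
    simp only [e3, gradA]
    rw [Finset.sum_comm]
    refine Finset.sum_congr rfl fun l _ => ?_
    rw [pd_sum fun k _ => differentiable_of_smooth (contDiff_pd (contDiff_pd hu k) k) x, map_sum]
  have hlhs : gradA a (testField a b q u) x = ∑ l, ∑ k, (pd l (pd k q) x • a l (b k (P x))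
      + pd k q x • a l (b k (pd l P x)) + pd l q x • a l (b k (pd k P x))
      + q x • a l (b k (pd l (pd k P) x))) := by
    rw [hT]
    unfold gradA
    refine Finset.sum_congr rfl fun l _ => ?_
    rw [pd_sum fun k _ => ((dq1 k x).fun_smul (dB (b k) dP x)).fun_add ((dq x).fun_smul (dB (b k) (dP1 k) x)),
      map_sum]
    refine Finset.sum_congr rfl fun k _ => ?_
    rw [pd_add ((dq1 k x).fun_smul (dB (b k) dP x)) ((dq x).fun_smul (dB (b k) (dP1 k) x)),
      pd_smul (dq1 k x) (dB (b k) dP x), pd_smul (dq x) (dB (b k) (dP1 k) x), pd_clm _ (dP x),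
      pd_clm _ (dP1 k x)]
    simp only [map_add, map_smul]
    abel
  have h1 : ∀ k, pd k (fun y => q y • pd k P y) x = pd k q x • pd k P x + q x • pd k (pd k P) x :=
    fun k => pd_smul (dq x) (dP1 k x) k
  have h2 : ∀ k, pd k (fun y => ∑ l, pd l q y • coeffZ a b k l (P y)) x =
      ∑ l, (pd k (pd l q) x • coeffZ a b k l (P x) + pd l q x • coeffZ a b k l (pd k P x)) := by
    intro k
    rw [pd_sum fun l _ => (dq1 l x).fun_smul (dC (coeffZ a b k l) dP x)]
    refine Finset.sum_congr rfl fun l _ => ?_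
    rw [pd_smul (dq1 l x) (dC (coeffZ a b k l) dP x), pd_clm _ (dP x)]
  rw [hlhs]
  simp only [h1, h2]
  simp only [coeffZ, coeffY, Fin.sum_univ_two] at hL ⊢
  simp only [_root_.sub_apply, _root_.add_apply,
    ContinuousLinearMap.comp_apply, if_true, if_neg (show ¬ (0 : Fin 2) = 1 by decide),
    if_neg (show ¬ (1 : Fin 2) = 0 by decide), ContinuousLinearMap.id_apply,
    _root_.zero_apply, pd_comm hq 1 0] at hL ⊢
  linear_combination (norm := module) (q x) • hL

end Elliptic

end WSO

namespace WSO

open Filter Topology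

/-! ### Convergence in `Lᵖ` -/

section LpConvergence

variable {F : Type*} [NormedAddCommGroup F] [NormedSpace ℝ F]
variable {F' : Type*} [NormedAddCommGroup F'] [NormedSpace ℝ F']
variable {F'' : Type*} [NormedAddCommGroup F''] [NormedSpace ℝ F'']

/-- Convergence of a sequence of functions on the plane in `Lᵖ`. -/
structure LpTendsto {H : Type*} [NormedAddCommGroup H] (p : ℝ≥0∞) (X : ℕ → E → H) (Y : E → H) :
    Prop where
  memLp : ∀ n, MemLp (X n) p
  memLp_lim : MemLp Y p
  tendsto : Tendsto (fun n => eLpNorm (fun x => X n x - Y x) p) atTop (𝓝 0)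

theorem memLp_clm_apply {p : ℝ≥0∞} {w : E → F →L[ℝ] F'} {C : ℝ} {X : E → F}
    (hw : AEStronglyMeasurable w) (hC : ∀ x, ‖w x‖ ≤ C) (hX : MemLp X p) :
    MemLp (fun x => w x (X x)) p := by
  refine MemLp.of_le_mul (c := C) hX ?_ (Eventually.of_forall fun x => ?_)
  · exact (ContinuousLinearMap.apply ℝ F').flip.aestronglyMeasurable_comp₂ hw hX.1
  · exact (w x).le_of_opNorm_le (hC x) _

theorem LpTendsto.clm_apply {p : ℝ≥0∞} {X : ℕ → E → F} {Y : E → F} (h : LpTendsto p X Y)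
    {w : E → F →L[ℝ] F'} {C : ℝ} (hw : AEStronglyMeasurable w) (hC : ∀ x, ‖w x‖ ≤ C) :
    LpTendsto p (fun n x => w x (X n x)) (fun x => w x (Y x)) := by
  refine ⟨fun n => memLp_clm_apply hw hC (h.memLp n), memLp_clm_apply hw hC h.memLp_lim, ?_⟩
  have hb : ∀ n, eLpNorm (fun x => w x (X n x) - w x (Y x)) p ≤
      ENNReal.ofReal C * eLpNorm (fun x => X n x - Y x) p := fun n => by
    refine eLpNorm_le_mul_eLpNorm_of_ae_le_mul (Eventually.of_forall fun x => ?_) p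
    rw [← map_sub]
    exact (w x).le_of_opNorm_le (hC x) _
  refine tendsto_of_tendsto_of_tendsto_of_le_of_le tendsto_const_nhds ?_ (fun _ => zero_le) hb
  simpa using ENNReal.Tendsto.const_mul h.tendsto (Or.inr ENNReal.ofReal_ne_top)

theorem LpTendsto.smul {p : ℝ≥0∞} {X : ℕ → E → F} {Y : E → F} (h : LpTendsto p X Y)
    {w : E → ℝ} {C : ℝ} (hw : AEStronglyMeasurable w) (hC : ∀ x, ‖w x‖ ≤ C) :
    LpTendsto p (fun n x => w x • X n x) (fun x => w x • Y x) := by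
  have hC0 : 0 ≤ C := (norm_nonneg _).trans (hC 0)
  refine h.clm_apply (w := fun x => w x • ContinuousLinearMap.id ℝ F) (C := C)
    (hw.smul_const _) fun x => ?_
  rw [norm_smul]
  have := ContinuousLinearMap.norm_id_le (𝕜 := ℝ) (E := F)
  nlinarith [hC x, norm_nonneg (w x)]

theorem LpTendsto.sub {H : Type*} [NormedAddCommGroup H] {p : ℝ≥0∞} (hp : 1 ≤ p)
    {X X' : ℕ → E → H} {Y Y' : E → H}
    (h : LpTendsto p X Y) (h' : LpTendsto p X' Y') :
    LpTendsto p (fun n x => X n x - X' n x) (fun x => Y x - Y' x) := by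
  refine ⟨fun n => (h.memLp n).sub (h'.memLp n), h.memLp_lim.sub h'.memLp_lim, ?_⟩
  have hb : ∀ n, eLpNorm (fun x => X n x - X' n x - (Y x - Y' x)) p ≤
      eLpNorm (fun x => X n x - Y x) p + eLpNorm (fun x => X' n x - Y' x) p := fun n => by
    have e : (fun x => X n x - X' n x - (Y x - Y' x)) =
        (fun x => X n x - Y x) - fun x => X' n x - Y' x := by
      funext x
      simp only [Pi.sub_apply]
      abel
    rw [e]
    exact eLpNorm_sub_le ((h.memLp n).sub h.memLp_lim).1 ((h'.memLp n).sub h'.memLp_lim).1 hp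
  refine tendsto_of_tendsto_of_tendsto_of_le_of_le tendsto_const_nhds ?_ (fun _ => zero_le) hb
  simpa using h.tendsto.add h'.tendsto

theorem memLp_comp_add_right {H : Type*} [NormedAddCommGroup H] {p : ℝ≥0∞} {X : E → H}
    (hX : MemLp X p) (h : E) : MemLp (fun x => X (x + h)) p :=
  hX.comp_measurePreserving (measurePreserving_add_right volume h)

theorem LpTendsto.comp_add_right {H : Type*} [NormedAddCommGroup H] {p : ℝ≥0∞} {X : ℕ → E → H}
    {Y : E → H} (hX : LpTendsto p X Y) (h : E) :
    LpTendsto p (fun n x => X n (x + h)) (fun x => Y (x + h)) := by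
  refine ⟨fun n => memLp_comp_add_right (hX.memLp n) h, memLp_comp_add_right hX.memLp_lim h, ?_⟩
  refine hX.tendsto.congr fun n => ?_
  exact (eLpNorm_comp_measurePreserving (p := p) ((hX.memLp n).sub hX.memLp_lim).1
    (measurePreserving_add_right volume h)).symm

theorem LpTendsto.tendsto_integral {X : ℕ → E → F} {Y : E → F} (h : LpTendsto 1 X Y) :
    Tendsto (fun n => ∫ x, X n x) atTop (𝓝 (∫ x, Y x)) := by
  refine tendsto_integral_of_L1 Y h.memLp_lim.1
    (Eventually.of_forall fun n => memLp_one_iff_integrable.1 (h.memLp n)) ?_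
  simpa [eLpNorm_one_eq_lintegral_enorm] using h.tendsto

theorem eLpNorm_bilin_le (B : F →L[ℝ] F' →L[ℝ] F'') {f : E → F} {g : E → F'} (hf : MemLp f 2)
    (hg : MemLp g 2) :
    eLpNorm (fun x => B (f x) (g x)) 1 ≤ ‖B‖₊ * eLpNorm f 2 * eLpNorm g 2 :=
  eLpNorm_le_eLpNorm_mul_eLpNorm'_of_norm (p := 2) (q := 2) (r := 1) hf.1 hg.1
    (fun u v => B u v) ‖B‖₊ (Eventually.of_forall fun _ => B.le_opNorm₂ _ _)

theorem eLpNorm_bilin_sub_le (B : F →L[ℝ] F' →L[ℝ] F'') {f f' : E → F} {g g' : E → F'}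
    (hf : MemLp f 2) (hf' : MemLp f' 2) (hg : MemLp g 2) (hg' : MemLp g' 2) :
    eLpNorm (fun x => B (f x) (g x) - B (f' x) (g' x)) 1 ≤
      ‖B‖₊ * eLpNorm (fun x => f x - f' x) 2 * eLpNorm g 2 +
        ‖B‖₊ * eLpNorm f' 2 * eLpNorm (fun x => g x - g' x) 2 := by
  have d : MemLp (fun x => f x - f' x) 2 := hf.sub hf'
  have d' : MemLp (fun x => g x - g' x) 2 := hg.sub hg'
  have e : (fun x => B (f x) (g x) - B (f' x) (g' x)) =
      (fun x => B (f x - f' x) (g x)) + fun x => B (f' x) (g x - g' x) := by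
    funext x
    simp only [Pi.add_apply, map_sub, _root_.sub_apply]
    abel
  rw [e]
  exact (eLpNorm_add_le (integrable_bilin B d hg).1 (integrable_bilin B hf' d').1 le_rfl).trans
    (add_le_add (eLpNorm_bilin_le B d hg) (eLpNorm_bilin_le B hf' d'))

theorem LpTendsto.eLpNorm_le {H : Type*} [NormedAddCommGroup H] {X : ℕ → E → H} {Y : E → H}
    {p : ℝ≥0∞} (hp : 1 ≤ p) (h : LpTendsto p X Y) (n : ℕ) :
    eLpNorm (X n) p ≤ eLpNorm (fun x => X n x - Y x) p + eLpNorm Y p := by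
  have e : X n = (fun x => X n x - Y x) + Y := by
    funext x
    simp
  conv_lhs => rw [e]
  exact eLpNorm_add_le ((h.memLp n).sub h.memLp_lim).1 h.memLp_lim.1 hp

theorem tendsto_mul_add_mul_zero {x y : ℕ → ℝ≥0∞} {c M d : ℝ≥0∞} (hx : Tendsto x atTop (𝓝 0))
    (hy : Tendsto y atTop (𝓝 0)) (hc : c ≠ ⊤) (hM : M ≠ ⊤) (hd : d ≠ ⊤) :
    Tendsto (fun n => c * x n * (y n + M) + d * y n) atTop (𝓝 0) := by
  have t1 : Tendsto (fun n => c * x n) atTop (𝓝 (c * 0)) :=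
    ENNReal.Tendsto.const_mul hx (Or.inr hc)
  have t2 : Tendsto (fun n => y n + M) atTop (𝓝 (0 + M)) := hy.add_const M
  have t4 : Tendsto (fun n => d * y n) atTop (𝓝 (d * 0)) :=
    ENNReal.Tendsto.const_mul hy (Or.inr hd)
  rw [mul_zero] at t1 t4
  rw [zero_add] at t2
  have t3 := ENNReal.Tendsto.mul t1 (Or.inr hM) t2 (Or.inr ENNReal.zero_ne_top)
  simpa using t3.add t4

theorem LpTendsto.bilin (B : F →L[ℝ] F' →L[ℝ] F'') {X : ℕ → E → F} {X' : ℕ → E → F'} {Y : E → F}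
    {Y' : E → F'} (h : LpTendsto 2 X Y) (h' : LpTendsto 2 X' Y') :
    LpTendsto 1 (fun n x => B (X n x) (X' n x)) (fun x => B (Y x) (Y' x)) := by
  refine ⟨fun n => memLp_one_iff_integrable.2 (integrable_bilin B (h.memLp n) (h'.memLp n)),
    memLp_one_iff_integrable.2 (integrable_bilin B h.memLp_lim h'.memLp_lim), ?_⟩
  have hb : ∀ n, eLpNorm (fun x => B (X n x) (X' n x) - B (Y x) (Y' x)) 1 ≤
      (‖B‖₊ : ℝ≥0∞) * eLpNorm (fun x => X n x - Y x) 2 *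
      (eLpNorm (fun x => X' n x - Y' x) 2 + eLpNorm Y' 2) +
      ‖B‖₊ * eLpNorm Y 2 * eLpNorm (fun x => X' n x - Y' x) 2 := fun n => by
    have h1 := eLpNorm_bilin_sub_le B (h.memLp n) h.memLp_lim (h'.memLp n) h'.memLp_lim
    have h2 := h'.eLpNorm_le (by norm_num) n
    refine h1.trans ?_
    gcongr
  refine tendsto_of_tendsto_of_tendsto_of_le_of_le tendsto_const_nhds ?_ (fun _ => zero_le) hb
  exact tendsto_mul_add_mul_zero h.tendsto h'.tendsto ENNReal.coe_ne_top
    h'.memLp_lim.eLpNorm_ne_top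
    (ENNReal.mul_ne_top ENNReal.coe_ne_top h.memLp_lim.eLpNorm_ne_top)

theorem lpTendsto_const {H : Type*} [NormedAddCommGroup H] {p : ℝ≥0∞} {Y : E → H}
    (hY : MemLp Y p) : LpTendsto p (fun _ => Y) Y :=
  ⟨fun _ => hY, hY, by simp⟩

theorem LpTendsto.tendsto_integral_norm_sq {H : Type*} [NormedAddCommGroup H]
    [InnerProductSpace ℝ H] {X : ℕ → E → H} {Y : E → H} (h : LpTendsto 2 X Y) :
    Tendsto (fun n => ∫ x, ‖X n x‖ ^ 2) atTop (𝓝 (∫ x, ‖Y x‖ ^ 2)) := by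
  have := (h.bilin (innerSL ℝ) h).tendsto_integral
  simp only [← real_inner_self_eq_norm_sq]
  exact this

theorem LpTendsto.tendsto_setIntegral_norm {H : Type*} [NormedAddCommGroup H]
    {X : ℕ → E → H} {Y : E → H} (h : LpTendsto 1 X Y)
    (s : Set E) : Tendsto (fun n => ∫ x in s, ‖X n x‖) atTop (𝓝 (∫ x in s, ‖Y x‖)) := by
  refine tendsto_integral_of_L1 (fun x => ‖Y x‖) h.memLp_lim.1.norm.restrict
    (Eventually.of_forall fun n => (memLp_one_iff_integrable.1 (h.memLp n)).norm.integrableOn) ?_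
  refine tendsto_of_tendsto_of_tendsto_of_le_of_le tendsto_const_nhds h.tendsto (fun _ => zero_le)
    fun n => ?_
  rw [eLpNorm_one_eq_lintegral_enorm]
  refine (setLIntegral_le_lintegral _ _).trans (lintegral_mono fun x => ?_)
  rw [← ofReal_norm, ← ofReal_norm]
  exact ENNReal.ofReal_le_ofReal (abs_norm_sub_norm_le _ _)

end LpConvergence

/-! ### Mollification -/

section Mollification

variable {F : Type*} [NormedAddCommGroup F] [NormedSpace ℝ F]
variable {F' : Type*} [NormedAddCommGroup F'] [NormedSpace ℝ F']

/-- Bump functions with supports shrinking to the origin. -/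
noncomputable def bumpSeq (n : ℕ) : ContDiffBump (0 : E) where
  rIn := 1 / (2 * (n + 1))
  rOut := 1 / (n + 1)
  rIn_pos := by positivity
  rIn_lt_rOut := by
    apply one_div_lt_one_div_of_lt <;> nlinarith [(Nat.cast_nonneg n : (0 : ℝ) ≤ n)]

theorem tendsto_bumpSeq_rOut : Tendsto (fun n => (bumpSeq n).rOut) atTop (𝓝 0) :=
  tendsto_one_div_add_atTop_nhds_zero_nat

theorem bumpSeq_rOut_le (n : ℕ) : (bumpSeq n).rOut ≤ 1 := by
  simp only [bumpSeq]
  rw [div_le_one (by positivity)]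
  linarith [(Nat.cast_nonneg n : (0 : ℝ) ≤ n)]

/-- The standard mollifiers. -/
noncomputable def mollifier (n : ℕ) : E → ℝ := (bumpSeq n).normed volume

/-- The mollification of `u`. -/
noncomputable def moll (n : ℕ) (u : E → F) : E → F :=
  convolution (mollifier n) u (ContinuousLinearMap.lsmul ℝ ℝ) volume

theorem contDiff_mollifier (n : ℕ) : ContDiff ℝ ∞ (mollifier n) := (bumpSeq n).contDiff_normed

theorem hasCompactSupport_mollifier (n : ℕ) : HasCompactSupport (mollifier n) :=
  (bumpSeq n).hasCompactSupport_normed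

theorem moll_apply (n : ℕ) (u : E → F) (x : E) : moll n u x = ∫ t, mollifier n (x - t) • u t := by
  simp [moll, convolution_eq_swap]

theorem moll_congr_ae {n : ℕ} {u u' : E → F} (h : u =ᵐ[volume] u') : moll n u = moll n u' :=
  convolution_congr _ (ae_eq_refl _) h

theorem contDiff_moll (n : ℕ) {u : E → F} (hu : LocallyIntegrable u) : ContDiff ℝ ∞ (moll n u) :=
  (hasCompactSupport_mollifier n).contDiff_convolution_left _ (contDiff_mollifier n) hu

theorem pd_moll (n : ℕ) {u : E → F} (hu : LocallyIntegrable u) (k : Fin 2) (x : E) :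
    pd k (moll n u) x = ∫ t, pd k (mollifier n) (x - t) • u t := by
  have h1 := (hasCompactSupport_mollifier n).hasFDerivAt_convolution_left
    (ContinuousLinearMap.lsmul ℝ ℝ (E := F)) ((contDiff_mollifier n).of_le (by simp)) hu x
  have h2 : Integrable fun t => ((ContinuousLinearMap.lsmul ℝ ℝ (E := F)).precompL E)
      (fderiv ℝ (mollifier n) (x - t)) (u t) := by
    have := ((hasCompactSupport_mollifier n).fderiv ℝ).convolutionExists_left
      ((ContinuousLinearMap.lsmul ℝ ℝ (E := F)).precompL E)
      ((contDiff_mollifier n).continuous_fderiv (by simp)) hu x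
    exact this.integrable_swap
  change fderiv ℝ (moll n u) x _ = _
  rw [moll, h1.fderiv, convolution_eq_swap, ContinuousLinearMap.integral_apply h2]
  rfl

theorem mollifier_eq_zero {n : ℕ} {t : E} (ht : (bumpSeq n).rOut ≤ ‖t‖) : mollifier n t = 0 := by
  have : t ∉ Function.support (mollifier n) := by
    rw [mollifier, (bumpSeq n).support_normed_eq]
    simpa using ht
  simpa using this

theorem mollifier_nonneg (n : ℕ) (t : E) : 0 ≤ mollifier n t := (bumpSeq n).nonneg_normed t

theorem moll_eq_zero {n : ℕ} {u : E → F} {x : E} (h : ∀ t ∈ Metric.ball x (bumpSeq n).rOut, u t = 0) :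
    moll n u x = 0 := by
  rw [moll_apply]
  refine integral_eq_zero_of_ae (Eventually.of_forall fun t => ?_)
  by_cases ht : t ∈ Metric.ball x (bumpSeq n).rOut
  · simp [h t ht]
  · have : mollifier n (x - t) = 0 := mollifier_eq_zero (by
      rw [Metric.mem_ball, dist_comm, dist_eq_norm] at ht
      linarith)
    simp [this]

theorem integrable_mollifier_smul (n : ℕ) {u : E → F} (hu : LocallyIntegrable u) (x : E) :
    Integrable fun t => mollifier n (x - t) • u t :=
  ((hasCompactSupport_mollifier n).convolutionExists_left (ContinuousLinearMap.lsmul ℝ ℝ (E := F))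
      (contDiff_mollifier n).continuous hu x).integrable_swap

/-- Jensen's inequality for the probability measure with density `mollifier n`, followed by
Tonelli's theorem and translation invariance. Strong measurability may be assumed because a
convolution depends only on the almost everywhere class. -/
theorem eLpNorm_moll_le (n : ℕ) {p : ℝ≥0∞} (hp : 1 ≤ p) (hp' : p ≠ ⊤) {u : E → F}
    (hu : MemLp u p) : eLpNorm (moll n u) p ≤ eLpNorm u p := by
  wlog hm : StronglyMeasurable u generalizing u
  · have hae := hu.1.ae_eq_mk
    refine (le_of_eq ?_).trans ((this ((memLp_congr_ae hae).1 hu) hu.1.stronglyMeasurable_mk).trans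
      (eLpNorm_congr_ae hae).ge)
    rw [moll_congr_ae hae]
  have hp0 : p ≠ 0 := (zero_lt_one.trans_le hp).ne'
  have hr : 0 < p.toReal := ENNReal.toReal_pos hp0 hp'
  set ν : Measure E := volume.withDensity fun t => ENNReal.ofReal (mollifier n t) with hν
  have hdm : Measurable fun t => ENNReal.ofReal (mollifier n t) :=
    (contDiff_mollifier n).continuous.measurable.ennreal_ofReal
  have hprob : IsProbabilityMeasure ν := by
    refine ⟨?_⟩
    have hi : Integrable (mollifier n) := (bumpSeq n).integrable_normed
    rw [hν, withDensity_apply _ MeasurableSet.univ, setLIntegral_univ,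
      ← ofReal_integral_eq_lintegral_ofReal hi (Eventually.of_forall (mollifier_nonneg n))]
    change ENNReal.ofReal (∫ t, (bumpSeq n).normed volume t) = 1
    rw [(bumpSeq n).integral_normed, ENNReal.ofReal_one]
  have hpt : ∀ x, ‖moll n u x‖ₑ ^ p.toReal ≤ ∫⁻ t, ‖u (x - t)‖ₑ ^ p.toReal ∂ν := fun x => by
    have hms : AEStronglyMeasurable (fun t => u (x - t)) ν :=
      (hm.comp_measurable (measurable_const.sub measurable_id)).aestronglyMeasurable
    have h1 : ‖moll n u x‖ₑ ≤ eLpNorm (fun t => u (x - t)) 1 ν := by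
      have hmx : Measurable fun t => ‖u (x - t)‖ₑ :=
        (hm.comp_measurable (measurable_const.sub measurable_id)).enorm
      rw [eLpNorm_one_eq_lintegral_enorm, hν, lintegral_withDensity_eq_lintegral_mul₀
        hdm.aemeasurable hmx.aemeasurable]
      rw [moll, convolution_def]
      refine (enorm_integral_le_lintegral_enorm _).trans (lintegral_mono fun t => ?_)
      simp [enorm_smul, Real.enorm_of_nonneg (mollifier_nonneg n t)]
    have h2 := h1.trans (eLpNorm_le_eLpNorm_of_exponent_le hp hms)
    rw [eLpNorm_eq_lintegral_rpow_enorm_toReal hp0 hp'] at h2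
    calc ‖moll n u x‖ₑ ^ p.toReal
        ≤ ((∫⁻ t, ‖u (x - t)‖ₑ ^ p.toReal ∂ν) ^ (1 / p.toReal)) ^ p.toReal := by gcongr
      _ = _ := by rw [← ENNReal.rpow_mul, one_div_mul_cancel hr.ne', ENNReal.rpow_one]
  rw [eLpNorm_eq_lintegral_rpow_enorm_toReal hp0 hp', eLpNorm_eq_lintegral_rpow_enorm_toReal hp0 hp']
  refine ENNReal.rpow_le_rpow ?_ (by positivity)
  calc ∫⁻ x, ‖moll n u x‖ₑ ^ p.toReal
      ≤ ∫⁻ x, ∫⁻ t, ‖u (x - t)‖ₑ ^ p.toReal ∂ν := lintegral_mono hpt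
    _ = ∫⁻ t, ∫⁻ x, ‖u (x - t)‖ₑ ^ p.toReal ∂volume ∂ν := by
        refine lintegral_lintegral_swap (Measurable.aemeasurable ?_)
        exact (hm.comp_measurable (measurable_fst.sub measurable_snd)).enorm.pow_const _
    _ = ∫⁻ t, ∫⁻ x, ‖u x‖ₑ ^ p.toReal ∂volume ∂ν := by
        refine lintegral_congr fun t => ?_
        exact lintegral_sub_right_eq_self (fun x => ‖u x‖ₑ ^ p.toReal) t
    _ = ∫⁻ x, ‖u x‖ₑ ^ p.toReal := by simp

theorem memLp_moll (n : ℕ) {p : ℝ≥0∞} (hp : 1 ≤ p) (hp' : p ≠ ⊤) {u : E → F} (hu : MemLp u p) :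
    MemLp (moll n u) p :=
  ⟨(contDiff_moll n (hu.locallyIntegrable hp)).continuous.aestronglyMeasurable,
    (eLpNorm_moll_le n hp hp' hu).trans_lt hu.2⟩

theorem moll_sub (n : ℕ) {u u' : E → F} (hu : LocallyIntegrable u) (hu' : LocallyIntegrable u') :
    moll n (u - u') = moll n u - moll n u' := by
  funext x
  simp only [moll_apply, Pi.sub_apply, smul_sub]
  exact integral_sub (integrable_mollifier_smul n hu x) (integrable_mollifier_smul n hu' x)

theorem moll_add (n : ℕ) {u u' : E → F} (hu : LocallyIntegrable u) (hu' : LocallyIntegrable u') :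
    moll n (u + u') = moll n u + moll n u' := by
  funext x
  simp only [moll_apply, Pi.add_apply, smul_add]
  exact integral_add (integrable_mollifier_smul n hu x) (integrable_mollifier_smul n hu' x)

theorem tendsto_eLpNorm_moll_of_continuous [CompleteSpace F] {p : ℝ≥0∞} {g : E → F} (hg : Continuous g)
    (hc : HasCompactSupport g) :
    Tendsto (fun n => eLpNorm (fun x => moll n g x - g x) p) atTop (𝓝 0) := by
  set K := Metric.cthickening 1 (tsupport g) with hK
  have hKc : IsCompact K := hc.isCompact.cthickening
  have hKm : volume K ^ (1 / p.toReal) ≠ ⊤ :=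
    ENNReal.rpow_ne_top_of_nonneg (one_div_nonneg.2 ENNReal.toReal_nonneg) hKc.measure_lt_top.ne
  have hb : ∀ ε : ℝ, 0 < ε → ∀ᶠ n in atTop, eLpNorm (fun x => moll n g x - g x) p ≤
      ENNReal.ofReal ε * volume K ^ (1 / p.toReal) := fun ε hε => by
    obtain ⟨δ, hδ, hu⟩ := Metric.uniformContinuous_iff.1
      (hc.uniformContinuous_of_continuous hg) ε hε
    filter_upwards [tendsto_bumpSeq_rOut.eventually (gt_mem_nhds hδ)] with n hn
    have hle : ∀ x, ‖moll n g x - g x‖ ≤ ‖K.indicator (fun _ => ε) x‖ := fun x => by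
      by_cases hx : x ∈ K
      · rw [Set.indicator_of_mem hx, Real.norm_of_nonneg hε.le, ← dist_eq_norm]
        refine (bumpSeq n).dist_normed_convolution_le hg.aestronglyMeasurable fun y hy => ?_
        exact (hu ((Metric.mem_ball.1 hy).trans hn)).le
      · have hz : ∀ t ∈ Metric.ball x (bumpSeq n).rOut, g t = 0 := fun t ht => by
          by_contra hgt
          refine hx (Metric.mem_cthickening_of_dist_le x t 1 _ (subset_tsupport g hgt) ?_)
          rw [dist_comm]
          exact (Metric.mem_ball.1 ht).le.trans (bumpSeq_rOut_le n)
        rw [moll_eq_zero hz, hz x (Metric.mem_ball_self (bumpSeq n).rOut_pos)]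
        simp
    refine (eLpNorm_mono hle).trans ((eLpNorm_indicator_const_le ε p).trans ?_)
    rw [Real.enorm_of_nonneg hε.le]
  rw [ENNReal.tendsto_atTop_zero]
  intro ε hε
  by_cases hε' : ε = ⊤
  · exact ⟨0, fun n _ => by simp [hε']⟩
  -- The summand 1 excludes a division by zero when K is a null set.
  have hpos : 0 < ε / (volume K ^ (1 / p.toReal) + 1) :=
    ENNReal.div_pos hε.ne' (ENNReal.add_ne_top.2 ⟨hKm, ENNReal.one_ne_top⟩)
  have hfin : ε / (volume K ^ (1 / p.toReal) + 1) ≠ ⊤ :=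
    ENNReal.div_ne_top hε' (by simp)
  obtain ⟨N, hN⟩ := eventually_atTop.1 (hb _ (ENNReal.toReal_pos hpos.ne' hfin))
  refine ⟨N, fun n hn => (hN n hn).trans ?_⟩
  rw [ENNReal.ofReal_toReal hfin]
  calc ε / (volume K ^ (1 / p.toReal) + 1) * volume K ^ (1 / p.toReal)
      ≤ ε / (volume K ^ (1 / p.toReal) + 1) * (volume K ^ (1 / p.toReal) + 1) := by
        gcongr
        exact le_self_add
    _ ≤ ε := (ENNReal.div_mul_cancel (by simp) (ENNReal.add_ne_top.2 ⟨hKm, ENNReal.one_ne_top⟩)).le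

theorem lpTendsto_moll [CompleteSpace F] {p : ℝ≥0∞} (hp : 1 ≤ p) (hp' : p ≠ ⊤) {u : E → F} (hu : MemLp u p) :
    LpTendsto p (fun n => moll n u) u := by
  refine ⟨fun n => memLp_moll n hp hp' hu, hu, ?_⟩
  rw [ENNReal.tendsto_atTop_zero]
  intro ε hε
  have hε3 : ε / 3 ≠ 0 := (ENNReal.div_pos hε.ne' (by norm_num)).ne'
  obtain ⟨g, hgc, hgu, hg, hgm⟩ := hu.exists_hasCompactSupport_eLpNorm_sub_le hp' hε3
  obtain ⟨N, hN⟩ := ENNReal.tendsto_atTop_zero.1 (tendsto_eLpNorm_moll_of_continuous (p := p) hg hgc)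
    (ε / 3) (pos_iff_ne_zero.2 hε3)
  refine ⟨N, fun n hn => ?_⟩
  have hd := hu.sub hgm
  have e : (fun x => moll n u x - u x) = (moll n (u - g) + fun x => moll n g x - g x) - (u - g) := by
    rw [moll_sub n (hu.locallyIntegrable hp) (hgm.locallyIntegrable hp)]
    funext x
    simp only [Pi.sub_apply, Pi.add_apply]
    abel
  rw [e]
  have m1 := memLp_moll n hp hp' hd
  have m2 := (memLp_moll n hp hp' hgm).sub hgm
  have b1 : eLpNorm (moll n (u - g)) p ≤ ε / 3 := (eLpNorm_moll_le n hp hp' hd).trans hgu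
  have b2 := hN n hn
  have b3 := eLpNorm_sub_le (m1.add m2).1 hd.1 hp
  have b4 := eLpNorm_add_le m1.1 m2.1 hp
  refine b3.trans ((add_le_add (b4.trans (add_le_add b1 b2)) hgu).trans ?_)
  rw [ENNReal.add_thirds]

theorem ae_tendsto_moll [CompleteSpace F] {u : E → F} (hu : LocallyIntegrable u) :
    ∀ᵐ x, Tendsto (fun n => moll n u x) atTop (𝓝 (u x)) := by
  -- Lebesgue differentiation needs a bounded ratio of outer to inner radius; for `bumpSeq` it is
  -- exactly 2.
  refine ContDiffBump.ae_convolution_tendsto_right_of_locallyIntegrable (K := 2)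
    tendsto_bumpSeq_rOut (Eventually.of_forall fun n => ?_) hu
  simp only [bumpSeq]
  apply le_of_eq
  field_simp

/-- `g = ∑ₖ Lₖ ∂ₖ u` in the sense of distributions on `U`. -/
def WeakOp (U : Set E) (L : Fin 2 → F →L[ℝ] F') (u : E → F) (g : E → F') : Prop :=
  ∀ φ : E → ℝ, IsTest U φ → ∫ x, φ x • g x = -∫ x, ∑ k, pd k φ x • L k (u x)

theorem WeakOp.mono {U V : Set E} {L : Fin 2 → F →L[ℝ] F'} {u : E → F} {g : E → F'}
    (h : WeakOp U L u g) (hV : V ⊆ U) : WeakOp V L u g :=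
  fun φ hφ => h φ (hφ.mono hV)

theorem WeakOp.congr {U : Set E} {L : Fin 2 → F →L[ℝ] F'} {u u' : E → F} {g g' : E → F'}
    (h : WeakOp U L u g) (hu : ∀ x ∈ U, u x = u' x) (hg : ∀ x ∈ U, g x = g' x) :
    WeakOp U L u' g' := by
  intro φ hφ
  have h1 : ∀ x, φ x • g' x = φ x • g x := fun x => by
    by_cases hx : x ∈ U
    · rw [hg x hx]
    · simp [hφ.eq_zero_of_notMem hx]
  have h2 : ∀ x, ∑ k, pd k φ x • L k (u' x) = ∑ k, pd k φ x • L k (u x) := fun x => by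
    by_cases hx : x ∈ U
    · rw [hu x hx]
    · simp [(hφ.pd _).eq_zero_of_notMem hx]
  simp only [h1, h2]
  exact h φ hφ

/-- The reflected mollifier t ↦ `mollifier n (x - t)` is itself an admissible test function once the
ball around `x` that carries it lies in U. So the weak identity becomes a classical one at `x`. -/
theorem WeakOp.moll_eq [CompleteSpace F] [CompleteSpace F'] {U : Set E} {L : Fin 2 → F →L[ℝ] F'}
    {u : E → F} {g : E → F'} (h : WeakOp U L u g) (hu : LocallyIntegrable u) {n : ℕ} {x : E}
    (hx : Metric.closedBall x (bumpSeq n).rOut ⊆ U) :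
    ∑ k, L k (pd k (moll n u) x) = moll n g x := by
  have hsm : ContDiff ℝ ∞ fun t => mollifier n (x - t) :=
    (contDiff_mollifier n).comp (contDiff_const.sub contDiff_id)
  have hsupp : tsupport (fun t => mollifier n (x - t)) ⊆ Metric.closedBall x (bumpSeq n).rOut := by
    refine closure_minimal (fun t ht => ?_) Metric.isClosed_closedBall
    by_contra h'
    refine ht (mollifier_eq_zero ?_)
    rw [Metric.mem_closedBall, dist_comm, dist_eq_norm] at h'
    linarith
  have htest : IsTest U fun t => mollifier n (x - t) :=
    ⟨hsm, (isCompact_closedBall _ _).of_isClosed_subset (isClosed_tsupport _) hsupp,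
      hsupp.trans hx⟩
  have hpd : ∀ k t, pd k (fun t => mollifier n (x - t)) t = -pd k (mollifier n) (x - t) := by
    intro k t
    have h1 : HasFDerivAt (fun t => x - t) (-ContinuousLinearMap.id ℝ E) t := by
      simpa using (hasFDerivAt_id t).const_sub x
    have h2 := ((differentiable_of_smooth (contDiff_mollifier n)) (x - t)).hasFDerivAt.comp t h1
    simp only [Function.comp_def] at h2
    simp [pd, h2.fderiv]
  have hi : ∀ k, Integrable fun t => pd k (mollifier n) (x - t) • u t := fun k =>
    ((hasCompactSupport_pd (hasCompactSupport_mollifier n) k).convolutionExists_left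
      (ContinuousLinearMap.lsmul ℝ ℝ (E := F))
      (contDiff_pd (contDiff_mollifier n) k).continuous hu x).integrable_swap
  have hL : ∀ k, L k (pd k (moll n u) x) = ∫ t, pd k (mollifier n) (x - t) • L k (u t) := fun k => by
    rw [pd_moll n hu, ← (L k).integral_comp_comm (hi k)]
    simp
  have hiL : ∀ k, Integrable fun t => pd k (mollifier n) (x - t) • L k (u t) := fun k => by
    simpa using (L k).integrable_comp (hi k)
  rw [moll_apply, h _ htest]
  simp only [hpd, hL, neg_smul, Finset.sum_neg_distrib, integral_neg, neg_neg]
  exact (integral_finsetSum _ fun k _ => hiL k).symm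

end Mollification

end WSO

namespace WSO

open Filter Topology

/-! ### Convex integrands -/

section Integrands

variable {W : Type*} [NormedAddCommGroup W] [InnerProductSpace ℝ W]

theorem bilin_le_half_add_half (B : W →L[ℝ] W →L[ℝ] ℝ) (hs : ∀ x y, B x y = B y x)
    (h0 : ∀ x, 0 ≤ B x x) (x y : W) : |B x y| ≤ 1 / 2 * B x x + 1 / 2 * B y y := by
  have h1 := h0 (x + y)
  have h2 := h0 (x - y)
  simp only [map_add, map_sub, _root_.add_apply, _root_.sub_apply] at h1 h2
  rw [hs y x] at h1 h2
  rw [abs_le]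
  constructor <;> linarith

/-- Young's inequality for the form is applied to ‖y‖x and ‖x‖y, which have equal length; this makes
it homogeneous in both arguments and gives the constant M without loss. -/
theorem bilin_norm_le (B : W →L[ℝ] W →L[ℝ] ℝ) (hs : ∀ x y, B x y = B y x)
    (h0 : ∀ x, 0 ≤ B x x) {M : ℝ} (hM : ∀ x, B x x ≤ M * ‖x‖ ^ 2) (hM0 : 0 ≤ M) : ‖B‖ ≤ M := by
  refine B.opNorm_le_bound₂ hM0 fun x y => ?_
  rcases eq_or_ne x 0 with rfl | hx
  · simp
  rcases eq_or_ne y 0 with rfl | hy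
  · simp
  have hx0 : 0 < ‖x‖ := norm_pos_iff.2 hx
  have hy0 : 0 < ‖y‖ := norm_pos_iff.2 hy
  have h := bilin_le_half_add_half B hs h0 (‖y‖ • x) (‖x‖ • y)
  have e1 := hM (‖y‖ • x)
  have e2 := hM (‖x‖ • y)
  rw [norm_smul, norm_norm] at e1 e2
  have e3 : B (‖y‖ • x) (‖x‖ • y) = ‖x‖ * ‖y‖ * B x y := by
    simp
    ring
  rw [e3, abs_mul, abs_of_pos (mul_pos hx0 hy0)] at h
  have h3 : (‖x‖ * ‖y‖) * |B x y| ≤ (‖x‖ * ‖y‖) * (M * ‖x‖ * ‖y‖) := by nlinarith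
  exact le_of_mul_le_mul_left h3 (mul_pos hx0 hy0)

/-- A `C²` function whose second derivative lies between `lam` and `L`. -/
structure HasHessBounds (lam L : ℝ) (g : W → ℝ) : Prop where
  contDiff : ContDiff ℝ 2 g
  lam_nonneg : 0 ≤ lam
  lower : ∀ P ξ, lam * ‖ξ‖ ^ 2 ≤ fderiv ℝ (fderiv ℝ g) P ξ ξ
  upper : ∀ P ξ, fderiv ℝ (fderiv ℝ g) P ξ ξ ≤ L * ‖ξ‖ ^ 2
  L_nonneg : 0 ≤ L

variable {g : W → ℝ} {lam L : ℝ}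

theorem hess_symm (hg : ContDiff ℝ 2 g) (P ξ η : W) :
    fderiv ℝ (fderiv ℝ g) P ξ η = fderiv ℝ (fderiv ℝ g) P η ξ :=
  (hg.contDiffAt.isSymmSndFDerivAt (by simp)) ξ η

theorem contDiff_fderiv (hg : ContDiff ℝ 2 g) : ContDiff ℝ 1 (fderiv ℝ g) :=
  hg.fderiv_right (m := 1) (by norm_num)

theorem HasHessBounds.nonneg (hg : HasHessBounds lam L g) (P ξ : W) :
    0 ≤ fderiv ℝ (fderiv ℝ g) P ξ ξ :=
  (mul_nonneg hg.lam_nonneg (by positivity)).trans (hg.lower P ξ)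

theorem HasHessBounds.norm_hess_le (hg : HasHessBounds lam L g) (P : W) :
    ‖fderiv ℝ (fderiv ℝ g) P‖ ≤ L :=
  bilin_norm_le _ (hess_symm hg.contDiff P) (hg.nonneg P) (hg.upper P) hg.L_nonneg

theorem HasHessBounds.norm_fderiv_sub_le (hg : HasHessBounds lam L g) (P Q : W) :
    ‖fderiv ℝ g P - fderiv ℝ g Q‖ ≤ L * ‖P - Q‖ :=
  convex_univ.norm_image_sub_le_of_norm_fderiv_le
    (fun x _ => (contDiff_fderiv hg.contDiff).differentiable one_ne_zero x)
    (fun x _ => hg.norm_hess_le x) (Set.mem_univ _) (Set.mem_univ _)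

theorem hasDerivAt_fderiv_comp (hg : ContDiff ℝ 2 g) {γ : ℝ → W} {γ' : W} {t : ℝ}
    (hγ : HasDerivAt γ γ' t) (Y : W) :
    HasDerivAt (fun s => fderiv ℝ g (γ s) Y) (fderiv ℝ (fderiv ℝ g) (γ t) γ' Y) t := by
  have h2 := (((contDiff_fderiv hg).differentiable one_ne_zero) (γ t)).hasFDerivAt
  have h3 := h2.comp_hasDerivAt t hγ
  simpa using h3.clm_apply (hasDerivAt_const t Y)

theorem hasDerivAt_fderiv_line (hg : ContDiff ℝ 2 g) (Q X Y : W) (t : ℝ) :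
    HasDerivAt (fun s : ℝ => fderiv ℝ g (Q + s • X) Y) (fderiv ℝ (fderiv ℝ g) (Q + t • X) X Y) t := by
  have h1 : HasDerivAt (fun s : ℝ => Q + s • X) X t := by
    simpa using ((hasDerivAt_id t).smul_const X).const_add Q
  exact hasDerivAt_fderiv_comp hg h1 Y

theorem hasDerivAt_line (hg : ContDiff ℝ 2 g) (Q X : W) (t : ℝ) :
    HasDerivAt (fun s : ℝ => g (Q + s • X)) (fderiv ℝ g (Q + t • X) X) t := by
  have h1 : HasDerivAt (fun s : ℝ => Q + s • X) X t := by
    simpa using ((hasDerivAt_id t).smul_const X).const_add Q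
  exact ((hg.differentiable (by norm_num)) (Q + t • X)).hasFDerivAt.comp_hasDerivAt t h1

theorem exists_fderiv_sub_eq (hg : ContDiff ℝ 2 g) (Q X Y : W) :
    ∃ t : ℝ, 0 < t ∧ t < 1 ∧
      fderiv ℝ g (Q + X) Y - fderiv ℝ g Q Y = fderiv ℝ (fderiv ℝ g) (Q + t • X) X Y := by
  obtain ⟨t, ht, h⟩ := exists_hasDerivAt_eq_slope _ _ (zero_lt_one' ℝ)
    (fun s _ => (hasDerivAt_fderiv_line hg Q X Y s).continuousAt.continuousWithinAt)
    (fun s _ => hasDerivAt_fderiv_line hg Q X Y s)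
  exact ⟨t, ht.1, ht.2, by simpa using h.symm⟩

theorem exists_sub_eq_fderiv (hg : ContDiff ℝ 2 g) (Q X : W) :
    ∃ t : ℝ, 0 < t ∧ t < 1 ∧ g (Q + X) - g Q = fderiv ℝ g (Q + t • X) X := by
  obtain ⟨t, ht, h⟩ := exists_hasDerivAt_eq_slope _ _ (zero_lt_one' ℝ)
    (fun s _ => (hasDerivAt_line hg Q X s).continuousAt.continuousWithinAt)
    (fun s _ => hasDerivAt_line hg Q X s)
  exact ⟨t, ht.1, ht.2, by simpa using h.symm⟩

theorem HasHessBounds.monotone (hg : HasHessBounds lam L g) (P Q : W) :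
    lam * ‖P - Q‖ ^ 2 ≤ (fderiv ℝ g P - fderiv ℝ g Q) (P - Q) := by
  obtain ⟨t, -, -, h⟩ := exists_fderiv_sub_eq hg.contDiff Q (P - Q) (P - Q)
  rw [add_sub_cancel] at h
  rw [_root_.sub_apply, h]
  exact hg.lower _ _

theorem HasHessBounds.le_taylor (hg : HasHessBounds lam L g) (P X : W) :
    g (P + X) ≤ g P + fderiv ℝ g P X + L * ‖X‖ ^ 2 := by
  obtain ⟨t, h0, h1, h⟩ := exists_sub_eq_fderiv hg.contDiff P X
  have h2 : (fderiv ℝ g (P + t • X) - fderiv ℝ g P) X ≤ L * ‖X‖ * ‖X‖ := by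
    refine (Real.le_norm_self _).trans (ContinuousLinearMap.le_of_opNorm_le _ ?_ X)
    refine (hg.norm_fderiv_sub_le _ _).trans ?_
    rw [add_sub_cancel_left, norm_smul, Real.norm_of_nonneg h0.le]
    have := mul_le_mul_of_nonneg_right h1.le (norm_nonneg X)
    exact mul_le_mul_of_nonneg_left (by linarith) hg.L_nonneg
  rw [_root_.sub_apply] at h2
  nlinarith

theorem HasHessBounds.norm_fderiv_le (hg : HasHessBounds lam L g) (P : W) :
    ‖fderiv ℝ g P - fderiv ℝ g 0‖ ≤ L * ‖P‖ := by
  simpa using hg.norm_fderiv_sub_le P 0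

/-- The values of `Df` at antipodal points are compared along a half circle. -/
theorem fderiv_antipodal_sub_le {f : W → ℝ} {Λ : ℝ} (hΛ : 0 ≤ Λ) (hf : ContDiff ℝ 2 f)
    (hH : ∀ P : W, ‖fderiv ℝ (fderiv ℝ f) P‖ ≤ Λ / Real.sqrt (1 + ‖P‖ ^ 2)) {ξ η : W} {R : ℝ}
    (hξ : ‖ξ‖ = 1) (hη : ‖η‖ = 1) (hξη : inner ℝ ξ η = 0) (hR : 0 ≤ R) :
    fderiv ℝ f (R • ξ) ξ - fderiv ℝ f (-(R • ξ)) ξ ≤ Real.pi * Λ := by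
  have aux : ∀ c s : ℝ, c ^ 2 + s ^ 2 = 1 → ‖R • (c • ξ + s • η)‖ = R := fun c s hcs => by
    have h1 : ‖c • ξ + s • η‖ ^ 2 = 1 := by
      rw [norm_add_sq_real, norm_smul, norm_smul, real_inner_smul_left, real_inner_smul_right, hξη,
        hξ, hη, mul_one, mul_one, Real.norm_eq_abs, Real.norm_eq_abs, sq_abs, sq_abs]
      linarith
    have h2 : ‖c • ξ + s • η‖ = 1 := by
      nlinarith [norm_nonneg (c • ξ + s • η)]
    rw [norm_smul, h2, Real.norm_of_nonneg hR, mul_one]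
  have hder : ∀ t : ℝ, HasDerivAt
      (fun s : ℝ => fderiv ℝ f (R • (Real.cos s • ξ + Real.sin s • η)) ξ)
      (fderiv ℝ (fderiv ℝ f) (R • (Real.cos t • ξ + Real.sin t • η))
        (R • (-Real.sin t • ξ + Real.cos t • η)) ξ) t := fun t => by
    have hγ : HasDerivAt (fun s : ℝ => R • (Real.cos s • ξ + Real.sin s • η))
        (R • (-Real.sin t • ξ + Real.cos t • η)) t :=
      (((Real.hasDerivAt_cos t).smul_const ξ).fun_add
        ((Real.hasDerivAt_sin t).smul_const η)).fun_const_smul R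
    exact hasDerivAt_fderiv_comp hf hγ ξ
  -- The half circle of radius R is traversed with speed R, while the Hessian on it is at most
  -- Λ/√(1+R²). The product is at most Λ whatever R is, and the parameter interval has length π.
  have hbd : ∀ t : ℝ, ‖fderiv ℝ (fderiv ℝ f) (R • (Real.cos t • ξ + Real.sin t • η))
        (R • (-Real.sin t • ξ + Real.cos t • η)) ξ‖ ≤ Λ := fun t => by
    refine (ContinuousLinearMap.le_opNorm₂ _ _ _).trans ?_
    rw [aux (-Real.sin t) (Real.cos t) (by rw [neg_sq]; exact Real.sin_sq_add_cos_sq t), hξ, mul_one]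
    refine (mul_le_mul_of_nonneg_right (hH _) hR).trans ?_
    rw [aux _ _ (Real.cos_sq_add_sin_sq t), div_mul_eq_mul_div,
      div_le_iff₀ (Real.sqrt_pos.2 (by positivity))]
    exact mul_le_mul_of_nonneg_left (Real.le_sqrt_of_sq_le (by linarith)) hΛ
  have := norm_image_sub_le_of_norm_deriv_le_segment' (a := 0) (b := Real.pi) (C := Λ)
    (fun t _ => (hder t).hasDerivWithinAt) (fun t _ => hbd t) Real.pi
    (Set.right_mem_Icc.2 Real.pi_pos.le)
  simp only [Real.cos_pi, Real.sin_pi, Real.cos_zero, Real.sin_zero, zero_smul, add_zero,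
    neg_smul, one_smul, smul_neg, sub_zero] at this
  rw [Real.norm_eq_abs] at this
  have := (abs_le.1 this).1
  linarith

/-- A convex function with `|D²f(P)| ≤ Λ (1 + |P|²)^{-1/2}` on a space of dimension at least two
has a bounded derivative, up to a linear function. -/
theorem norm_fderiv_sub_fderiv_zero_le {f : W → ℝ} {Λ : ℝ} (hΛ : 0 ≤ Λ) (hf : ContDiff ℝ 2 f)
    (h0 : ∀ P ξ, 0 ≤ fderiv ℝ (fderiv ℝ f) P ξ ξ)
    (h1 : ∀ P ξ, fderiv ℝ (fderiv ℝ f) P ξ ξ ≤ Λ * (‖ξ‖ ^ 2 / Real.sqrt (1 + ‖P‖ ^ 2)))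
    (hdim : ∀ ξ : W, ∃ η : W, ‖η‖ = 1 ∧ inner ℝ ξ η = 0) (P : W) :
    ‖fderiv ℝ f P - fderiv ℝ f 0‖ ≤ Real.pi * Λ := by
  have hsq : ∀ P : W, 0 < Real.sqrt (1 + ‖P‖ ^ 2) := fun P => Real.sqrt_pos.2 (by positivity)
  have hH : ∀ P : W, ‖fderiv ℝ (fderiv ℝ f) P‖ ≤ Λ / Real.sqrt (1 + ‖P‖ ^ 2) := fun P =>
    bilin_norm_le _ (hess_symm hf P) (h0 P)
      (fun x => (h1 P x).trans (le_of_eq (by ring))) (div_nonneg hΛ (hsq P).le)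
  have hmono : ∀ Q X : W, fderiv ℝ f Q X ≤ fderiv ℝ f (Q + X) X := fun Q X => by
    obtain ⟨t, -, -, h⟩ := exists_fderiv_sub_eq hf Q X X
    have := h0 (Q + t • X) X
    linarith
  -- By convexity the slope in direction ξ at -Rξ does not exceed the one at 0, so the increment
  -- from 0 to Rξ is dominated by the increment between antipodal points.
  have hray : ∀ (ξ : W) (R : ℝ), ‖ξ‖ = 1 → 0 ≤ R →
      fderiv ℝ f (R • ξ) ξ - fderiv ℝ f 0 ξ ≤ Real.pi * Λ := fun ξ R hξ hR => by
    rcases hR.eq_or_lt with rfl | hR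
    · simp only [zero_smul, sub_self]
      positivity
    have h2 := hmono (-(R • ξ)) (R • ξ)
    simp only [neg_add_cancel, map_smul, smul_eq_mul] at h2
    have h3 := le_of_mul_le_mul_left h2 hR
    obtain ⟨η, hη, hξη⟩ := hdim ξ
    linarith [fderiv_antipodal_sub_le hΛ hf hH hξ hη hξη hR.le]
  have hgrow : ∀ Q : W, f Q - f 0 - fderiv ℝ f 0 Q ≤ Real.pi * Λ * ‖Q‖ := fun Q => by
    rcases eq_or_ne Q 0 with rfl | hQ
    · simp
    have hn : 0 < ‖Q‖ := norm_pos_iff.2 hQ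
    obtain ⟨t, ht0, -, h⟩ := exists_sub_eq_fderiv hf 0 Q
    rw [zero_add, zero_add] at h
    have hu : ‖(‖Q‖⁻¹ • Q)‖ = 1 := by
      rw [norm_smul, norm_inv, norm_norm, inv_mul_cancel₀ hn.ne']
    have hQu : Q = ‖Q‖ • (‖Q‖⁻¹ • Q) := by rw [smul_smul, mul_inv_cancel₀ hn.ne', one_smul]
    have h3 := hray (‖Q‖⁻¹ • Q) (t * ‖Q‖) hu (by positivity)
    rw [mul_smul, ← hQu] at h3
    simp only [map_smul, smul_eq_mul] at h3
    have h4 := mul_le_mul_of_nonneg_right h3 hn.le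
    rw [sub_mul, mul_right_comm, inv_mul_cancel₀ hn.ne', one_mul, mul_right_comm,
      inv_mul_cancel₀ hn.ne', one_mul] at h4
    linarith
  have hconv : ∀ Q X : W, f Q + fderiv ℝ f Q X ≤ f (Q + X) := fun Q X => by
    obtain ⟨t, ht0, -, h⟩ := exists_sub_eq_fderiv hf Q X
    have h2 := hmono Q (t • X)
    simp only [map_smul, smul_eq_mul] at h2
    have h3 := le_of_mul_le_mul_left h2 ht0
    linarith
  have hdir : ∀ η : W, (fderiv ℝ f P - fderiv ℝ f 0) η ≤ Real.pi * Λ * ‖η‖ := fun η => by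
    have hbase : f 0 + fderiv ℝ f 0 P ≤ f P := by simpa using hconv 0 P
    -- Convexity bounds the slope at P by the growth of f along P + sη, which is linear with
    -- constant πΛ after the affine part at 0 is removed. Dividing by s leaves a term in ‖P‖ that
    -- disappears as s → ∞. In this way the bound along rays becomes a bound in all directions.
    have hs : ∀ s : ℝ, 0 < s → (fderiv ℝ f P - fderiv ℝ f 0) η ≤
        Real.pi * Λ * ‖η‖ + Real.pi * Λ * ‖P‖ / s := fun s hs => by
      have e1 := hconv P (s • η)
      have e2 := hgrow (P + s • η)
      have e3 : ‖P + s • η‖ ≤ ‖P‖ + s * ‖η‖ := by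
        refine (norm_add_le _ _).trans ?_
        rw [norm_smul, Real.norm_of_nonneg hs.le]
      have e4 := mul_le_mul_of_nonneg_left e3 (mul_nonneg Real.pi_pos.le hΛ)
      simp only [map_add, map_smul, smul_eq_mul] at e1 e2
      rw [_root_.sub_apply, ← sub_le_iff_le_add', le_div_iff₀ hs]
      nlinarith
    have hlim : Tendsto (fun s : ℝ => Real.pi * Λ * ‖η‖ + Real.pi * Λ * ‖P‖ / s) atTop
        (𝓝 (Real.pi * Λ * ‖η‖ + 0)) :=
      tendsto_const_nhds.add (tendsto_const_nhds.div_atTop tendsto_id)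
    rw [add_zero] at hlim
    exact ge_of_tendsto hlim ((eventually_gt_atTop 0).mono hs)
  refine ContinuousLinearMap.opNorm_le_bound _ (mul_nonneg Real.pi_pos.le hΛ) fun η => ?_
  rw [Real.norm_eq_abs, abs_le]
  have h2 := hdir (-η)
  rw [map_neg, norm_neg] at h2
  exact ⟨by linarith, hdir η⟩

end Integrands

/-! ### Differences of smooth functions -/

section Differences

variable {F : Type*} [NormedAddCommGroup F] [NormedSpace ℝ F]

theorem norm_sub_sq_le_integral [CompleteSpace F] {u : E → F} (hu : ContDiff ℝ 1 u) (k : Fin 2)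
    (h : ℝ) (x : E) :
    ENNReal.ofReal (‖u (x + EuclideanSpace.single k h) - u x‖ ^ 2) ≤
      ∫⁻ t in Set.Ioc (0 : ℝ) 1,
        ENNReal.ofReal (h ^ 2 * ‖pd k u (x + EuclideanSpace.single k (t * h))‖ ^ 2) := by
  set e : E := EuclideanSpace.single k h with he
  have hes : ∀ t : ℝ, t • e = EuclideanSpace.single k (t * h) := fun t => by
    rw [he]
    ext i
    simp
  have heh : e = h • EuclideanSpace.single k (1 : ℝ) := by
    rw [he]
    ext i
    simp
  have hd : ∀ t : ℝ, HasDerivAt (fun s : ℝ => u (x + s • e)) (h • pd k u (x + t • e)) t := fun t => by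
    have h1 : HasDerivAt (fun s : ℝ => x + s • e) e t := by
      simpa using ((hasDerivAt_id t).smul_const e).const_add x
    have h2 := ((hu.differentiable one_ne_zero) (x + t • e)).hasFDerivAt.comp_hasDerivAt t h1
    have h3 : fderiv ℝ u (x + t • e) e = h • pd k u (x + t • e) := by
      conv_lhs => rw [heh, map_smul]
      rw [← heh]
      rfl
    rw [h3] at h2
    exact h2
  have hc : Continuous fun t : ℝ => h • pd k u (x + t • e) :=
    continuous_const.smul ((continuous_pd hu k).comp (by fun_prop))
  have hftc : ∫ t in (0 : ℝ)..1, h • pd k u (x + t • e) = u (x + e) - u x := by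
    rw [intervalIntegral.integral_eq_sub_of_hasDerivAt (fun t _ => hd t)
      (hc.intervalIntegrable _ _)]
    simp
  have hprob : IsProbabilityMeasure (volume.restrict (Set.Ioc (0 : ℝ) 1)) :=
    ⟨by simp⟩
  rw [intervalIntegral.integral_of_le zero_le_one] at hftc
  have h1 : ‖u (x + e) - u x‖ₑ ≤
      eLpNorm (fun t : ℝ => h • pd k u (x + t • e)) 1 (volume.restrict (Set.Ioc (0 : ℝ) 1)) := by
    rw [← hftc, eLpNorm_one_eq_lintegral_enorm]
    exact enorm_integral_le_lintegral_enorm _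
  have h2 := h1.trans (eLpNorm_le_eLpNorm_of_exponent_le (q := 2) (by norm_num)
    hc.aestronglyMeasurable)
  rw [eLpNorm_eq_lintegral_rpow_enorm_toReal (by norm_num) (by norm_num)] at h2
  have h3 : ‖u (x + e) - u x‖ₑ ^ (2 : ℝ) ≤
      ∫⁻ t in Set.Ioc (0 : ℝ) 1, ‖h • pd k u (x + t • e)‖ₑ ^ (2 : ℝ) := by
    refine (ENNReal.rpow_le_rpow h2 (by norm_num : (0 : ℝ) ≤ 2)).trans (le_of_eq ?_)
    rw [← ENNReal.rpow_mul]
    norm_num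
  have hconv : ∀ y : F, ‖y‖ₑ ^ (2 : ℝ) = ENNReal.ofReal (‖y‖ ^ 2) := fun y => by
    rw [← ofReal_norm, ENNReal.ofReal_rpow_of_nonneg (norm_nonneg _) (by norm_num)]
    norm_num
  simp only [hconv] at h3
  refine h3.trans (le_of_eq ?_)
  refine lintegral_congr fun t => ?_
  rw [hes, norm_smul, mul_pow, Real.norm_eq_abs, sq_abs]

theorem integrableOn_norm_sq_of_continuous {H : Type*} [NormedAddCommGroup H] {u : E → H}
    (hu : Continuous u) {K : Set E}
    (hK : IsCompact K) : IntegrableOn (fun x => ‖u x‖ ^ 2) K :=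
  (by fun_prop : Continuous fun x => ‖u x‖ ^ 2).continuousOn.integrableOn_compact hK

theorem dist_add_single_le (x : E) (k : Fin 2) (h : ℝ) :
    dist (x + EuclideanSpace.single k h) x = |h| := by
  simp

/-- The `L²` norm of a difference is controlled by that of the derivative. -/
theorem setIntegral_norm_sub_sq_le [CompleteSpace F] {u : E → F} (hu : ContDiff ℝ 1 u) (k : Fin 2)
    {h : ℝ} {K K' : Set E} (hK : IsCompact K) (hK' : IsCompact K')
    (hKK' : ∀ x ∈ K, ∀ t ∈ Set.Ioc (0 : ℝ) 1, x + EuclideanSpace.single k (t * h) ∈ K') :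
    ∫ x in K, ‖u (x + EuclideanSpace.single k h) - u x‖ ^ 2 ≤
      h ^ 2 * ∫ x in K', ‖pd k u x‖ ^ 2 := by
  have hc1 : Continuous fun x => u (x + EuclideanSpace.single k h) - u x :=
    (hu.continuous.comp (by fun_prop)).sub hu.continuous
  have hi1 := integrableOn_norm_sq_of_continuous hc1 hK
  have hi2 := integrableOn_norm_sq_of_continuous (continuous_pd hu k) hK'
  have hr : 0 ≤ h ^ 2 * ∫ x in K', ‖pd k u x‖ ^ 2 :=
    mul_nonneg (by positivity) (integral_nonneg fun x => by positivity)
  refine (ENNReal.ofReal_le_ofReal_iff hr).1 ?_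
  rw [ofReal_integral_eq_lintegral_ofReal hi1 (Eventually.of_forall fun x => by positivity),
    ENNReal.ofReal_mul (by positivity),
    ofReal_integral_eq_lintegral_ofReal hi2 (Eventually.of_forall fun x => by positivity)]
  have hmeas : Measurable (Function.uncurry fun (x : E) (t : ℝ) =>
      ENNReal.ofReal (h ^ 2 * ‖pd k u (x + EuclideanSpace.single k (t * h))‖ ^ 2)) := by
    refine Measurable.ennreal_ofReal (Continuous.measurable ?_)
    have hcs : Continuous fun p : E × ℝ => (EuclideanSpace.single k (p.2 * h) : E) := by
      have : (fun p : E × ℝ => (EuclideanSpace.single k (p.2 * h) : E)) =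
          fun p => (p.2 * h) • EuclideanSpace.single k (1 : ℝ) := by
        funext p
        ext i
        simp
      rw [this]
      fun_prop
    exact continuous_const.mul ((((continuous_pd hu k).comp (continuous_fst.add hcs)).norm).pow 2)
  calc ∫⁻ x in K, ENNReal.ofReal (‖u (x + EuclideanSpace.single k h) - u x‖ ^ 2)
      ≤ ∫⁻ x in K, ∫⁻ t in Set.Ioc (0 : ℝ) 1,
        ENNReal.ofReal (h ^ 2 * ‖pd k u (x + EuclideanSpace.single k (t * h))‖ ^ 2) :=
        lintegral_mono fun x => norm_sub_sq_le_integral hu k h x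
    _ = ∫⁻ t in Set.Ioc (0 : ℝ) 1, ∫⁻ x in K,
        ENNReal.ofReal (h ^ 2 * ‖pd k u (x + EuclideanSpace.single k (t * h))‖ ^ 2) :=
        lintegral_lintegral_swap hmeas.aemeasurable
    _ ≤ ∫⁻ _ in Set.Ioc (0 : ℝ) 1, ENNReal.ofReal (h ^ 2) *
          ∫⁻ x in K', ENNReal.ofReal (‖pd k u x‖ ^ 2) := by
        refine setLIntegral_mono measurable_const fun t ht => ?_
        simp only [ENNReal.ofReal_mul (sq_nonneg h)]
        rw [lintegral_const_mul' _ _ ENNReal.ofReal_ne_top]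
        refine mul_le_mul_right ?_ _
        rw [← lintegral_indicator hK.measurableSet, ← lintegral_indicator hK'.measurableSet,
          ← lintegral_add_right_eq_self (K'.indicator fun x => ENNReal.ofReal (‖pd k u x‖ ^ 2))
            (EuclideanSpace.single k (t * h) : E)]
        refine lintegral_mono fun x => ?_
        by_cases hx : x ∈ K
        · rw [Set.indicator_of_mem hx, Set.indicator_of_mem (hKK' x hx t ht)]
        · rw [Set.indicator_of_notMem hx]
          exact zero_le
    _ = _ := by simp

end Differences

end WSO

namespace WSO

open Filter Topology

/-! ### Negative Sobolev norms -/

section NegSob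

variable {F : Type*} [NormedAddCommGroup F] [NormedSpace ℝ F]

theorem IsTest.of_compact {Ω K : Set E} {φ : E → F} (hφ : ContDiff ℝ ∞ φ) (hK : IsCompact K)
    (hKΩ : K ⊆ Ω) (h : ∀ x, x ∉ K → φ x = 0) : IsTest Ω φ := by
  have hs : tsupport φ ⊆ K := by
    refine closure_minimal (fun x hx => ?_) hK.isClosed
    by_contra hx'
    exact hx (h x hx')
  exact ⟨hφ, hK.of_isClosed_subset (isClosed_tsupport _) hs, hs.trans hKΩ⟩

theorem multiIdx_two :
    multiIdx 2 = {(0, 0), (0, 1), (0, 2), (1, 0), (1, 1), (2, 0)} := by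
  decide

theorem IsTest.setIntegral_smul {Ω : Set E} {φ : E → ℝ} (hφ : IsTest Ω φ) (u : E → F) :
    ∫ x in Ω, φ x • u x = ∫ x, φ x • u x :=
  setIntegral_eq_integral_of_forall_compl_eq_zero fun x hx => by
    simp [hφ.eq_zero_of_notMem hx]

theorem IsTest.setIntegral_smul' {Ω : Set E} {φ : E → F} (hφ : IsTest Ω φ) (u : E → ℝ) :
    ∫ x in Ω, u x • φ x = ∫ x, u x • φ x :=
  setIntegral_eq_integral_of_forall_compl_eq_zero fun x hx => by
    simp [hφ.eq_zero_of_notMem hx]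

theorem IsTest.of_le_one {Ω : Set E} {φ : E → F} (hφ : IsTest Ω φ) : ContDiff ℝ 1 φ :=
  hφ.1.of_le (by simp)

/-- The norm in `W^{-2,1}` of an explicit sum of derivatives of test functions. -/
theorem negSobNorm_le_of_eq {Ω : Set E} {φ S : E → F} {T U : Fin 2 → E → F} (hS : IsTest Ω S)
    (hT : ∀ k, IsTest Ω (T k)) (hU : ∀ k, IsTest Ω (U k))
    (h : ∀ x, φ x = S x + ∑ k, pd k (T k) x + ∑ k, pd k (pd k (U k)) x) :
    negSobNorm 2 Ω φ ≤
      ENNReal.ofReal ((∫ x, ‖S x‖) + ∑ k, (∫ x, ‖T k x‖) + ∑ k, ∫ x, ‖U k x‖) := by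
  classical
  set R : ℕ × ℕ → E → F := fun α =>
    if α = (0, 0) then S else if α = (1, 0) then T 0 else if α = (0, 1) then T 1
    else if α = (2, 0) then U 0 else if α = (0, 2) then U 1 else 0 with hR
  have hsum : IsTest Ω φ := by
    have e : φ = fun x => S x + ∑ k, pd k (T k) x + ∑ k, pd k (pd k (U k)) x := funext h
    rw [e]
    exact (hS.add (IsTest.sum _ fun k => (hT k).pd k)).add (IsTest.sum _ fun k => ((hU k).pd k).pd k)
  have hRt : ∀ α, IsTest Ω (R α) := fun α => by
    simp only [hR]
    split_ifs
    · exact hS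
    · exact hT 0
    · exact hT 1
    · exact hU 0
    · exact hU 1
    · exact isTest_zero Ω
  have rep : IsNegSobRep 2 Ω φ R := by
    refine ⟨(hsum.integrable.integrableOn).locallyIntegrableOn, fun α _ =>
      (hRt α).integrable.integrableOn, fun ψ hψ => ?_⟩
    have ibp1 : ∀ k (V : E → F), IsTest Ω V →
        ∫ x, ψ x • pd k V x = -∫ x, pd k ψ x • V x := fun k V hV =>
      integral_smul_pd hψ.of_le_one hV.of_le_one hψ.2.1 k
    have ibp2 : ∀ k (V : E → F), IsTest Ω V →
        ∫ x, ψ x • pd k (pd k V) x = ∫ x, pd k (pd k ψ) x • V x := fun k V hV => by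
      rw [ibp1 k _ (hV.pd k), integral_smul_pd (hψ.pd k).of_le_one hV.of_le_one (hψ.pd k).2.1 k,
        neg_neg]
    have int : ∀ V : E → F, IsTest Ω V → Integrable fun x => ψ x • V x := fun V hV =>
      (hψ.smul_left hV.1).integrable
    rw [multiIdx_two]
    simp only [hψ.setIntegral_smul, (hRt _).setIntegral_smul']
    simp only [h, smul_add, Fin.sum_univ_two]
    rw [integral_add ((int _ hS).fun_add ((int _ ((hT 0).pd 0)).fun_add (int _ ((hT 1).pd 1))))
        ((int _ (((hU 0).pd 0).pd 0)).fun_add (int _ (((hU 1).pd 1).pd 1))),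
      integral_add (int _ hS) ((int _ ((hT 0).pd 0)).fun_add (int _ ((hT 1).pd 1))),
      integral_add (int _ ((hT 0).pd 0)) (int _ ((hT 1).pd 1)),
      integral_add (int _ (((hU 0).pd 0).pd 0)) (int _ (((hU 1).pd 1).pd 1)),
      ibp1 0 _ (hT 0), ibp1 1 _ (hT 1), ibp2 0 _ (hU 0), ibp2 1 _ (hU 1)]
    simp [hR, pdMulti]
    abel
  refine (iInf₂_le R rep).trans ?_
  have hn : ∀ V : E → F, IsTest Ω V →
      eLpNorm V 1 (volume.restrict Ω) ≤ ENNReal.ofReal (∫ x, ‖V x‖) := fun V hV => by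
    refine (eLpNorm_mono_measure _ Measure.restrict_le_self).trans (le_of_eq ?_)
    rw [eLpNorm_one_eq_lintegral_enorm, ofReal_integral_norm_eq_lintegral_enorm hV.integrable]
  have hz : eLpNorm (0 : E → F) 1 (volume.restrict Ω) = 0 := eLpNorm_zero
  have hp : ∀ V : E → F, 0 ≤ ∫ x, ‖V x‖ := fun V => integral_nonneg fun x => norm_nonneg _
  rw [multiIdx_two]
  simp only [Fin.sum_univ_two]
  rw [ENNReal.ofReal_add (add_nonneg (hp _) (add_nonneg (hp _) (hp _))) (add_nonneg (hp _) (hp _)),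
    ENNReal.ofReal_add (hp _) (add_nonneg (hp _) (hp _)), ENNReal.ofReal_add (hp _) (hp _),
    ENNReal.ofReal_add (hp _) (hp _)]
  have hsumR : ∑ α ∈ ({(0, 0), (0, 1), (0, 2), (1, 0), (1, 1), (2, 0)} : Finset (ℕ × ℕ)),
      eLpNorm (R α) 1 (volume.restrict Ω) =
      eLpNorm S 1 (volume.restrict Ω) + (eLpNorm (T 0) 1 (volume.restrict Ω) +
        eLpNorm (T 1) 1 (volume.restrict Ω)) + (eLpNorm (U 0) 1 (volume.restrict Ω) +
        eLpNorm (U 1) 1 (volume.restrict Ω)) := by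
    simp [hR]
    abel
  rw [hsumR]
  exact add_le_add (add_le_add (hn _ hS) (add_le_add (hn _ (hT 0)) (hn _ (hT 1))))
    (add_le_add (hn _ (hU 0)) (hn _ (hU 1)))

theorem negSobNorm_le_integral_norm {Ω : Set E} {φ : E → F} (hφ : IsTest Ω φ) :
    negSobNorm 2 Ω φ ≤ ENNReal.ofReal (∫ x, ‖φ x‖) := by
  have h0 : ∀ k (x : E), pd k (fun _ : E => (0 : F)) x = 0 := fun k x => by simp [pd]
  have h0' : ∀ k : Fin 2, pd k (fun _ : E => (0 : F)) = fun _ => 0 := fun k => funext (h0 k)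
  have := negSobNorm_le_of_eq (T := fun _ _ => 0) (U := fun _ _ => 0) hφ
    (fun _ => isTest_zero Ω) (fun _ => isTest_zero Ω) (φ := φ) (fun x => by simp [h0'])
  simpa using this

end NegSob

/-! ### Almost solutions of the Euler-Lagrange system -/

section AlmostSolutions

variable {W : Type*} [NormedAddCommGroup W] [InnerProductSpace ℝ W]

/-- `v`, with `P = ∑ₖ aₖ ∂ₖ v`, solves the Euler-Lagrange system of `∫ g(∑ₖ aₖ ∂ₖ v)` up to an
error that is controlled by `θ` times the norm of `W^{-2,1}`. -/
structure IsAlmostSolution (Ω : Set E) (a : Fin 2 → E →L[ℝ] W) (g : W → ℝ) (θ : ℝ) (v : E → E)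
    (P : E → W) : Prop where
  integrable : Integrable v
  memLp : MemLp P 2
  weakOp : WeakOp Ω a v P
  euler : ∀ (φ : E → E) (N : ℝ), IsTest Ω φ → 0 ≤ N → negSobNorm 2 Ω φ ≤ ENNReal.ofReal N →
    |∫ x, (fderiv ℝ g (P x) - fderiv ℝ g 0) (gradA a φ x)| ≤ θ * N
  grad_bound : ∀ K : Set E, IsCompact K → K ⊆ Ω → ∃ C : ℝ, 0 ≤ C ∧ ∀ k, ∀ᶠ n in atTop,
    ∫ x in K, ‖pd k (moll n v) x‖ ^ 2 ≤ C

variable {Ω : Set E} {a : Fin 2 → E →L[ℝ] W} {b : Fin 2 → W →L[ℝ] E} {g : W → ℝ} {θ lam L : ℝ}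
  {v : E → E} {P : E → W}

/-- Subtracting Dg(0) makes the stress vanish wherever P does. For P extended by zero it is thus
square integrable over the whole plane, and translations and mollifications can be used freely. -/
theorem memLp_stress (hg : HasHessBounds lam L g) (hP : MemLp P 2) :
    MemLp (fun x => fderiv ℝ g (P x) - fderiv ℝ g 0) 2 := by
  refine MemLp.of_le_mul (c := L) hP ?_ (Eventually.of_forall fun x => hg.norm_fderiv_le (P x))
  exact ((contDiff_fderiv hg.contDiff).continuous.comp_aestronglyMeasurable hP.1).sub
    aestronglyMeasurable_const

theorem pd_pow_four {ρ : E → ℝ} (hρ : ContDiff ℝ ∞ ρ) (k : Fin 2) (x : E) :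
    pd k (fun y => ρ y ^ 4) x = 4 * ρ x ^ 3 * pd k ρ x := by
  have h := ((differentiable_of_smooth hρ x).hasFDerivAt.pow 4).fderiv
  simp [pd, h]

theorem IsTest.pow_four {ρ : E → ℝ} (hρ : IsTest Ω ρ) : IsTest Ω fun y => ρ y ^ 4 :=
  hρ.of_tsupport (hρ.1.pow 4) fun x hx => by simp [image_eq_zero_of_notMem_tsupport hx]

theorem norm_sum_smul_le (a : Fin 2 → E →L[ℝ] W) {c : Fin 2 → ℝ} {M : ℝ} (hM : ∀ l, |c l| ≤ M)
    (y : E) : ‖∑ l, c l • a l y‖ ≤ (∑ l, ‖a l‖) * M * ‖y‖ := by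
  refine (norm_sum_le _ _).trans ?_
  rw [Finset.sum_mul, Finset.sum_mul]
  refine Finset.sum_le_sum fun l _ => ?_
  rw [norm_smul, Real.norm_eq_abs]
  have h1 := (a l).le_opNorm y
  have h2 := hM l
  calc |c l| * ‖a l y‖ ≤ M * (‖a l‖ * ‖y‖) :=
        mul_le_mul h2 h1 (norm_nonneg _) ((abs_nonneg _).trans h2)
    _ = ‖a l‖ * M * ‖y‖ := by ring

variable [FiniteDimensional ℝ W]

/-- The difference of a mollified almost solution, localised. -/
theorem gradA_smul_difference (hv : Integrable v) (hw : WeakOp Ω a v P)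
    {q : E → ℝ} (hq : IsTest Ω q) {n : ℕ} {e : E}
    (hball : ∀ x ∈ tsupport q, Metric.closedBall x (bumpSeq n).rOut ⊆ Ω ∧
      Metric.closedBall (x + e) (bumpSeq n).rOut ⊆ Ω) (x : E) :
    gradA a (fun y => q y • (moll n v (y + e) - moll n v y)) x =
      q x • (moll n P (x + e) - moll n P x) +
        ∑ l, pd l q x • a l (moll n v (x + e) - moll n v x) := by
  have sv := contDiff_moll n hv.locallyIntegrable
  have sve : ContDiff ℝ ∞ fun y => moll n v (y + e) := sv.comp (contDiff_id.add contDiff_const)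
  have dv := differentiable_of_smooth sv
  have dve := differentiable_of_smooth sve
  unfold gradA
  have h1 : ∀ l, pd l (fun y => q y • (moll n v (y + e) - moll n v y)) x =
      pd l q x • (moll n v (x + e) - moll n v x) +
        q x • (pd l (moll n v) (x + e) - pd l (moll n v) x) := fun l => by
    rw [pd_smul (differentiable_of_smooth hq.1 x) ((dve x).fun_sub (dv x)), pd_sub (dve x) (dv x),
      pd_comp_add_right]
  simp only [h1, map_add, map_smul, Finset.sum_add_distrib, map_sub]
  rw [add_comm]
  congr 1
  rw [← Finset.smul_sum, Finset.sum_sub_distrib]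
  by_cases hx : x ∈ tsupport q
  · rw [hw.moll_eq hv.locallyIntegrable (hball x hx).1,
      hw.moll_eq hv.locallyIntegrable (hball x hx).2]
  · simp [image_eq_zero_of_notMem_tsupport hx]

end AlmostSolutions

end WSO

namespace WSO

open Filter Topology

/-! ### Difference quotients of `P` for almost solutions. -/

section DifferenceEstimate

variable {W : Type*} [NormedAddCommGroup W] [InnerProductSpace ℝ W]

variable {Ω : Set E} {a : Fin 2 → E →L[ℝ] W} {b : Fin 2 → W →L[ℝ] E} {g : W → ℝ} {θ lam L : ℝ}
  {v : E → E} {P : E → W}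

theorem isTest_difference {F : Type*} [NormedAddCommGroup F] [NormedSpace ℝ F] {ψ : E → F}
    (hψ : IsTest Ω ψ) {K₁ : Set E} (hK₁ : IsCompact K₁) (hK₁Ω : K₁ ⊆ Ω) {e : E}
    (h1 : tsupport ψ ⊆ K₁) (h2 : ∀ x ∈ tsupport ψ, x + e ∈ K₁) :
    IsTest Ω (fun x => ψ (x + -e) - ψ x) ∧ ∀ x, x ∉ K₁ → ψ (x + -e) - ψ x = 0 := by
  have hz : ∀ x, x ∉ K₁ → ψ (x + -e) - ψ x = 0 := fun x hx => by
    have e1 : ψ x = 0 := image_eq_zero_of_notMem_tsupport fun h => hx (h1 h)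
    have e2 : ψ (x + -e) = 0 := image_eq_zero_of_notMem_tsupport fun h => hx (by
      simpa using h2 _ h)
    simp [e1, e2]
  exact ⟨IsTest.of_compact ((hψ.1.comp (contDiff_id.add contDiff_const)).sub hψ.1) hK₁ hK₁Ω hz, hz⟩

/-- The system is tested with a backward difference of ψ, and a translation moves the difference
onto the stress. In the error term the norm of W^{-2,1} is simply estimated by the norm of L¹. -/
theorem IsAlmostSolution.abs_integral_difference_le (h : IsAlmostSolution Ω a g θ v P)
    (hg : HasHessBounds lam L g) {ψ : E → E} (hψ : IsTest Ω ψ) {K₁ : Set E} (hK₁ : IsCompact K₁)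
    (hK₁Ω : K₁ ⊆ Ω) {e : E} (h1 : tsupport ψ ⊆ K₁) (h2 : ∀ x ∈ tsupport ψ, x + e ∈ K₁) :
    |∫ x, (fderiv ℝ g (P (x + e)) - fderiv ℝ g (P x)) (gradA a ψ x)| ≤
      θ * ∫ x, ‖ψ (x + -e) - ψ x‖ := by
  obtain ⟨ht, -⟩ := isTest_difference hψ hK₁ hK₁Ω h1 h2
  have hE := h.euler _ _ ht (integral_nonneg fun x => norm_nonneg _) (negSobNorm_le_integral_norm ht)
  refine le_trans (le_of_eq ?_) hE
  congr 1
  have dψ := differentiable_of_smooth hψ.1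
  have dψe : Differentiable ℝ fun x => ψ (x + -e) :=
    differentiable_of_smooth (hψ.1.comp (contDiff_id.add contDiff_const))
  have hgr : ∀ x, gradA a (fun x => ψ (x + -e) - ψ x) x = gradA a ψ (x + -e) - gradA a ψ x :=
    fun x => by
      unfold gradA
      rw [← Finset.sum_sub_distrib]
      refine Finset.sum_congr rfl fun k _ => ?_
      rw [pd_sub (dψe x) (dψ x), pd_comp_add_right, map_sub]
  set σ := fun x => fderiv ℝ g (P x) - fderiv ℝ g 0 with hσ
  have hσm : MemLp σ 2 := memLp_stress hg h.memLp
  have hXm : MemLp (gradA a ψ) 2 := hψ.gradA.memLp 2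
  have hXme : MemLp (fun x => gradA a ψ (x + -e)) 2 := memLp_comp_add_right hXm _
  have hσe : MemLp (fun x => σ (x + e)) 2 := memLp_comp_add_right hσm _
  have i1 : Integrable fun x => σ x (gradA a ψ (x + -e)) :=
    integrable_bilin (ContinuousLinearMap.id ℝ (W →L[ℝ] ℝ)) hσm hXme
  have i2 : Integrable fun x => σ x (gradA a ψ x) :=
    integrable_bilin (ContinuousLinearMap.id ℝ (W →L[ℝ] ℝ)) hσm hXm
  have i3 : Integrable fun x => σ (x + e) (gradA a ψ x) :=
    integrable_bilin (ContinuousLinearMap.id ℝ (W →L[ℝ] ℝ)) hσe hXm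
  have e1 : ∀ x, (fderiv ℝ g (P (x + e)) - fderiv ℝ g (P x)) (gradA a ψ x) =
      σ (x + e) (gradA a ψ x) - σ x (gradA a ψ x) := fun x => by
    simp [hσ]
  have e2 : ∫ x, σ x (gradA a ψ (x + -e)) = ∫ x, σ (x + e) (gradA a ψ x) := by
    rw [← integral_add_right_eq_self (fun x => σ x (gradA a ψ (x + -e))) e]
    simp
  simp only [e1]
  rw [integral_sub i3 i2, ← e2, ← integral_sub i1 i2]
  refine integral_congr_ae (Eventually.of_forall fun x => ?_)
  simp only [hgr, map_sub, hσ]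

/-- Young's inequality with weight τ/h² trades the L¹ norm of a difference for a small multiple of
the square of the gradient of ψ, plus a term of order h². In the application ψ is itself a localised
difference with step h. By Korn's inequality the first term can then be absorbed, and the second has
the order required of squared difference quotients. -/
theorem FactorsLaplacian.integral_norm_difference_le (hab : FactorsLaplacian a b)
    {ψ : E → E} (hψ : IsTest Ω ψ) {K₁ : Set E} (hK₁ : IsCompact K₁) (hK₁Ω : K₁ ⊆ Ω) {k : Fin 2}
    {h τ : ℝ} (hh : 0 < h) (hτ : 0 < τ) (h1 : tsupport ψ ⊆ K₁)
    (h2 : ∀ x ∈ tsupport ψ, x + EuclideanSpace.single k h ∈ K₁) :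
    ∫ x, ‖ψ (x + -EuclideanSpace.single k h) - ψ x‖ ≤
      τ * ((∑ l, ‖b l‖ ^ 2) * ∫ x, ‖WSO.gradA a ψ x‖ ^ 2) + h ^ 2 * (volume.real K₁ / (4 * τ)) := by
  obtain ⟨ht, hz⟩ := isTest_difference hψ hK₁ hK₁Ω h1 h2
  set φ := fun x => ψ (x + -EuclideanSpace.single k h) - ψ x with hφ
  have hsq : Integrable fun x => ‖φ x‖ ^ 2 := integrable_norm_sq (ht.memLp 2)
  have hind : Integrable (K₁.indicator fun _ => h ^ 2 / (4 * τ)) :=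
    (integrable_indicator_iff hK₁.measurableSet).2 (integrableOn_const hK₁.measure_lt_top.ne)
  have hpt : ∀ x, ‖φ x‖ ≤ τ / h ^ 2 * ‖φ x‖ ^ 2 + K₁.indicator (fun _ => h ^ 2 / (4 * τ)) x := by
    intro x
    by_cases hx : x ∈ K₁
    · rw [Set.indicator_of_mem hx]
      have key : 0 ≤ (2 * τ * ‖φ x‖ - h ^ 2) ^ 2 / (4 * τ * h ^ 2) := by positivity
      have : (2 * τ * ‖φ x‖ - h ^ 2) ^ 2 / (4 * τ * h ^ 2) =
          τ / h ^ 2 * ‖φ x‖ ^ 2 + h ^ 2 / (4 * τ) - ‖φ x‖ := by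
        field_simp
        ring
      linarith
    · rw [Set.indicator_of_notMem hx, add_zero]
      have : φ x = 0 := hz x hx
      simp [this]
  have hsqK : ∫ x, ‖φ x‖ ^ 2 ≤ h ^ 2 * ∫ x, ‖pd k ψ x‖ ^ 2 := by
    have e0 : ∫ x, ‖φ x‖ ^ 2 = ∫ x in K₁, ‖φ x‖ ^ 2 :=
      (setIntegral_eq_integral_of_forall_compl_eq_zero fun x hx => by
        have : φ x = 0 := hz x hx
        simp [this]).symm
    have e1 : (-EuclideanSpace.single k h : E) = EuclideanSpace.single k (-h) := by
      ext i
      simp only [PiLp.neg_apply, PiLp.single_apply]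
      split_ifs <;> simp
    have e2 := setIntegral_norm_sub_sq_le hψ.of_le_one k (h := -h) hK₁
      (hK₁.cthickening (r := h)) (fun x hx t htt => by
        refine Metric.mem_cthickening_of_dist_le _ x h _ hx ?_
        rw [dist_add_single_le, abs_mul, abs_neg, abs_of_pos hh, abs_of_pos htt.1]
        nlinarith [htt.2])
    rw [e0]
    simp only [hφ, e1]
    refine e2.trans ?_
    rw [neg_sq]
    refine mul_le_mul_of_nonneg_left ?_ (by positivity)
    exact setIntegral_le_integral (integrable_norm_sq ((hψ.pd k).memLp 2))
      (Eventually.of_forall fun x => by positivity)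
  have hkorn := hab.korn hψ k
  calc ∫ x, ‖φ x‖ ≤ ∫ x, (τ / h ^ 2 * ‖φ x‖ ^ 2 + K₁.indicator (fun _ => h ^ 2 / (4 * τ)) x) :=
        integral_mono ht.integrable.norm ((hsq.const_mul _).add hind) hpt
    _ = τ / h ^ 2 * (∫ x, ‖φ x‖ ^ 2) + h ^ 2 * (volume.real K₁ / (4 * τ)) := by
        rw [integral_add (hsq.const_mul _) hind, integral_const_mul,
          integral_indicator hK₁.measurableSet, setIntegral_const, smul_eq_mul]
        ring
    _ ≤ τ / h ^ 2 * (h ^ 2 * ((∑ l, ‖b l‖ ^ 2) * ∫ x, ‖WSO.gradA a ψ x‖ ^ 2)) +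
        h ^ 2 * (volume.real K₁ / (4 * τ)) := by
        gcongr
        exact hsqK.trans (mul_le_mul_of_nonneg_left hkorn (by positivity))
    _ = _ := by
        field_simp

variable [FiniteDimensional ℝ W]

/-- The estimate for the differences of `P`, before passing to the limit in the mollification. -/
theorem IsAlmostSolution.difference_estimate (h : IsAlmostSolution Ω a g θ v P)
    (hab : FactorsLaplacian a b) (hg : HasHessBounds lam L g) (hlam : 0 < lam) (hθ : 0 ≤ θ)
    {ρ : E → ℝ} (hρ : IsTest Ω ρ) (hρ0 : ∀ x, 0 ≤ ρ x) (hρ1 : ∀ x, ρ x ≤ 1) {M : ℝ}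
    (hM : ∀ l x, |pd l ρ x| ≤ M) {K₁ : Set E} (hK₁ : IsCompact K₁) (hK₁Ω : K₁ ⊆ Ω) {k : Fin 2}
    {n : ℕ} {η τ c₁ C₁ : ℝ} (hη : 0 < η) (hτ : 0 < τ) (hτl : 2 * (θ * τ * ∑ l, ‖b l‖ ^ 2) ≤ lam / 4)
    (hc₁ : c₁ = (∑ l, ‖a l‖) * (4 * M))
    (hsub : ∀ x ∈ tsupport ρ, ∀ t ∈ Set.Icc (0 : ℝ) 1, x + EuclideanSpace.single k (t * η) ∈ K₁)
    (hball : ∀ x ∈ K₁, Metric.closedBall x (bumpSeq n).rOut ⊆ Ω)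
    (hC₁ : ∫ x in K₁, ‖pd k (moll n v) x‖ ^ 2 ≤ C₁) :
    ∫ x, (fderiv ℝ g (P (x + EuclideanSpace.single k η)) - fderiv ℝ g (P x))
        (ρ x ^ 4 • (moll n P (x + EuclideanSpace.single k η) - moll n P x)) ≤
      lam / 4 * (∫ x, ‖ρ x ^ 2 • (P (x + EuclideanSpace.single k η) - P x)‖ ^ 2) +
      lam / 4 * (∫ x, ‖ρ x ^ 2 • (moll n P (x + EuclideanSpace.single k η) - moll n P x)‖ ^ 2) +
      (θ * (τ * ((∑ l, ‖b l‖ ^ 2) * (2 * c₁ ^ 2 * C₁)) + volume.real K₁ / (4 * τ))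
        + L ^ 2 * c₁ ^ 2 / lam * C₁) * η ^ 2 := by
  set e : E := EuclideanSpace.single k η with he
  set K := tsupport ρ with hK
  have hKc : IsCompact K := hρ.2.1
  have hM0 : 0 ≤ M := (abs_nonneg _).trans (hM 0 0)
  have hc0 : 0 ≤ c₁ := by
    rw [hc₁]
    exact mul_nonneg (Finset.sum_nonneg fun l _ => norm_nonneg _) (by linarith)
  have hKK₁ : K ⊆ K₁ := fun x hx => by
    have h0 := hsub x hx 0 ⟨le_rfl, zero_le_one⟩
    have e0 : (EuclideanSpace.single k (0 * η) : E) = 0 := by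
      ext i
      simp
    rwa [e0, add_zero] at h0
  have hKe : ∀ x ∈ K, x + e ∈ K₁ := fun x hx => by
    have := hsub x hx 1 ⟨zero_le_one, le_rfl⟩
    simpa [he] using this
  have hq : IsTest Ω fun y => ρ y ^ 4 := hρ.pow_four
  have hqK : tsupport (fun y => ρ y ^ 4) ⊆ K := by
    refine closure_minimal (fun x hx => ?_) (isClosed_tsupport _)
    by_contra hx'
    exact hx (by simp [image_eq_zero_of_notMem_tsupport hx'])
  have sv := contDiff_moll n h.integrable.locallyIntegrable
  set dv : E → E := fun x => moll n v (x + e) - moll n v x with hdv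
  have sdv : ContDiff ℝ ∞ dv := (sv.comp (contDiff_id.add contDiff_const)).sub sv
  set ψ : E → E := fun y => ρ y ^ 4 • dv y with hψdef
  have hψ : IsTest Ω ψ := hq.smul_left sdv
  have hψK : tsupport ψ ⊆ K := by
    refine closure_minimal (fun x hx => ?_) (isClosed_tsupport _)
    by_contra hx'
    exact hx (by simp [hψdef, image_eq_zero_of_notMem_tsupport hx'])
  set dP : E → W := fun x => P (x + e) - P x with hdP
  set dPn : E → W := fun x => moll n P (x + e) - moll n P x with hdPn
  set D : E → W →L[ℝ] ℝ := fun x => fderiv ℝ g (P (x + e)) - fderiv ℝ g (P x) with hD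
  set Y : E → W := fun x => ∑ l, pd l (fun y => ρ y ^ 4) x • a l (dv x) with hY
  have hX : ∀ x, gradA a ψ x = ρ x ^ 4 • dPn x + Y x := fun x =>
    gradA_smul_difference h.integrable h.weakOp hq (fun y hy =>
      ⟨hball y (hKK₁ (hqK hy)), hball _ (hKe y (hqK hy))⟩) x
  -- Of the three factors ρ left by differentiating ρ⁴, two are kept; in Young's inequality they are
  -- paired with the difference of P.
  have hYle : ∀ x, ‖Y x‖ ≤ ρ x ^ 2 * (c₁ * ‖dv x‖) := fun x => by
    have hcl : ∀ l, |pd l (fun y => ρ y ^ 4) x| ≤ 4 * M * ρ x ^ 2 := fun l => by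
      rw [pd_pow_four hρ.1, abs_mul, abs_of_nonneg (by have := hρ0 x; positivity)]
      have := hM l x
      have h0 := hρ0 x
      have h1 := hρ1 x
      calc 4 * ρ x ^ 3 * |pd l ρ x| ≤ 4 * ρ x ^ 3 * M := by gcongr
        _ = 4 * M * ρ x ^ 2 * ρ x := by ring
        _ ≤ 4 * M * ρ x ^ 2 * 1 := by gcongr
        _ = _ := by ring
    refine (norm_sum_smul_le a hcl (dv x)).trans (le_of_eq ?_)
    rw [hc₁]
    ring
  have hY0 : ∀ x, x ∉ K → Y x = 0 := fun x hx => by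
    have : ρ x = 0 := image_eq_zero_of_notMem_tsupport hx
    have h' := hYle x
    rw [this] at h'
    simpa using h'
  have hDle : ∀ x, ‖D x‖ ≤ L * ‖dP x‖ := fun x => hg.norm_fderiv_sub_le _ _
  have hPe : MemLp dP 2 := (memLp_comp_add_right h.memLp e).sub h.memLp
  have hPn := memLp_moll n (by norm_num) (by norm_num) h.memLp
  have hPne : MemLp dPn 2 := (memLp_comp_add_right hPn e).sub hPn
  have hDm : MemLp D 2 := by
    have h1 := memLp_stress hg h.memLp
    have h2 := (memLp_comp_add_right h1 e).sub h1
    refine (memLp_congr_ae (Eventually.of_forall fun x => ?_)).1 h2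
    simp [hD]
  have hρc : Continuous ρ := hρ.continuous
  have wmem : ∀ {Z : E → W}, MemLp Z 2 → ∀ m : ℕ, MemLp (fun x => ρ x ^ m • Z x) 2 := fun hZ m => by
    refine MemLp.of_le_mul (c := 1) hZ ((hρc.pow m).aestronglyMeasurable.smul hZ.1)
      (Eventually.of_forall fun x => ?_)
    rw [norm_smul, Real.norm_of_nonneg (pow_nonneg (hρ0 x) m)]
    exact mul_le_mul_of_nonneg_right (pow_le_one₀ (hρ0 x) (hρ1 x)) (norm_nonneg _)
  have hR := wmem hPe 2
  have hRn := wmem hPne 2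
  have hqn := wmem hPne 4
  have hXm : MemLp (gradA a ψ) 2 := hψ.gradA.memLp 2
  have hYm : MemLp Y 2 := by
    refine (memLp_congr_ae (Eventually.of_forall fun x => ?_)).1 (hXm.sub hqn)
    simp [hX]
  have iDX : Integrable fun x => D x (gradA a ψ x) :=
    integrable_bilin (ContinuousLinearMap.id ℝ (W →L[ℝ] ℝ)) hDm hXm
  have iDY : Integrable fun x => D x (Y x) :=
    integrable_bilin (ContinuousLinearMap.id ℝ (W →L[ℝ] ℝ)) hDm hYm
  have idv : IntegrableOn (fun x => ‖dv x‖ ^ 2) K :=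
    integrableOn_norm_sq_of_continuous sdv.continuous hKc
  have idv' : Integrable (K.indicator fun x => ‖dv x‖ ^ 2) :=
    (integrable_indicator_iff hKc.measurableSet).2 idv
  have iR := integrable_norm_sq hR
  have iRn := integrable_norm_sq hRn
  have hdvC : ∫ x, K.indicator (fun x => ‖dv x‖ ^ 2) x ≤ η ^ 2 * C₁ := by
    rw [integral_indicator hKc.measurableSet]
    refine (setIntegral_norm_sub_sq_le (sv.of_le (by simp)) k hKc hK₁ fun x hx t ht =>
      hsub x hx t ⟨ht.1.le, ht.2⟩).trans ?_
    exact mul_le_mul_of_nonneg_left hC₁ (by positivity)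
  have hDY : |∫ x, D x (Y x)| ≤
      lam / 4 * (∫ x, ‖ρ x ^ 2 • dP x‖ ^ 2) + L ^ 2 * c₁ ^ 2 / lam * (η ^ 2 * C₁) := by
    have hpt : ∀ x, |D x (Y x)| ≤ lam / 4 * ‖ρ x ^ 2 • dP x‖ ^ 2 +
        L ^ 2 * c₁ ^ 2 / lam * K.indicator (fun x => ‖dv x‖ ^ 2) x := fun x => by
      by_cases hx : x ∈ K
      · rw [Set.indicator_of_mem hx, norm_smul, Real.norm_of_nonneg (pow_nonneg (hρ0 x) 2)]
        have e1 : |D x (Y x)| ≤ L * ‖dP x‖ * (ρ x ^ 2 * (c₁ * ‖dv x‖)) := by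
          refine ((D x).le_opNorm (Y x)).trans ?_
          exact mul_le_mul (hDle x) (hYle x) (norm_nonneg _)
            (mul_nonneg hg.L_nonneg (norm_nonneg _))
        -- The square whose expansion is Young's inequality with weight λ/4 on the difference of P.
        have e2 : 0 ≤ (lam * (ρ x ^ 2 * ‖dP x‖) - 2 * L * c₁ * ‖dv x‖) ^ 2 / (4 * lam) := by
          positivity
        have e3 : (lam * (ρ x ^ 2 * ‖dP x‖) - 2 * L * c₁ * ‖dv x‖) ^ 2 / (4 * lam) =
            lam / 4 * (ρ x ^ 2 * ‖dP x‖) ^ 2 + L ^ 2 * c₁ ^ 2 / lam * ‖dv x‖ ^ 2 -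
              L * ‖dP x‖ * (ρ x ^ 2 * (c₁ * ‖dv x‖)) := by
          field_simp
          ring
        linarith
      · rw [hY0 x hx, map_zero, abs_zero, Set.indicator_of_notMem hx]
        positivity
    calc |∫ x, D x (Y x)| ≤ ∫ x, |D x (Y x)| := abs_integral_le_integral_abs
      _ ≤ ∫ x, (lam / 4 * ‖ρ x ^ 2 • dP x‖ ^ 2 +
          L ^ 2 * c₁ ^ 2 / lam * K.indicator (fun x => ‖dv x‖ ^ 2) x) :=
          integral_mono iDY.abs ((iR.const_mul _).add (idv'.const_mul _)) hpt
      _ = lam / 4 * (∫ x, ‖ρ x ^ 2 • dP x‖ ^ 2) +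
          L ^ 2 * c₁ ^ 2 / lam * ∫ x, K.indicator (fun x => ‖dv x‖ ^ 2) x := by
          rw [integral_add (iR.const_mul _) (idv'.const_mul _), integral_const_mul,
            integral_const_mul]
      _ ≤ _ := by
          gcongr
  have hXX : ∫ x, ‖gradA a ψ x‖ ^ 2 ≤
      2 * (∫ x, ‖ρ x ^ 2 • dPn x‖ ^ 2) + 2 * c₁ ^ 2 * (η ^ 2 * C₁) := by
    have hpt : ∀ x, ‖gradA a ψ x‖ ^ 2 ≤ 2 * ‖ρ x ^ 2 • dPn x‖ ^ 2 +
        2 * c₁ ^ 2 * K.indicator (fun x => ‖dv x‖ ^ 2) x := fun x => by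
      have p2 : 0 ≤ ρ x ^ 2 := pow_nonneg (hρ0 x) 2
      have p2' : ρ x ^ 2 ≤ 1 := pow_le_one₀ (hρ0 x) (hρ1 x)
      have e1 : ‖ρ x ^ 4 • dPn x‖ ≤ ‖ρ x ^ 2 • dPn x‖ := by
        have : ρ x ^ 4 • dPn x = ρ x ^ 2 • (ρ x ^ 2 • dPn x) := by rw [smul_smul]; ring_nf
        rw [this, norm_smul, Real.norm_of_nonneg p2]
        exact mul_le_of_le_one_left (norm_nonneg _) p2'
      by_cases hx : x ∈ K
      · rw [Set.indicator_of_mem hx, hX]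
        have e2 := norm_add_le (ρ x ^ 4 • dPn x) (Y x)
        have e3 : ‖Y x‖ ≤ c₁ * ‖dv x‖ :=
          (hYle x).trans (mul_le_of_le_one_left (by positivity) p2')
        have e4 : ‖ρ x ^ 4 • dPn x + Y x‖ ≤ ‖ρ x ^ 2 • dPn x‖ + c₁ * ‖dv x‖ := by linarith
        have e5 : ‖ρ x ^ 4 • dPn x + Y x‖ ^ 2 ≤ (‖ρ x ^ 2 • dPn x‖ + c₁ * ‖dv x‖) ^ 2 := by
          gcongr
        nlinarith [sq_nonneg (‖ρ x ^ 2 • dPn x‖ - c₁ * ‖dv x‖)]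
      · rw [Set.indicator_of_notMem hx, hX, hY0 x hx, add_zero, mul_zero, add_zero]
        have : ‖ρ x ^ 4 • dPn x‖ ^ 2 ≤ ‖ρ x ^ 2 • dPn x‖ ^ 2 := by gcongr
        nlinarith [sq_nonneg ‖ρ x ^ 2 • dPn x‖]
    calc ∫ x, ‖gradA a ψ x‖ ^ 2 ≤ ∫ x, (2 * ‖ρ x ^ 2 • dPn x‖ ^ 2 +
          2 * c₁ ^ 2 * K.indicator (fun x => ‖dv x‖ ^ 2) x) :=
          integral_mono (integrable_norm_sq hXm) ((iRn.const_mul _).add (idv'.const_mul _)) hpt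
      _ = 2 * (∫ x, ‖ρ x ^ 2 • dPn x‖ ^ 2) +
          2 * c₁ ^ 2 * ∫ x, K.indicator (fun x => ‖dv x‖ ^ 2) x := by
          rw [integral_add (iRn.const_mul _) (idv'.const_mul _), integral_const_mul,
            integral_const_mul]
      _ ≤ _ := by
          gcongr
  have hEL := h.abs_integral_difference_le hg hψ hK₁ hK₁Ω (e := e) (hψK.trans hKK₁)
    fun x hx => hKe x (hψK hx)
  have hKo := hab.integral_norm_difference_le hψ hK₁ hK₁Ω hη hτ (hψK.trans hKK₁)
    fun x hx => hKe x (hψK hx)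
  have hsplit : ∫ x, D x (ρ x ^ 4 • dPn x) = (∫ x, D x (gradA a ψ x)) - ∫ x, D x (Y x) := by
    rw [← integral_sub iDX iDY]
    refine integral_congr_ae (Eventually.of_forall fun x => ?_)
    simp only [hX, map_add, add_sub_cancel_right]
  rw [hsplit]
  have hb0 : 0 ≤ ∑ l, ‖b l‖ ^ 2 := Finset.sum_nonneg fun l _ => by positivity
  have hs0 : 0 ≤ ∫ x, ‖ρ x ^ 2 • dPn x‖ ^ 2 := integral_nonneg fun x => by positivity
  have f1 := (abs_le.1 hEL).2
  have f2 := (abs_le.1 hDY).1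
  have f3 := mul_le_mul_of_nonneg_left hKo hθ
  have f4 : θ * (τ * ((∑ l, ‖b l‖ ^ 2) * ∫ x, ‖gradA a ψ x‖ ^ 2)) ≤
      θ * (τ * ((∑ l, ‖b l‖ ^ 2) *
        (2 * (∫ x, ‖ρ x ^ 2 • dPn x‖ ^ 2) + 2 * c₁ ^ 2 * (η ^ 2 * C₁)))) := by
    gcongr
  have f5 := mul_le_mul_of_nonneg_right hτl hs0
  nlinarith

/-- The differences of `P` are controlled in `L²_loc`. -/
theorem IsAlmostSolution.exists_difference_bound (h : IsAlmostSolution Ω a g θ v P)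
    (hΩ : IsOpen Ω) (hab : FactorsLaplacian a b) (hg : HasHessBounds lam L g) (hlam : 0 < lam)
    (hθ : 0 ≤ θ) {ρ : E → ℝ} (hρ : IsTest Ω ρ) (hρ0 : ∀ x, 0 ≤ ρ x) (hρ1 : ∀ x, ρ x ≤ 1) :
    ∃ C η₀ : ℝ, 0 < η₀ ∧ ∀ k : Fin 2, ∀ η : ℝ, 0 < η → η < η₀ →
      ∫ x, ‖ρ x ^ 2 • (P (x + EuclideanSpace.single k η) - P x)‖ ^ 2 ≤ C * η ^ 2 := by
  obtain ⟨r, hr, hrΩ⟩ := (show IsCompact (tsupport ρ) from hρ.2.1).exists_cthickening_subset_open hΩ hρ.2.2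
  set K₁ := Metric.cthickening (r / 2) (tsupport ρ) with hK₁
  have hK₁c : IsCompact K₁ := (show IsCompact (tsupport ρ) from hρ.2.1).cthickening
  have hth : Metric.cthickening (r / 2) K₁ ⊆ Metric.cthickening r (tsupport ρ) := by
    refine (Metric.cthickening_cthickening_subset (by linarith) (by linarith) _).trans ?_
    rw [add_halves]
  have hK₁Ω : K₁ ⊆ Ω := (Metric.cthickening_mono (by linarith) _).trans hrΩ
  obtain ⟨C₁, hC₁0, hC₁⟩ := h.grad_bound K₁ hK₁c hK₁Ω
  obtain ⟨M₀, hM₀, hM₀'⟩ := (hρ.pd 0).bounded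
  obtain ⟨M₁, hM₁, hM₁'⟩ := (hρ.pd 1).bounded
  have hM : ∀ l x, |pd l ρ x| ≤ max M₀ M₁ := fun l x => by
    fin_cases l
    · exact (hM₀' x).trans (le_max_left _ _)
    · exact (hM₁' x).trans (le_max_right _ _)
  set B := ∑ l, ‖b l‖ ^ 2 with hB
  have hB0 : 0 ≤ B := Finset.sum_nonneg fun l _ => by positivity
  set c₁ := (∑ l, ‖a l‖) * (4 * max M₀ M₁) with hc₁
  -- So small that the share of the Ekeland error that falls on the squared difference of P is at
  -- most λ/4. The factor 2 in `hτl` comes from (x+y)² ≤ 2x² + 2y², and the summand 1 covers θB = 0.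
  set τ := lam / (8 * (θ * B + 1)) with hτ
  have hden : 0 < θ * B + 1 := by positivity
  have hτ0 : 0 < τ := by positivity
  have hτl : 2 * (θ * τ * B) ≤ lam / 4 := by
    have : τ * (8 * (θ * B + 1)) = lam := by
      rw [hτ]
      field_simp
    nlinarith
  set C₄ := θ * (τ * (B * (2 * c₁ ^ 2 * C₁)) + volume.real K₁ / (4 * τ)) +
    L ^ 2 * c₁ ^ 2 / lam * C₁ with hC₄
  refine ⟨2 * C₄ / lam, r / 2, by linarith, fun k η hη hηr => ?_⟩
  set e : E := EuclideanSpace.single k η with he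
  have hsub : ∀ x ∈ tsupport ρ, ∀ t ∈ Set.Icc (0 : ℝ) 1,
      x + EuclideanSpace.single k (t * η) ∈ K₁ := fun x hx t ht => by
    refine Metric.mem_cthickening_of_dist_le _ x _ _ hx ?_
    rw [dist_add_single_le, abs_mul, abs_of_pos hη, abs_of_nonneg ht.1]
    nlinarith [ht.2]
  -- The test field has to be smooth, so it is built from the mollification of v, whose gradient is
  -- bounded in L² on K₁ uniformly for large n. The stress is that of P itself.
  have hev : ∀ᶠ n in atTop, ∫ x, (fderiv ℝ g (P (x + e)) - fderiv ℝ g (P x))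
        (ρ x ^ 4 • (moll n P (x + e) - moll n P x)) ≤
      lam / 4 * (∫ x, ‖ρ x ^ 2 • (P (x + e) - P x)‖ ^ 2) +
      lam / 4 * (∫ x, ‖ρ x ^ 2 • (moll n P (x + e) - moll n P x)‖ ^ 2) + C₄ * η ^ 2 := by
    filter_upwards [hC₁ k, tendsto_bumpSeq_rOut.eventually (gt_mem_nhds (half_pos hr))] with n hn1 hn2
    refine h.difference_estimate hab hg hlam hθ hρ hρ0 hρ1 hM hK₁c hK₁Ω hη hτ0 hτl hc₁ hsub
      (fun x hx => ?_) hn1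
    refine (fun y hy => hrΩ (hth ?_))
    exact Metric.mem_cthickening_of_dist_le _ x _ _ hx ((Metric.mem_closedBall.1 hy).trans hn2.le)
  have hmoll := lpTendsto_moll (by norm_num) (by norm_num) h.memLp
  have hd := (hmoll.comp_add_right e).sub (by norm_num) hmoll
  have hρc : Continuous ρ := hρ.continuous
  have hw : ∀ m : ℕ, ∀ x, ‖ρ x ^ m‖ ≤ 1 := fun m x => by
    rw [Real.norm_of_nonneg (pow_nonneg (hρ0 x) m)]
    exact pow_le_one₀ (hρ0 x) (hρ1 x)
  have h2 := hd.smul (hρc.pow 2).aestronglyMeasurable (hw 2)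
  have h4 := hd.smul (hρc.pow 4).aestronglyMeasurable (hw 4)
  have hDm : MemLp (fun x => fderiv ℝ g (P (x + e)) - fderiv ℝ g (P x)) 2 := by
    have h1 := memLp_stress hg h.memLp
    have h2 := (memLp_comp_add_right h1 e).sub h1
    refine (memLp_congr_ae (Eventually.of_forall fun x => ?_)).1 h2
    simp
  have t1 := ((lpTendsto_const hDm).bilin (ContinuousLinearMap.id ℝ (W →L[ℝ] ℝ)) h4).tendsto_integral
  have t2 := h2.tendsto_integral_norm_sq
  simp only [ContinuousLinearMap.id_apply] at t1
  have hlim := le_of_tendsto_of_tendsto t1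
    (((tendsto_const_nhds (x := lam / 4 * (∫ x, ‖ρ x ^ 2 • (P (x + e) - P x)‖ ^ 2))).add
      (t2.const_mul (lam / 4))).add_const (C₄ * η ^ 2)) hev
  simp only [Pi.pow_apply] at hlim
  -- Strong monotonicity of Dg. In the limit both terms with factor λ/4 contain the same integral,
  -- so half of the left side survives.
  have hmono : lam * (∫ x, ‖ρ x ^ 2 • (P (x + e) - P x)‖ ^ 2) ≤
      ∫ x, (fderiv ℝ g (P (x + e)) - fderiv ℝ g (P x)) (ρ x ^ 4 • (P (x + e) - P x)) := by
    rw [← integral_const_mul]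
    refine integral_mono ((integrable_norm_sq h2.memLp_lim).const_mul _)
      (integrable_bilin (ContinuousLinearMap.id ℝ (W →L[ℝ] ℝ)) hDm h4.memLp_lim) fun x => ?_
    have := mul_le_mul_of_nonneg_left (hg.monotone (P (x + e)) (P x)) (pow_nonneg (hρ0 x) 4)
    simp only [map_smul, smul_eq_mul, norm_smul, Real.norm_of_nonneg (pow_nonneg (hρ0 x) 2)]
    calc lam * (ρ x ^ 2 * ‖P (x + e) - P x‖) ^ 2 = ρ x ^ 4 * (lam * ‖P (x + e) - P x‖ ^ 2) := by ring
      _ ≤ _ := this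
  have hfin : lam * (∫ x, ‖ρ x ^ 2 • (P (x + e) - P x)‖ ^ 2) ≤ 2 * (C₄ * η ^ 2) := by linarith
  rw [div_mul_eq_mul_div, le_div_iff₀ hlam]
  linarith

end DifferenceEstimate

end WSO

namespace WSO

open Filter Topology

/-! ### Weak derivatives from difference quotients -/

section WeakDerivatives

/-- Weak compactness of bounded sets in a Hilbert space. -/
theorem exists_inner_eq_of_tendsto {H : Type*} [NormedAddCommGroup H] [InnerProductSpace ℝ H]
    [CompleteSpace H] {D : ℕ → H} {C : ℝ} (hD : ∀ᶠ m in atTop, ‖D m‖ ≤ C) :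
    ∃ Γ : H, ∀ (g : H) (l : ℝ), Tendsto (fun m => inner ℝ (D m) g) atTop (𝓝 l) →
      inner ℝ Γ g = l := by
  set T : ℕ → WeakDual ℝ H := fun m =>
    StrongDual.toWeakDual (InnerProductSpace.toDual ℝ H (D m)) with hT
  have hcomp := WeakDual.isCompact_closedBall (0 : StrongDual ℝ H) C
  -- A limit along a free ultrafilter replaces the extraction of a weakly convergent subsequence. It
  -- agrees with the limit of the whole sequence whenever the latter exists, and this is all that is
  -- claimed.
  set 𝒰 : Ultrafilter ℕ := hyperfilter ℕ
  have hU : (𝒰 : Filter ℕ) ≤ atTop := Nat.hyperfilter_le_atTop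
  have hmem : ((𝒰.map T : Ultrafilter (WeakDual ℝ H)) : Filter (WeakDual ℝ H)) ≤
      𝓟 (WeakDual.toStrongDual ⁻¹' Metric.closedBall (0 : StrongDual ℝ H) C) := by
    rw [le_principal_iff]
    refine (hD.filter_mono hU).mono fun m hm => ?_
    simpa [hT] using hm
  obtain ⟨ℓ, -, hℓ⟩ := hcomp.ultrafilter_le_nhds _ hmem
  refine ⟨(InnerProductSpace.toDual ℝ H).symm (WeakDual.toStrongDual ℓ), fun g l hl => ?_⟩
  rw [InnerProductSpace.toDual_symm_apply]
  have h1 : Tendsto (fun m => T m g) 𝒰 (𝓝 (ℓ g)) :=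
    ((WeakDual.eval_continuous g).tendsto ℓ).comp hℓ
  exact tendsto_nhds_unique h1 (hl.mono_left hU)

variable {W : Type*} [NormedAddCommGroup W] [InnerProductSpace ℝ W]

/-- The coefficients of the operator `∂ₖ`. -/
noncomputable def pdCoeff (W : Type*) [NormedAddCommGroup W] [NormedSpace ℝ W] (k l : Fin 2) :
    W →L[ℝ] W := if l = k then ContinuousLinearMap.id ℝ W else 0

theorem sum_smul_pdCoeff (k : Fin 2) (c : Fin 2 → ℝ) (w : W) :
    ∑ l, c l • pdCoeff W k l w = c k • w := by
  rw [Finset.sum_eq_single k]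
  · simp [pdCoeff]
  · intro l _ hl
    simp [pdCoeff, hl]
  · simp

theorem sum_pdCoeff (k : Fin 2) (w : Fin 2 → W) : ∑ l, pdCoeff W k l (w l) = w k := by
  rw [Finset.sum_eq_single k]
  · simp [pdCoeff]
  · intro l _ hl
    simp [pdCoeff, hl]
  · simp

theorem weakOp_pdCoeff_iff {U : Set E} {k : Fin 2} {P Γ : E → W} :
    WeakOp U (pdCoeff W k) P Γ ↔
      ∀ φ : E → ℝ, IsTest U φ → ∫ x, φ x • Γ x = -∫ x, pd k φ x • P x := by
  simp only [WeakOp, sum_smul_pdCoeff k (fun l => pd l _ _)]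

theorem tendsto_integral_difference_quotient {Ω : Set E} {φ : E → ℝ} (hφ : IsTest Ω φ) (k : Fin 2)
    {p : E → ℝ} (hp : LocallyIntegrable p) :
    Tendsto (fun m : ℕ => ∫ x, ((m : ℝ) + 1) *
      (φ (x + EuclideanSpace.single k (-(1 / ((m : ℝ) + 1)))) - φ x) * p x) atTop
      (𝓝 (-∫ x, pd k φ x * p x)) := by
  obtain ⟨M, hM0, hM⟩ : ∃ M : ℝ, 0 ≤ M ∧ ∀ x, ‖fderiv ℝ φ x‖ ≤ M := by
    obtain ⟨M, hM⟩ := (hφ.2.1.fderiv ℝ).exists_bound_of_continuous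
      (hφ.1.continuous_fderiv (by simp))
    exact ⟨M, (norm_nonneg _).trans (hM 0), hM⟩
  set K := Metric.cthickening 1 (tsupport φ) with hK
  have hKc : IsCompact K := (show IsCompact (tsupport φ) from hφ.2.1).cthickening
  have hdist : ∀ (m : ℕ) (x : E),
      dist (x + EuclideanSpace.single k (-(1 / ((m : ℝ) + 1)))) x = 1 / ((m : ℝ) + 1) := fun m x => by
    rw [dist_add_single_le, abs_neg, abs_of_pos (by positivity)]
  have hm1 : ∀ m : ℕ, 1 / ((m : ℝ) + 1) ≤ 1 := fun m => by
    rw [div_le_one (by positivity)]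
    linarith [(Nat.cast_nonneg m : (0 : ℝ) ≤ m)]
  rw [← integral_neg]
  refine tendsto_integral_of_dominated_convergence
    (K.indicator fun x => M * |p x|) (fun m => ?_) ?_ (fun m => Eventually.of_forall fun x => ?_) ?_
  · have hc : Continuous fun x => ((m : ℝ) + 1) *
        (φ (x + EuclideanSpace.single k (-(1 / ((m : ℝ) + 1)))) - φ x) := by
      have := hφ.continuous
      fun_prop
    exact hc.aestronglyMeasurable.mul hp.aestronglyMeasurable
  · rw [integrable_indicator_iff hKc.measurableSet]
    exact (hp.integrableOn_isCompact hKc).abs.const_mul M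
  · by_cases hx : x ∈ K
    · rw [Set.indicator_of_mem hx, norm_mul, norm_mul, Real.norm_eq_abs (p x)]
      refine mul_le_mul_of_nonneg_right ?_ (abs_nonneg _)
      have h1 := convex_univ.norm_image_sub_le_of_norm_fderiv_le (𝕜 := ℝ)
        (fun y _ => differentiable_of_smooth hφ.1 y) (fun y _ => hM y) (Set.mem_univ x)
        (Set.mem_univ (x + EuclideanSpace.single k (-(1 / ((m : ℝ) + 1)))))
      rw [← dist_eq_norm (x + _) x, hdist] at h1
      rw [Real.norm_of_nonneg (by positivity)]
      calc ((m : ℝ) + 1) * _ ≤ ((m : ℝ) + 1) * (M * (1 / ((m : ℝ) + 1))) := by gcongr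
        _ = M := by field_simp
    · have e1 : φ x = 0 := image_eq_zero_of_notMem_tsupport fun h =>
        hx (Metric.self_subset_cthickening _ h)
      have e2 : φ (x + EuclideanSpace.single k (-(1 / ((m : ℝ) + 1)))) = 0 :=
        image_eq_zero_of_notMem_tsupport fun h => hx (by
          refine Metric.mem_cthickening_of_dist_le _ _ _ _ h ?_
          rw [dist_comm, hdist]
          exact hm1 m)
      rw [e1, e2]
      simp [Set.indicator_of_notMem hx]
  · refine Eventually.of_forall fun x => ?_
    have hd : HasDerivAt (fun t : ℝ => φ (x + t • EuclideanSpace.single k (1 : ℝ))) (pd k φ x) 0 := by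
      have h1 : HasDerivAt (fun t : ℝ => x + t • EuclideanSpace.single k (1 : ℝ))
          (EuclideanSpace.single k (1 : ℝ)) 0 := by
        simpa using ((hasDerivAt_id (0 : ℝ)).smul_const (EuclideanSpace.single k (1 : ℝ))).const_add x
      have h2 : HasFDerivAt φ (fderiv ℝ φ x) (x + (0 : ℝ) • EuclideanSpace.single k (1 : ℝ)) := by
        rw [zero_smul, add_zero]
        exact (differentiable_of_smooth hφ.1 x).hasFDerivAt
      exact h2.comp_hasDerivAt 0 h1
    have hs := hd.tendsto_slope_zero
    have hseq : Tendsto (fun m : ℕ => -(1 / ((m : ℝ) + 1))) atTop (𝓝[≠] 0) := by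
      refine tendsto_nhdsWithin_iff.2 ⟨?_, Eventually.of_forall fun m => ?_⟩
      · have := (tendsto_one_div_add_atTop_nhds_zero_nat (𝕜 := ℝ)).neg
        rwa [neg_zero] at this
      · simp only [Set.mem_compl_iff, Set.mem_singleton_iff, neg_eq_zero]
        positivity
    have ht := (hs.comp hseq).neg.mul_const (p x)
    rw [neg_mul] at ht
    refine ht.congr fun m => ?_
    simp only [Function.comp_apply, zero_add, zero_smul, add_zero, smul_eq_mul]
    have e1 : (-(1 / ((m : ℝ) + 1))) • (EuclideanSpace.single k (1 : ℝ) : E) =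
        EuclideanSpace.single k (-(1 / ((m : ℝ) + 1))) := by
      ext i
      simp only [PiLp.smul_apply, PiLp.single_apply, smul_eq_mul]
      split_ifs <;> simp
    rw [e1]
    have : ((-(1 / ((m : ℝ) + 1)))⁻¹ : ℝ) = -((m : ℝ) + 1) := by
      rw [inv_neg, one_div, inv_inv]
    rw [this]
    ring

variable [FiniteDimensional ℝ W]

/-- The difference quotients, cut off by ρ², are bounded in L². A discrete integration by parts puts
the quotient on the test function and identifies a weak limit as the derivative of P on the set
where the cut-off equals 1. -/
theorem exists_weakOp_of_difference_bound {P : E → W} (hP : MemLp P 2) {ρ : E → ℝ}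
    (hρ : Continuous ρ) (hρ0 : ∀ x, 0 ≤ ρ x) (hρ1 : ∀ x, ρ x ≤ 1) {k : Fin 2} {C η₀ : ℝ}
    (hη₀ : 0 < η₀)
    (hC : ∀ η : ℝ, 0 < η → η < η₀ →
      ∫ x, ‖ρ x ^ 2 • (P (x + EuclideanSpace.single k η) - P x)‖ ^ 2 ≤ C * η ^ 2)
    {U : Set E} (hU : ∀ x ∈ U, ρ x = 1) :
    ∃ Γ : E → W, MemLp Γ 2 ∧ WeakOp U (pdCoeff W k) P Γ := by
  set D : ℕ → E → W := fun m x => ((m : ℝ) + 1) •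
    (ρ x ^ 2 • (P (x + EuclideanSpace.single k (1 / ((m : ℝ) + 1))) - P x)) with hD
  have hw : ∀ x, ‖ρ x ^ 2‖ ≤ 1 := fun x => by
    rw [Real.norm_of_nonneg (pow_nonneg (hρ0 x) 2)]
    exact pow_le_one₀ (hρ0 x) (hρ1 x)
  have hDm : ∀ m, MemLp (D m) 2 := fun m => by
    refine MemLp.const_smul ?_ _
    have h1 : MemLp (fun x => P (x + EuclideanSpace.single k (1 / ((m : ℝ) + 1))) - P x) 2 :=
      (memLp_comp_add_right hP _).sub hP
    refine MemLp.of_le_mul (c := 1) h1 ((hρ.pow 2).aestronglyMeasurable.smul h1.1)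
      (Eventually.of_forall fun x => ?_)
    rw [norm_smul]
    exact mul_le_mul_of_nonneg_right (hw x) (norm_nonneg _)
  have hsmall : ∀ᶠ m : ℕ in atTop, 1 / ((m : ℝ) + 1) < η₀ :=
    tendsto_one_div_add_atTop_nhds_zero_nat.eventually (gt_mem_nhds hη₀)
  have hbd : ∀ᶠ m in atTop, ‖(hDm m).toLp (D m)‖ ≤ Real.sqrt C := by
    filter_upwards [hsmall] with m hm
    refine Real.le_sqrt_of_sq_le ?_
    have h1 : ‖(hDm m).toLp (D m)‖ ^ 2 = ∫ x, ‖D m x‖ ^ 2 := by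
      rw [← real_inner_self_eq_norm_sq, L2.inner_def]
      refine integral_congr_ae ((hDm m).coeFn_toLp.mono fun x hx => ?_)
      simp only [hx]
      exact real_inner_self_eq_norm_sq _
    have h2 : ∀ x, ‖D m x‖ ^ 2 = ((m : ℝ) + 1) ^ 2 *
        ‖ρ x ^ 2 • (P (x + EuclideanSpace.single k (1 / ((m : ℝ) + 1))) - P x)‖ ^ 2 := fun x => by
      simp only [hD]
      rw [norm_smul ((m : ℝ) + 1), mul_pow, Real.norm_eq_abs, sq_abs]
    rw [h1]
    simp only [h2]
    rw [integral_const_mul]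
    have h3 := hC _ (by positivity) hm
    calc ((m : ℝ) + 1) ^ 2 * _ ≤ ((m : ℝ) + 1) ^ 2 * (C * (1 / ((m : ℝ) + 1)) ^ 2) := by gcongr
      _ = C := by field_simp
  obtain ⟨Γ, hΓ⟩ := exists_inner_eq_of_tendsto hbd
  refine ⟨Γ, Lp.memLp Γ, weakOp_pdCoeff_iff.2 fun φ hφ => ?_⟩
  have hPl : LocallyIntegrable P := hP.locallyIntegrable (by norm_num)
  have hi1 : Integrable fun x => φ x • Γ x := by
    have := integrable_bilin (ContinuousLinearMap.lsmul ℝ ℝ (E := W)) (hφ.memLp 2) (Lp.memLp Γ)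
    simpa using this
  have hi2 : Integrable fun x => pd k φ x • P x := by
    have := integrable_bilin (ContinuousLinearMap.lsmul ℝ ℝ (E := W)) ((hφ.pd k).memLp 2) hP
    simpa using this
  refine ext_inner_right ℝ fun w => ?_
  set p : E → ℝ := fun x => inner ℝ (P x) w with hp
  have hpm : MemLp p 2 := by
    refine hP.of_le_mul (c := ‖w‖) (hP.1.inner aestronglyMeasurable_const)
      (Eventually.of_forall fun x => ?_)
    rw [mul_comm]
    exact norm_inner_le_norm _ _
  have hpl : LocallyIntegrable p := hpm.locallyIntegrable (by norm_num)
  have htw : MemLp (fun x => φ x • w) 2 := by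
    simpa using (hφ.clm (ContinuousLinearMap.smulRight (1 : ℝ →L[ℝ] ℝ) w)).memLp 2
  have key := hΓ (htw.toLp _) (-∫ x, pd k φ x * p x) (by
    refine (tendsto_integral_difference_quotient hφ k hpl).congr fun m => ?_
    rw [L2.inner_def]
    set e : E := EuclideanSpace.single k (1 / ((m : ℝ) + 1)) with he
    have hen : (EuclideanSpace.single k (-(1 / ((m : ℝ) + 1))) : E) = -e := by
      rw [he]
      ext i
      simp only [PiLp.neg_apply, PiLp.single_apply]
      split_ifs <;> simp
    have e1 : ∫ x, inner ℝ ((hDm m).toLp (D m) x) (htw.toLp (fun x => φ x • w) x) =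
        ∫ x, ((m : ℝ) + 1) * (φ x * p (x + e) - φ x * p x) := by
      refine integral_congr_ae ?_
      filter_upwards [(hDm m).coeFn_toLp, htw.coeFn_toLp] with x hx1 hx2
      rw [hx1, hx2]
      simp only [hD, real_inner_smul_left, real_inner_smul_right, inner_sub_left, hp]
      by_cases hx : x ∈ U
      · rw [hU x hx]
        ring
      · rw [hφ.eq_zero_of_notMem hx]
        ring
    have i1 : Integrable fun x => φ (x + -e) * p x := by
      have hφe : MemLp (fun x => φ (x + -e)) 2 := memLp_comp_add_right (hφ.memLp 2) _
      exact integrable_bilin (ContinuousLinearMap.mul ℝ ℝ) hφe hpm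
    have i2 : Integrable fun x => φ x * p x :=
      integrable_bilin (ContinuousLinearMap.mul ℝ ℝ) (hφ.memLp 2) hpm
    have i3 : Integrable fun x => φ x * p (x + e) :=
      integrable_bilin (ContinuousLinearMap.mul ℝ ℝ) (hφ.memLp 2) (memLp_comp_add_right hpm e)
    have e2 : ∫ x, φ (x + -e) * p x = ∫ x, φ x * p (x + e) := by
      rw [← integral_add_right_eq_self (fun x => φ (x + -e) * p x) e]
      simp
    rw [e1, integral_const_mul, integral_sub i3 i2, ← e2, ← integral_sub i1 i2,
      ← integral_const_mul, hen]
    refine integral_congr_ae (Eventually.of_forall fun x => ?_)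
    simp only
    ring)
  rw [L2.inner_def] at key
  have e3 : ∫ x, inner ℝ (Γ x) (htw.toLp (fun x => φ x • w) x) = inner ℝ (∫ x, φ x • Γ x) w := by
    rw [real_inner_comm, ← integral_inner hi1]
    refine integral_congr_ae (htw.coeFn_toLp.mono fun x hx => ?_)
    simp only [hx, real_inner_smul_right]
    rw [real_inner_comm]
  have e4 : ∫ x, pd k φ x * p x = inner ℝ (∫ x, pd k φ x • P x) w := by
    rw [real_inner_comm, ← integral_inner hi2]
    refine integral_congr_ae (Eventually.of_forall fun x => ?_)
    simp only [hp, real_inner_smul_right]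
    rw [real_inner_comm]
  rw [e3, e4] at key
  rw [key, inner_neg_left]

end WeakDerivatives

end WSO

namespace WSO

open Filter Topology

/-! ### Local weak derivatives and the chain rule -/

section Gluing

theorem exists_exhaustion {Ω : Set E} (hΩ : IsOpen Ω) (hb : Bornology.IsBounded Ω) :
    ∃ V : ℕ → Set E, (∀ n, IsOpen (V n)) ∧ Monotone V ∧
      (∀ n, ∃ K, IsCompact K ∧ K ⊆ Ω ∧ V n ⊆ K) ∧ ∀ K, IsCompact K → K ⊆ Ω → ∃ n, K ⊆ V n := by
  have hmono : Monotone fun n : ℕ => {x : E | (n : ℝ≥0∞)⁻¹ < Metric.infEDist x Ωᶜ} :=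
    fun m n hmn x hx => lt_of_le_of_lt (ENNReal.inv_le_inv.2 (by exact_mod_cast hmn)) hx
  have hopen : ∀ n : ℕ, IsOpen {x : E | (n : ℝ≥0∞)⁻¹ < Metric.infEDist x Ωᶜ} := fun n =>
    isOpen_lt continuous_const Metric.continuous_infEDist
  refine ⟨fun n => {x | (n : ℝ≥0∞)⁻¹ < Metric.infEDist x Ωᶜ}, hopen, hmono, fun n => ?_,
    fun K hK hKΩ => ?_⟩
  · have hsub : {x : E | (n : ℝ≥0∞)⁻¹ ≤ Metric.infEDist x Ωᶜ} ⊆ Ω := fun x hx => by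
      by_contra hx'
      have h0 : Metric.infEDist x Ωᶜ = 0 := Metric.infEDist_zero_of_mem hx'
      simp [h0] at hx
    refine ⟨{x | (n : ℝ≥0∞)⁻¹ ≤ Metric.infEDist x Ωᶜ}, ?_, hsub,
      fun x (hx : (n : ℝ≥0∞)⁻¹ < _) => hx.le⟩
    exact Metric.isCompact_of_isClosed_isBounded
      (isClosed_le continuous_const Metric.continuous_infEDist) (hb.subset hsub)
  · refine hK.elim_directed_cover _ hopen (fun x hx => ?_) hmono.directed_le
    have hpos : Metric.infEDist x Ωᶜ ≠ 0 := fun h0 => by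
      have := Metric.mem_closure_iff_infEDist_zero.2 h0
      rw [hΩ.isClosed_compl.closure_eq] at this
      exact this (hKΩ hx)
    obtain ⟨n, hn⟩ := ENNReal.exists_inv_nat_lt hpos
    exact Set.mem_iUnion.2 ⟨n, hn⟩

theorem exists_cutoff {Ω K : Set E} (hΩ : IsOpen Ω) (hK : IsCompact K) (hKΩ : K ⊆ Ω) :
    ∃ ρ : E → ℝ, IsTest Ω ρ ∧ (∀ x, 0 ≤ ρ x) ∧ (∀ x, ρ x ≤ 1) ∧ ∀ x ∈ K, ρ x = 1 := by
  obtain ⟨K', hK', hKK', hK'Ω⟩ := exists_compact_between hK hΩ hKΩ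
  obtain ⟨ρ, h0, h1, h01⟩ := exists_contMDiffMap_zero_one_of_isClosed
    (modelWithCornersSelf ℝ E) (n := (⊤ : ℕ∞)) (isOpen_interior (s := K')).isClosed_compl hK.isClosed
    (Set.disjoint_left.2 fun x hx hxK => hx (hKK' hxK))
  exact ⟨ρ, IsTest.of_compact ρ.contMDiff.contDiff hK' hK'Ω fun x hx =>
    h0 fun hx' => hx (interior_subset hx'), fun x => (h01 x).1, fun x => (h01 x).2, fun x hx => h1 hx⟩

variable {F F' : Type*} [NormedAddCommGroup F] [NormedSpace ℝ F]
  [NormedAddCommGroup F'] [NormedSpace ℝ F']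

theorem WeakOp.congr_ae {U : Set E} {L : Fin 2 → F →L[ℝ] F'} {u u' : E → F} {g g' : E → F'}
    (h : WeakOp U L u g) (hu : ∀ᵐ x, x ∈ U → u x = u' x) (hg : ∀ᵐ x, x ∈ U → g x = g' x) :
    WeakOp U L u' g' := by
  intro φ hφ
  have e1 : ∫ x, φ x • g' x = ∫ x, φ x • g x := integral_congr_ae <| hg.mono fun x hx => by
    by_cases hxU : x ∈ U
    · simp only [hx hxU]
    · simp only [hφ.eq_zero_of_notMem hxU, zero_smul]
  have e2 : ∫ x, ∑ k, pd k φ x • L k (u' x) = ∫ x, ∑ k, pd k φ x • L k (u x) :=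
    integral_congr_ae <| hu.mono fun x hx => by
      by_cases hxU : x ∈ U
      · simp only [hx hxU]
      · simp only [(hφ.pd _).eq_zero_of_notMem hxU, zero_smul]
  rw [e1, e2, h φ hφ]

theorem IsTest.integrable_smul_of_locallyIntegrableOn {Ω : Set E} {φ : E → ℝ} (hφ : IsTest Ω φ)
    {g : E → F} (hg : LocallyIntegrableOn g Ω) : Integrable fun x => φ x • g x := by
  have h1 : IntegrableOn g (tsupport φ) := hg.integrableOn_compact_subset hφ.2.2 hφ.2.1
  have h2 : IntegrableOn (fun x => φ x • g x) (tsupport φ) := by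
    obtain ⟨C, hC0, hC⟩ := hφ.bounded
    exact Integrable.bdd_smul h1 C hφ.continuous.aestronglyMeasurable (Eventually.of_forall hC)
  refine (integrableOn_iff_integrable_of_support_subset fun x hx => ?_).1 h2
  by_contra hx'
  exact hx (by simp [image_eq_zero_of_notMem_tsupport hx'])

theorem WeakOp.ae_eq [CompleteSpace F'] {U : Set E} (hU : IsOpen U) {L : Fin 2 → F →L[ℝ] F'}
    {u : E → F} {g g' : E → F'} (h : WeakOp U L u g) (h' : WeakOp U L u g')
    (hg : LocallyIntegrableOn g U) (hg' : LocallyIntegrableOn g' U) :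
    ∀ᵐ x, x ∈ U → g x = g' x := by
  have := hU.ae_eq_zero_of_integral_contDiff_smul_eq_zero (μ := volume) (f := fun x => g x - g' x)
    (hg.sub hg') fun φ h1 h2 h3 => by
      have hφ : IsTest U φ := ⟨h1, h2, h3⟩
      simp only [smul_sub]
      rw [integral_sub (hφ.integrable_smul_of_locallyIntegrableOn hg)
        (hφ.integrable_smul_of_locallyIntegrableOn hg'), h φ hφ, h' φ hφ, sub_self]
  exact this.mono fun x hx hxU => sub_eq_zero.1 (hx hxU)

/-- By the fundamental lemma of the calculus of variations the local derivatives agree almost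
everywhere on overlaps, so they can be glued along a countable exhaustion. -/
theorem exists_weakOp_of_local [CompleteSpace F'] {Ω : Set E} (hΩ : IsOpen Ω)
    (hb : Bornology.IsBounded Ω)
    {L : Fin 2 → F →L[ℝ] F'} {u : E → F}
    (h : ∀ K, IsCompact K → K ⊆ Ω → ∃ Γ : E → F', MemLp Γ 2 ∧ WeakOp K L u Γ) :
    ∃ G : E → F', WeakOp Ω L u G ∧
      ∀ K, IsCompact K → K ⊆ Ω → MemLp (K.indicator G) 2 := by
  obtain ⟨V, hVo, hVm, hVK, hV⟩ := exists_exhaustion hΩ hb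
  have hΓ : ∀ n, ∃ Γ : E → F', MemLp Γ 2 ∧ WeakOp (V n) L u Γ := fun n => by
    obtain ⟨K, hK, hKΩ, hVK⟩ := hVK n
    obtain ⟨Γ, h1, h2⟩ := h K hK hKΩ
    exact ⟨Γ, h1, h2.mono hVK⟩
  choose Γ hΓm hΓw using hΓ
  have hli : ∀ n U, LocallyIntegrableOn (Γ n) U := fun n U =>
    ((hΓm n).locallyIntegrable (by norm_num)).locallyIntegrableOn U
  have hae : ∀ᵐ x, ∀ m n, x ∈ V m → x ∈ V n → Γ m x = Γ n x := by
    rw [ae_all_iff]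
    intro m
    rw [ae_all_iff]
    intro n
    have := WeakOp.ae_eq ((hVo m).inter (hVo n)) ((hΓw m).mono Set.inter_subset_left)
      ((hΓw n).mono Set.inter_subset_right) (hli m _) (hli n _)
    exact this.mono fun x hx h1 h2 => hx ⟨h1, h2⟩
  -- The first set of the exhaustion that contains x decides. Outside Ω no set does; the infimum is
  -- then 0 by convention, and the value plays no role.
  set G : E → F' := fun x => Γ (sInf {n | x ∈ V n}) x with hG
  have hGΓ : ∀ n, ∀ᵐ x, x ∈ V n → Γ n x = G x := fun n => hae.mono fun x hx hxn =>
    hx n _ hxn (Nat.sInf_mem (s := {n | x ∈ V n}) ⟨n, hxn⟩)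
  refine ⟨G, fun φ hφ => ?_, fun K hK hKΩ => ?_⟩
  · obtain ⟨n, hn⟩ := hV _ hφ.2.1 hφ.2.2
    exact (hΓw n).congr_ae (Eventually.of_forall fun x _ => rfl) (hGΓ n) φ ⟨hφ.1, hφ.2.1, hn⟩
  · obtain ⟨n, hn⟩ := hV K hK hKΩ
    refine (memLp_congr_ae ?_).1 ((hΓm n).indicator hK.measurableSet)
    filter_upwards [hGΓ n] with x hx
    by_cases hxK : x ∈ K
    · simp only [Set.indicator_of_mem hxK, hx (hn hxK)]
    · simp only [Set.indicator_of_notMem hxK]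

end Gluing

/-! ### The weak chain rule for the stress. -/

section ChainRule

variable {W : Type*} [NormedAddCommGroup W] [InnerProductSpace ℝ W]
  {Ω : Set E} {g : W → ℝ} {lam L : ℝ} {P : E → W}

theorem lpTendsto_fderiv (hg : HasHessBounds lam L g) {X : ℕ → E → W} (h : LpTendsto 2 X P) :
    LpTendsto 2 (fun n x => fderiv ℝ g (X n x) - fderiv ℝ g 0)
      (fun x => fderiv ℝ g (P x) - fderiv ℝ g 0) := by
  refine ⟨fun n => memLp_stress hg (h.memLp n), memLp_stress hg h.memLp_lim, ?_⟩
  have hb : ∀ n, eLpNorm (fun x => (fderiv ℝ g (X n x) - fderiv ℝ g 0) -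
      (fderiv ℝ g (P x) - fderiv ℝ g 0)) 2 ≤
      ENNReal.ofReal L * eLpNorm (fun x => X n x - P x) 2 := fun n =>
    eLpNorm_le_mul_eLpNorm_of_ae_le_mul (Eventually.of_forall fun x => by
      rw [sub_sub_sub_cancel_right]
      exact hg.norm_fderiv_sub_le _ _) 2
  have ht := ENNReal.Tendsto.const_mul h.tendsto (Or.inr (ENNReal.ofReal_ne_top (r := L)))
  rw [mul_zero] at ht
  exact tendsto_of_tendsto_of_tendsto_of_le_of_le tendsto_const_nhds ht (fun _ => zero_le) hb

theorem integral_stress_pd_of_smooth (hg : ContDiff ℝ 2 g) {X Q : E → W}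
    (hX : IsTest Ω X) (hQ : ContDiff ℝ ∞ Q) (k : Fin 2) :
    ∫ x, (fderiv ℝ g (Q x) - fderiv ℝ g 0) (pd k X x) =
      -∫ x, fderiv ℝ (fderiv ℝ g) (Q x) (pd k Q x) (X x) := by
  have hD := contDiff_fderiv hg
  have hψ : ContDiff ℝ 1 fun x => fderiv ℝ g (Q x) - fderiv ℝ g 0 :=
    (hD.comp (hQ.of_le (by simp))).sub contDiff_const
  have h := integral_bilin_pd (ContinuousLinearMap.apply ℝ ℝ (E := W)) hX.of_le_one hψ hX.2.1 k
  have hpd : ∀ x, pd k (fun x => fderiv ℝ g (Q x) - fderiv ℝ g 0) x =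
      fderiv ℝ (fderiv ℝ g) (Q x) (pd k Q x) := fun x => by
    have h1 : HasFDerivAt (fun x => fderiv ℝ g (Q x) - fderiv ℝ g 0)
        ((fderiv ℝ (fderiv ℝ g) (Q x)).comp (fderiv ℝ Q x)) x :=
      ((hD.differentiable one_ne_zero (Q x)).hasFDerivAt.comp x
        (differentiable_of_smooth hQ x).hasFDerivAt).sub_const _
    rw [pd, h1.fderiv]
    rfl
  simp only [hpd, ContinuousLinearMap.apply_apply] at h
  rw [h, neg_neg]

variable [FiniteDimensional ℝ W]

/-- The chain rule for `Dg(P)`, in weak form. -/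
theorem integral_stress_pd (hg : HasHessBounds lam L g) (hΩ : IsOpen Ω) (hP : MemLp P 2) {k : Fin 2}
    {G : E → W} (hG : WeakOp Ω (pdCoeff W k) P G)
    (hGm : ∀ K, IsCompact K → K ⊆ Ω → MemLp (K.indicator G) 2) {X : E → W} (hX : IsTest Ω X) :
    ∫ x, (fderiv ℝ g (P x) - fderiv ℝ g 0) (pd k X x) =
      -∫ x, fderiv ℝ (fderiv ℝ g) (P x) (G x) (X x) := by
  have hXc : IsCompact (tsupport X) := hX.2.1
  obtain ⟨δ, hδ, hδΩ⟩ := hXc.exists_cthickening_subset_open hΩ hX.2.2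
  set K := Metric.cthickening δ (tsupport X) with hK
  have hKc : IsCompact K := hXc.cthickening
  set Γ := K.indicator G with hΓdef
  have hΓ : MemLp Γ 2 := hGm K hKc hδΩ
  have hw : WeakOp K (pdCoeff W k) P Γ := (hG.mono hδΩ).congr (fun _ _ => rfl) fun x hx => by
    rw [hΓdef, Set.indicator_of_mem hx]
  have hPl : LocallyIntegrable P := hP.locallyIntegrable (by norm_num)
  have hmP := lpTendsto_moll (by norm_num) (by norm_num) hP
  have hmΓ := lpTendsto_moll (by norm_num) (by norm_num) hΓ
  have hH : Continuous (fderiv ℝ (fderiv ℝ g)) :=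
    (contDiff_fderiv hg.contDiff).continuous_fderiv one_ne_zero
  have hHb : ∀ Q w y, ‖fderiv ℝ (fderiv ℝ g) Q w y‖ ≤ L * (‖w‖ * ‖y‖) := fun Q w y => by
    rw [← mul_assoc]
    exact (fderiv ℝ (fderiv ℝ g) Q).le_of_opNorm₂_le_of_le (hg.norm_hess_le Q) le_rfl le_rfl
  have hΓX : Integrable fun x => L * (‖Γ x‖ * ‖X x‖) :=
    (integrable_bilin (ContinuousLinearMap.mul ℝ ℝ) hΓ.norm (hX.memLp 2).norm).const_mul L
  have hmeas : ∀ {Q Y : E → W}, AEStronglyMeasurable Q → AEStronglyMeasurable Y →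
      AEStronglyMeasurable (fun x => fderiv ℝ (fderiv ℝ g) (Q x) (Y x) (X x)) := fun {Q Y} hQ hY => by
    have h0 : AEStronglyMeasurable fun x => fderiv ℝ (fderiv ℝ g) (Q x) :=
      hH.comp_aestronglyMeasurable hQ
    have h1 : AEStronglyMeasurable fun x => fderiv ℝ (fderiv ℝ g) (Q x) (Y x) :=
      (isBoundedBilinearMap_apply (𝕜 := ℝ) (E := W)
        (F := W →L[ℝ] ℝ)).continuous.comp_aestronglyMeasurable (h0.prodMk hY)
    exact (ContinuousLinearMap.id ℝ (W →L[ℝ] ℝ)).aestronglyMeasurable_comp₂ h1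
      hX.continuous.aestronglyMeasurable
  have t1 := ((lpTendsto_fderiv hg hmP).bilin (ContinuousLinearMap.id ℝ (W →L[ℝ] ℝ))
    (lpTendsto_const ((hX.pd k).memLp 2))).tendsto_integral
  simp only [ContinuousLinearMap.id_apply] at t1
  -- D²g is only continuous and bounded, so its values at the mollifications converge merely
  -- pointwise almost everywhere. Freezing Γ gives an integrable majorant for dominated convergence;
  -- the difference between Γ and its mollification is small in L² and is treated separately.
  have t2 : Tendsto (fun n => ∫ x, fderiv ℝ (fderiv ℝ g) (moll n P x) (Γ x) (X x)) atTop
      (𝓝 (∫ x, fderiv ℝ (fderiv ℝ g) (P x) (Γ x) (X x))) := by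
    refine tendsto_integral_of_dominated_convergence _ (fun n => hmeas (hmP.memLp n).1 hΓ.1) hΓX
      (fun n => Eventually.of_forall fun x => hHb _ _ _) ?_
    filter_upwards [ae_tendsto_moll hPl] with x hx
    have hc : Continuous fun Q => fderiv ℝ (fderiv ℝ g) Q (Γ x) (X x) :=
      (hH.clm_apply continuous_const).clm_apply continuous_const
    exact (hc.tendsto (P x)).comp hx
  have t3 : Tendsto (fun n => ∫ x, fderiv ℝ (fderiv ℝ g) (moll n P x) (moll n Γ x - Γ x) (X x))
      atTop (𝓝 0) := by
    have h1 := ((lpTendsto_const (hX.memLp 2).norm).bilin (ContinuousLinearMap.lsmul ℝ ℝ (E := W))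
      (hmΓ.sub (by norm_num) (lpTendsto_const hΓ))).tendsto_setIntegral_norm Set.univ
    simp only [Measure.restrict_univ, ContinuousLinearMap.lsmul_apply, sub_self, smul_zero, norm_zero,
      integral_zero, norm_smul, norm_norm] at h1
    have h2 := h1.const_mul L
    rw [mul_zero] at h2
    refine squeeze_zero_norm (fun n => ?_) h2
    rw [← integral_const_mul]
    refine norm_integral_le_of_norm_le ?_ (Eventually.of_forall fun x => ?_)
    · exact (integrable_bilin (ContinuousLinearMap.mul ℝ ℝ) (hX.memLp 2).norm
        ((hmΓ.memLp n).sub hΓ).norm).const_mul L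
    · rw [mul_comm ‖X x‖]
      exact hHb _ _ _
  have t4 : Tendsto (fun n => ∫ x, (fderiv ℝ g (moll n P x) - fderiv ℝ g 0) (pd k X x)) atTop
      (𝓝 (-∫ x, fderiv ℝ (fderiv ℝ g) (P x) (Γ x) (X x))) := by
    have h1 := (t3.add t2).neg
    rw [zero_add] at h1
    refine h1.congr' ?_
    filter_upwards [tendsto_bumpSeq_rOut.eventually (gt_mem_nhds hδ)] with n hn
    rw [integral_stress_pd_of_smooth hg.contDiff hX (contDiff_moll n hPl) k, ← integral_add]
    · congr 1
      refine integral_congr_ae (Eventually.of_forall fun x => ?_)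
      simp only
      rw [← _root_.add_apply, ← map_add, sub_add_cancel]
      by_cases hx : x ∈ tsupport X
      · have h2 := hw.moll_eq hPl (n := n) (x := x) fun y hy =>
          Metric.mem_cthickening_of_dist_le _ x _ _ hx ((Metric.mem_closedBall.1 hy).trans hn.le)
        rw [sum_pdCoeff] at h2
        rw [h2]
      · simp [image_eq_zero_of_notMem_tsupport hx]
    · refine Integrable.mono' ?_ (hmeas (hmP.memLp n).1 ((hmΓ.memLp n).sub hΓ).1)
        (Eventually.of_forall fun x => hHb _ _ _)
      exact (integrable_bilin (ContinuousLinearMap.mul ℝ ℝ)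
        ((hmΓ.memLp n).sub hΓ).norm (hX.memLp 2).norm).const_mul L
    · exact Integrable.mono' hΓX (hmeas (hmP.memLp n).1 hΓ.1) (Eventually.of_forall fun x => hHb _ _ _)
  rw [tendsto_nhds_unique t1 t4]
  congr 1
  refine integral_congr_ae (Eventually.of_forall fun x => ?_)
  by_cases hx : x ∈ tsupport X
  · have hxK : x ∈ K := Metric.self_subset_cthickening _ hx
    simp only [hΓdef, Set.indicator_of_mem hxK]
  · simp [image_eq_zero_of_notMem_tsupport hx]

end ChainRule

/-! ### Existence of the weak derivatives of `P`. -/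

section Regularity

variable {W : Type*} [NormedAddCommGroup W] [InnerProductSpace ℝ W] [FiniteDimensional ℝ W]
  {Ω : Set E} {a : Fin 2 → E →L[ℝ] W} {b : Fin 2 → W →L[ℝ] E} {g : W → ℝ} {θ lam L : ℝ}
  {v : E → E} {P : E → W}

theorem IsAlmostSolution.exists_weakOp (h : IsAlmostSolution Ω a g θ v P) (hΩ : IsOpen Ω)
    (hb : Bornology.IsBounded Ω) (hab : FactorsLaplacian a b) (hg : HasHessBounds lam L g)
    (hlam : 0 < lam) (hθ : 0 ≤ θ) (k : Fin 2) :
    ∃ G : E → W, WeakOp Ω (pdCoeff W k) P G ∧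
      ∀ K, IsCompact K → K ⊆ Ω → MemLp (K.indicator G) 2 := by
  refine exists_weakOp_of_local hΩ hb fun K hK hKΩ => ?_
  obtain ⟨ρ, hρ, hρ0, hρ1, hρK⟩ := exists_cutoff hΩ hK hKΩ
  obtain ⟨C, η₀, hη₀, hC⟩ := h.exists_difference_bound hΩ hab hg hlam hθ hρ hρ0 hρ1
  exact exists_weakOp_of_difference_bound h.memLp hρ.continuous hρ0 hρ1 hη₀ (hC k) hρK

end Regularity

end WSO

namespace WSO

open Filter Topology

/-! ### The second order estimate -/

section SecondOrder

variable {W : Type*} [NormedAddCommGroup W] [InnerProductSpace ℝ W]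
  {Ω : Set E} {a : Fin 2 → E →L[ℝ] W} {b : Fin 2 → W →L[ℝ] E} {g : W → ℝ} {θ lam L : ℝ}
  {v : E → E} {P : E → W} {G : Fin 2 → E → W}

theorem LpTendsto.add {H : Type*} [NormedAddCommGroup H] {p : ℝ≥0∞} (hp : 1 ≤ p)
    {X X' : ℕ → E → H} {Y Y' : E → H} (h : LpTendsto p X Y) (h' : LpTendsto p X' Y') :
    LpTendsto p (fun n x => X n x + X' n x) (fun x => Y x + Y' x) := by
  have h0 : LpTendsto p (fun n x => -X' n x) (fun x => -Y' x) := by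
    refine ⟨fun n => (h'.memLp n).neg, h'.memLp_lim.neg, ?_⟩
    refine h'.tendsto.congr fun n => ?_
    rw [← eLpNorm_neg]
    congr 1
    funext x
    simp [sub_eq_add_neg, add_comm]
  simpa only [sub_neg_eq_add] using h.sub hp h0

theorem LpTendsto.sum {H ι : Type*} [NormedAddCommGroup H] {p : ℝ≥0∞} (hp : 1 ≤ p) (s : Finset ι)
    {X : ι → ℕ → E → H} {Y : ι → E → H} (h : ∀ i, LpTendsto p (X i) (Y i)) :
    LpTendsto p (fun n x => ∑ i ∈ s, X i n x) (fun x => ∑ i ∈ s, Y i x) := by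
  classical
  induction s using Finset.induction_on with
  | empty => simpa using lpTendsto_const (H := H) (Y := fun _ => 0) (p := p) MemLp.zero'
  | insert i s hi ih => simpa only [Finset.sum_insert hi] using (h i).add hp ih

theorem LpTendsto.clm {H H' : Type*} [NormedAddCommGroup H] [NormedSpace ℝ H]
    [NormedAddCommGroup H'] [NormedSpace ℝ H'] {p : ℝ≥0∞} {X : ℕ → E → H} {Y : E → H}
    (hX : LpTendsto p X Y) (T : H →L[ℝ] H') :
    LpTendsto p (fun n x => T (X n x)) (fun x => T (Y x)) :=
  hX.clm_apply (w := fun _ => T) aestronglyMeasurable_const fun _ => le_rfl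

/-- This is where the norm of W^{-2,1} pays off: the field is a sum of first and second derivatives
of expressions that contain no derivative of `u`. -/
theorem isTest_testField {q : E → ℝ} (hq : IsTest Ω q) {u : E → E} (hu : ContDiff ℝ ∞ u) :
    IsTest Ω (testField a b q u) ∧ negSobNorm 2 Ω (testField a b q u) ≤
      ENNReal.ofReal (∑ k, (∫ x, ‖b k (∑ l, pd l q x • a l (u x))‖) +
        ∑ _k : Fin 2, ∫ x, ‖q x • u x‖) := by
  have hU : IsTest Ω fun x => q x • u x := hq.smul_left hu
  have hT : ∀ k, IsTest Ω fun x => b k (∑ l, pd l q x • a l (u x)) := fun k =>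
    (IsTest.sum _ fun l => (hq.pd l).smul_left ((a l).contDiff.comp hu)).clm (b k)
  have hT' : ∀ k, IsTest Ω fun x => -(b k (∑ l, pd l q x • a l (u x))) := fun k => by
    simpa only [neg_smul, one_smul] using (hT k).const_smul (-1)
  have hpd : ∀ k x, pd k (fun y => -(b k (∑ l, pd l q y • a l (u y)))) x =
      -pd k (fun y => b k (∑ l, pd l q y • a l (u y))) x := fun k x => by
    rw [pd, fderiv_fun_neg]
    rfl
  refine ⟨(IsTest.sum _ fun k => (hU.pd k).pd k).sub (IsTest.sum _ fun k => (hT k).pd k), ?_⟩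
  have := negSobNorm_le_of_eq (isTest_zero Ω) hT' (fun _ => hU) (φ := testField a b q u) fun x => by
    simp only [testField, hpd, Finset.sum_neg_distrib, zero_add]
    abel
  simpa only [norm_zero, integral_zero, zero_add, norm_neg] using this

variable [FiniteDimensional ℝ W]

/-- Mollifications of an almost solution and of its derivatives, near a compact set. -/
theorem IsAlmostSolution.gradA_moll (h : IsAlmostSolution Ω a g θ v P) {S : Set E} {δ : ℝ}
    (hδ : 0 < δ) (hδΩ : Metric.cthickening δ S ⊆ Ω)
    (hGw : ∀ k, WeakOp Ω (pdCoeff W k) P (G k)) {n : ℕ} (hn : (bumpSeq n).rOut < δ / 2) {x : E}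
    (hx : x ∈ S) :
    gradA a (moll n v) x = moll n P x ∧ ∀ k, pd k (gradA a (moll n v)) x =
      moll n ((Metric.cthickening δ S).indicator (G k)) x := by
  have hPl : LocallyIntegrable P := h.memLp.locallyIntegrable (by norm_num)
  have hball : ∀ y ∈ Metric.ball x (δ / 2), Metric.closedBall y (bumpSeq n).rOut ⊆
      Metric.cthickening δ S := fun y hy z hz => by
    refine Metric.mem_cthickening_of_dist_le z x _ _ hx ?_
    have h1 := dist_triangle z y x
    rw [Metric.mem_ball] at hy
    rw [Metric.mem_closedBall] at hz
    linarith
  have hloc : ∀ y ∈ Metric.ball x (δ / 2), gradA a (moll n v) y = moll n P y := fun y hy =>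
    h.weakOp.moll_eq h.integrable.locallyIntegrable ((hball y hy).trans hδΩ)
  have hx0 : x ∈ Metric.ball x (δ / 2) := Metric.mem_ball_self (half_pos hδ)
  refine ⟨hloc x hx0, fun k => ?_⟩
  have hev : gradA a (moll n v) =ᶠ[𝓝 x] moll n P :=
    eventually_of_mem (Metric.isOpen_ball.mem_nhds hx0) hloc
  have hw : WeakOp (Metric.cthickening δ S) (pdCoeff W k) P
      ((Metric.cthickening δ S).indicator (G k)) :=
    ((hGw k).mono hδΩ).congr (fun _ _ => rfl) fun y hy => (Set.indicator_of_mem hy _).symm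
  have h2 := hw.moll_eq hPl (n := n) (x := x) (hball x hx0)
  rw [sum_pdCoeff] at h2
  rw [← h2, pd, hev.fderiv_eq, pd]

/-- The Euler-Lagrange system, tested with `∑ₖ ∂ₖ (q bₖ P)`. -/
theorem IsAlmostSolution.abs_second_order_le (h : IsAlmostSolution Ω a g θ v P) (hΩ : IsOpen Ω)
    (hab : FactorsLaplacian a b) (hg : HasHessBounds lam L g)
    (hGw : ∀ k, WeakOp Ω (pdCoeff W k) P (G k))
    (hGm : ∀ k K, IsCompact K → K ⊆ Ω → MemLp (K.indicator (G k)) 2)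
    {q : E → ℝ} (hq : IsTest Ω q) :
    |∑ k, (∫ x, fderiv ℝ (fderiv ℝ g) (P x) (G k x)
        (q x • G k x + ∑ l, pd l q x • coeffZ a b k l (P x))) +
      ∫ x, (fderiv ℝ g (P x) - fderiv ℝ g 0)
        (∑ k, ∑ l, pd k (pd l q) x • coeffY a b k l (P x))| ≤
      θ * (∑ k, (∫ x, ‖b k (∑ l, pd l q x • a l (v x))‖) + ∑ _k : Fin 2, ∫ x, ‖q x • v x‖) := by
  obtain ⟨δ, hδ, hδΩ⟩ := (show IsCompact (tsupport q) from hq.2.1).exists_cthickening_subset_open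
    hΩ hq.2.2
  set K := Metric.cthickening δ (tsupport q) with hK
  have hKc : IsCompact K := (show IsCompact (tsupport q) from hq.2.1).cthickening
  have hqK : ∀ x, x ∉ K → x ∉ tsupport q := fun x hx hx' => hx (Metric.self_subset_cthickening _ hx')
  -- The derivatives of P are only locally square integrable. Restricted to a compact neighbourhood
  -- of the support of q they lie in L² of the plane, can be mollified there, and give the same
  -- integrals.
  set Γ : Fin 2 → E → W := fun k => K.indicator (G k) with hΓdef
  have hΓ : ∀ k, MemLp (Γ k) 2 := fun k => hGm k K hKc hδΩ
  have hmP := lpTendsto_moll (by norm_num) (by norm_num) h.memLp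
  have hmv := lpTendsto_moll le_rfl (by norm_num) (memLp_one_iff_integrable.2 h.integrable)
  have hmΓ := fun k => lpTendsto_moll (by norm_num) (by norm_num) (hΓ k)
  have hq0 := hq.bounded
  have hq1 := fun l => (hq.pd l).bounded
  have hq2 := fun k l => ((hq.pd l).pd k).bounded
  choose C0 _ hC0 using hq0
  choose C1 _ hC1 using hq1
  choose C2 _ hC2 using hq2
  have cq := hq.continuous.aestronglyMeasurable (μ := volume)
  have cq1 := fun l => (hq.pd l).continuous.aestronglyMeasurable (μ := volume)
  have cq2 := fun k l => ((hq.pd l).pd k).continuous.aestronglyMeasurable (μ := volume)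
  have tX : ∀ k, LpTendsto 2 (fun n x => q x • moll n (Γ k) x +
      ∑ l, pd l q x • coeffZ a b k l (moll n P x))
      (fun x => q x • Γ k x + ∑ l, pd l q x • coeffZ a b k l (P x)) := fun k =>
    ((hmΓ k).smul cq hC0).add (by norm_num)
      (LpTendsto.sum (by norm_num) _ fun l => (hmP.clm (coeffZ a b k l)).smul (cq1 l) (hC1 l))
  have tY : LpTendsto 2 (fun n x => ∑ k, ∑ l, pd k (pd l q) x • coeffY a b k l (moll n P x))
      (fun x => ∑ k, ∑ l, pd k (pd l q) x • coeffY a b k l (P x)) :=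
    LpTendsto.sum (by norm_num) _ fun k => LpTendsto.sum (by norm_num) _ fun l =>
      (hmP.clm (coeffY a b k l)).smul (cq2 k l) (hC2 k l)
  have tT : ∀ k, LpTendsto 1 (fun n x => b k (∑ l, pd l q x • a l (moll n v x)))
      (fun x => b k (∑ l, pd l q x • a l (v x))) := fun k =>
    (LpTendsto.sum le_rfl _ fun l => (hmv.clm (a l)).smul (cq1 l) (hC1 l)).clm (b k)
  have tU : LpTendsto 1 (fun n x => q x • moll n v x) (fun x => q x • v x) := hmv.smul cq hC0
  have hσ : MemLp (fun x => fderiv ℝ g (P x) - fderiv ℝ g 0) 2 := memLp_stress hg h.memLp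
  have hHΓ : ∀ k, MemLp (fun x => fderiv ℝ (fderiv ℝ g) (P x) (Γ k x)) 2 := fun k =>
    memLp_clm_apply (((contDiff_fderiv hg.contDiff).continuous_fderiv
      one_ne_zero).comp_aestronglyMeasurable h.memLp.1) (fun x => hg.norm_hess_le _) (hΓ k)
  have l1 := fun k => ((lpTendsto_const (hHΓ k)).bilin (ContinuousLinearMap.id ℝ (W →L[ℝ] ℝ))
    (tX k)).tendsto_integral
  have l2 := ((lpTendsto_const hσ).bilin (ContinuousLinearMap.id ℝ (W →L[ℝ] ℝ)) tY).tendsto_integral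
  have l3 := fun k => (tT k).tendsto_setIntegral_norm Set.univ
  have l4 := tU.tendsto_setIntegral_norm Set.univ
  simp only [ContinuousLinearMap.id_apply] at l1 l2
  simp only [Measure.restrict_univ] at l3 l4
  have lhs := ((tendsto_finsetSum Finset.univ fun k _ => l1 k).add l2).abs
  have rhs := ((tendsto_finsetSum Finset.univ fun k _ => l3 k).add
    (tendsto_finsetSum (Finset.univ : Finset (Fin 2)) fun k _ => l4)).const_mul θ
  have eΓ : ∀ k, ∫ x, fderiv ℝ (fderiv ℝ g) (P x) (G k x)
      (q x • G k x + ∑ l, pd l q x • coeffZ a b k l (P x)) =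
      ∫ x, fderiv ℝ (fderiv ℝ g) (P x) (Γ k x)
        (q x • Γ k x + ∑ l, pd l q x • coeffZ a b k l (P x)) := fun k => by
    refine integral_congr_ae (Eventually.of_forall fun x => ?_)
    by_cases hx : x ∈ K
    · simp only [hΓdef, Set.indicator_of_mem hx]
    · simp [image_eq_zero_of_notMem_tsupport (hqK x hx), pd_eq_zero_of_notMem (hqK x hx)]
  simp only [eΓ]
  refine le_of_tendsto_of_tendsto lhs rhs ?_
  filter_upwards [tendsto_bumpSeq_rOut.eventually (gt_mem_nhds (half_pos hδ))] with n hn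
  have hvn : ContDiff ℝ ∞ (moll n v) := contDiff_moll n h.integrable.locallyIntegrable
  set Q := gradA a (moll n v) with hQ
  have hQs : ContDiff ℝ ∞ Q := contDiff_gradA hvn
  obtain ⟨ht, hN⟩ := isTest_testField (a := a) (b := b) hq hvn
  have hE := h.euler _ _ ht (add_nonneg
    (Finset.sum_nonneg fun k _ => integral_nonneg fun x => norm_nonneg _)
    (Finset.sum_nonneg fun k _ => integral_nonneg fun x => norm_nonneg _)) hN
  refine le_trans (le_of_eq ?_) hE
  rw [← abs_neg]
  congr 1
  have hX : ∀ k, IsTest Ω fun x => q x • pd k Q x := fun k => hq.smul_left (contDiff_pd hQs k)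
  have hZ : ∀ k, IsTest Ω fun x => ∑ l, pd l q x • coeffZ a b k l (Q x) := fun k =>
    IsTest.sum _ fun l => (hq.pd l).smul_left ((coeffZ a b k l).contDiff.comp hQs)
  have hY : IsTest Ω fun x => ∑ k, ∑ l, pd k (pd l q) x • coeffY a b k l (Q x) :=
    IsTest.sum _ fun k => IsTest.sum _ fun l =>
      ((hq.pd l).pd k).smul_left ((coeffY a b k l).contDiff.comp hQs)
  have hXZ := fun k => (hX k).add (hZ k)
  have key := fun x => gradA_testField hab hq.1 hvn x
  have key' : ∀ x, gradA a (testField a b q (moll n v)) x =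
      ∑ k, pd k (fun y => q y • pd k Q y + ∑ l, pd l q y • coeffZ a b k l (Q y)) x -
        ∑ k, ∑ l, pd k (pd l q) x • coeffY a b k l (Q x) := fun x => by
    rw [key x, ← Finset.sum_add_distrib]
    congr 1
    refine Finset.sum_congr rfl fun k _ => ?_
    rw [pd_add (differentiable_of_smooth (hX k).1 x) (differentiable_of_smooth (hZ k).1 x)]
  have i1 : ∀ k, Integrable fun x => (fderiv ℝ g (P x) - fderiv ℝ g 0)
      (pd k (fun y => q y • pd k Q y + ∑ l, pd l q y • coeffZ a b k l (Q y)) x) := fun k =>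
    integrable_bilin (ContinuousLinearMap.id ℝ (W →L[ℝ] ℝ)) hσ (((hXZ k).pd k).memLp 2)
  have i2 : Integrable fun x => (fderiv ℝ g (P x) - fderiv ℝ g 0)
      (∑ k, ∑ l, pd k (pd l q) x • coeffY a b k l (Q x)) :=
    integrable_bilin (ContinuousLinearMap.id ℝ (W →L[ℝ] ℝ)) hσ (hY.memLp 2)
  have e1 : ∫ x, (fderiv ℝ g (P x) - fderiv ℝ g 0) (gradA a (testField a b q (moll n v)) x) =
      ∑ k, (∫ x, (fderiv ℝ g (P x) - fderiv ℝ g 0)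
        (pd k (fun y => q y • pd k Q y + ∑ l, pd l q y • coeffZ a b k l (Q y)) x)) -
      ∫ x, (fderiv ℝ g (P x) - fderiv ℝ g 0)
        (∑ k, ∑ l, pd k (pd l q) x • coeffY a b k l (Q x)) := by
    rw [← integral_finsetSum _ fun k _ => i1 k, ← integral_sub (integrable_finsetSum _ fun k _ => i1 k) i2]
    refine integral_congr_ae (Eventually.of_forall fun x => ?_)
    simp only [key', map_sub, map_sum]
  rw [e1, neg_add, sub_eq_add_neg]
  congr 1
  · rw [← Finset.sum_neg_distrib]
    refine Finset.sum_congr rfl fun k _ => ?_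
    -- The weak chain rule moves ∂ₖ from the smooth test expression onto the stress of P. Mollified
    -- quantities thus occur only linearly, in the test expression, which makes the passage to the
    -- limit in n possible.
    rw [integral_stress_pd hg hΩ h.memLp (hGw k) (hGm k) (hXZ k)]
    congr 1
    refine integral_congr_ae (Eventually.of_forall fun x => ?_)
    simp only
    by_cases hx : x ∈ tsupport q
    · obtain ⟨m1, m2⟩ := h.gradA_moll hδ hδΩ hGw hn hx
      have hxK : x ∈ K := Metric.self_subset_cthickening _ hx
      rw [hQ, m1, m2 k]
      simp only [hΓdef, Set.indicator_of_mem hxK]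
      rfl
    · simp [image_eq_zero_of_notMem_tsupport hx, pd_eq_zero_of_notMem hx]
  · congr 1
    refine integral_congr_ae (Eventually.of_forall fun x => ?_)
    simp only
    by_cases hx : x ∈ tsupport q
    · rw [hQ, (h.gradA_moll hδ hδΩ hGw hn hx).1]
    · have : ∀ k l, pd k (pd l q) x = 0 := fun k l =>
        pd_eq_zero_of_notMem (fun hx' => hx (tsupport_pd_subset q l hx')) k
      simp [this]

end SecondOrder

end WSO

namespace WSO

open Filter Topology

/-! ### Derivatives of the cut-off function and of its fourth power. -/

section Cutoff

variable {κ r : ℝ} {Ω : Set E} {x₀ : E} {ρ : E → ℝ}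

theorem IsCutoff.nonneg (h : IsCutoff κ Ω x₀ r ρ) (x : E) : 0 ≤ ρ x :=
  (Set.indicator_nonneg (fun _ _ => zero_le_one) x).trans (h.lower x)

theorem IsCutoff.le_one (h : IsCutoff κ Ω x₀ r ρ) (x : E) : ρ x ≤ 1 :=
  (h.upper x).trans (Set.indicator_le_self' (fun _ _ => zero_le_one) x)

theorem IsCutoff.eq_zero (h : IsCutoff κ Ω x₀ r ρ) {x : E} (hx : x ∉ Metric.ball x₀ (2 * r)) :
    ρ x = 0 :=
  le_antisymm ((h.upper x).trans (Set.indicator_of_notMem hx _).le) (h.nonneg x)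

theorem IsCutoff.abs_pd_le (h : IsCutoff κ Ω x₀ r ρ) (k : Fin 2) (x : E) : |pd k ρ x| ≤ 2 / r := by
  rw [← gradient_apply_eq_pd]
  exact (PiLp.norm_apply_le (gradient ρ x) k).trans (h.grad x)

theorem IsCutoff.abs_pd_pd_le (h : IsCutoff κ Ω x₀ r ρ) (k l : Fin 2) (x : E) :
    |pd k (pd l ρ) x| ≤ κ / r ^ 2 := by
  refine le_trans (Real.abs_le_sqrt ?_) (h.hess x)
  calc pd k (pd l ρ) x ^ 2 ≤ ∑ l, pd k (pd l ρ) x ^ 2 :=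
        Finset.single_le_sum (f := fun l => pd k (pd l ρ) x ^ 2) (fun _ _ => sq_nonneg _)
          (Finset.mem_univ l)
    _ ≤ ∑ k, ∑ l, pd k (pd l ρ) x ^ 2 :=
        Finset.single_le_sum (f := fun k => ∑ l, pd k (pd l ρ) x ^ 2)
          (fun _ _ => Finset.sum_nonneg fun _ _ => sq_nonneg _) (Finset.mem_univ k)

theorem pd_pd_pow_four (hρ : ContDiff ℝ ∞ ρ) (k l : Fin 2) (x : E) :
    pd k (pd l fun y => ρ y ^ 4) x =
      12 * ρ x ^ 2 * (pd k ρ x * pd l ρ x) + 4 * ρ x ^ 3 * pd k (pd l ρ) x := by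
  have e : (pd l fun y => ρ y ^ 4) = fun y => (4 * ρ y ^ 3) • pd l ρ y :=
    funext fun y => pd_pow_four hρ l y
  have h3 : HasFDerivAt (fun y => 4 * ρ y ^ 3) _ x :=
    ((differentiable_of_smooth hρ x).hasFDerivAt.pow 3).const_mul 4
  rw [e, pd_smul h3.differentiableAt (differentiable_of_smooth (contDiff_pd hρ l) x)]
  have : pd k (fun y => 4 * ρ y ^ 3) x = 12 * ρ x ^ 2 * pd k ρ x := by
    rw [pd, h3.fderiv]
    simp [pd]
    ring
  rw [this]
  simp only [smul_eq_mul]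
  ring

theorem IsCutoff.abs_pd_pow_four_le (h : IsCutoff κ Ω x₀ r ρ) (l : Fin 2) (x : E) :
    |pd l (fun y => ρ y ^ 4) x| ≤ 8 / r := by
  have h0 := h.nonneg x
  rw [pd_pow_four h.test.1, abs_mul, abs_of_nonneg (by positivity)]
  have h1 : 4 * ρ x ^ 3 ≤ 4 := by linarith [pow_le_one₀ (n := 3) h0 (h.le_one x)]
  calc _ ≤ 4 * (2 / r) := mul_le_mul h1 (h.abs_pd_le l x) (abs_nonneg _) (by norm_num)
    _ = 8 / r := by ring

theorem IsCutoff.abs_pd_pd_pow_four_le (h : IsCutoff κ Ω x₀ r ρ) (k l : Fin 2) (x : E) :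
    |pd k (pd l fun y => ρ y ^ 4) x| ≤ (48 + 4 * κ) / r ^ 2 := by
  have h0 := h.nonneg x
  have h2 : 12 * ρ x ^ 2 ≤ 12 := by linarith [pow_le_one₀ (n := 2) h0 (h.le_one x)]
  have h3 : 4 * ρ x ^ 3 ≤ 4 := by linarith [pow_le_one₀ (n := 3) h0 (h.le_one x)]
  have hr : 0 ≤ 2 / r := (abs_nonneg _).trans (h.abs_pd_le k x)
  rw [pd_pd_pow_four h.test.1]
  refine (abs_add_le _ _).trans ?_
  rw [abs_mul (12 * ρ x ^ 2), abs_mul (4 * ρ x ^ 3), abs_mul (pd k ρ x),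
    abs_of_nonneg (show (0 : ℝ) ≤ 12 * ρ x ^ 2 by positivity),
    abs_of_nonneg (show (0 : ℝ) ≤ 4 * ρ x ^ 3 by positivity)]
  calc _ ≤ 12 * (2 / r * (2 / r)) + 4 * (κ / r ^ 2) := by
        refine add_le_add (mul_le_mul h2 ?_ (by positivity) (by norm_num))
          (mul_le_mul h3 (h.abs_pd_pd_le k l x) (abs_nonneg _) (by norm_num))
        exact mul_le_mul (h.abs_pd_le k x) (h.abs_pd_le l x) (abs_nonneg _) hr
    _ = (48 + 4 * κ) / r ^ 2 := by
        ring

end Cutoff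

/-! ### The second order estimate with explicit constants. -/

section SecondOrderEstimate

/-- Collects the constants after 1/r² has been factored out. The Ekeland error is bounded by a
multiple of θ(1 + 1/r)∫|v|, which is r⁻² θ(r² + r³) ∫|v|/r; this is the origin of the powers of r in
the theorem. -/
theorem second_order_arith {Λ κ ε θ r sZ cY cA cB M₁ M₂ Mv S : ℝ} (hΛ : 0 < Λ) (hκ : 0 < κ)
    (hε : 0 < ε) (hθ : 0 ≤ θ) (hr : 0 < r) (hsZ : 0 ≤ sZ) (hcY : 0 ≤ cY) (hcA : 0 ≤ cA)
    (hcB : 0 ≤ cB) (hM₁ : 0 ≤ M₁) (hM₂ : 0 ≤ M₂) (hMv : 0 ≤ Mv)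
    (hS : S ≤ 64 / r ^ 2 * sZ * (Λ * M₁ + ε * M₂) +
      2 * ((48 + 4 * κ) / r ^ 2 * cY * (Real.pi * Λ * M₁ + ε * M₂)) +
      2 * (θ * (cB * (cA * (8 / r)) * Mv + 2 * Mv))) :
    S ≤ (64 * sZ * (Λ + 1) + 2 * ((48 + 4 * κ) * cY * (Real.pi * Λ + 1)) +
      2 * (8 * cB * cA + 2)) / r ^ 2 * (M₁ + ε * M₂ + θ * (r ^ 2 + r ^ 3) * (Mv / r)) := by
  refine hS.trans ?_
  have hπ := Real.pi_pos
  obtain ⟨D, hD⟩ : ∃ D, D = M₁ + ε * M₂ := ⟨_, rfl⟩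
  have hD0 : 0 ≤ D := by rw [hD]; positivity
  have g1 : Λ * M₁ + ε * M₂ ≤ (Λ + 1) * D := by
    have : 0 ≤ M₁ + Λ * (ε * M₂) := by positivity
    rw [hD]
    linarith
  have g2 : Real.pi * Λ * M₁ + ε * M₂ ≤ (Real.pi * Λ + 1) * D := by
    have : 0 ≤ M₁ + Real.pi * Λ * (ε * M₂) := by positivity
    rw [hD]
    linarith
  obtain ⟨R, hR⟩ : ∃ R, R = θ * (1 + 1 / r) * Mv := ⟨_, rfl⟩
  have hR0 : 0 ≤ R := by rw [hR]; positivity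
  have g3 : θ * (cB * (cA * (8 / r)) * Mv + 2 * Mv) ≤ (8 * cB * cA + 2) * R := by
    have e : (8 * cB * cA + 2) * R = θ * (cB * (cA * (8 / r)) * Mv + 2 * Mv) +
        (8 * cB * cA * (θ * Mv) + 2 * (θ * (1 / r) * Mv)) := by
      rw [hR]
      ring
    have : 0 ≤ 8 * cB * cA * (θ * Mv) + 2 * (θ * (1 / r) * Mv) := by positivity
    linarith
  obtain ⟨c₁, hc₁⟩ : ∃ c, c = 64 * sZ * (Λ + 1) + 2 * ((48 + 4 * κ) * cY * (Real.pi * Λ + 1)) :=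
    ⟨_, rfl⟩
  have hc₁0 : 0 ≤ c₁ := by rw [hc₁]; positivity
  obtain ⟨c₂, hc₂⟩ : ∃ c, c = 2 * (8 * cB * cA + 2) := ⟨_, rfl⟩
  have hc₂0 : 0 ≤ c₂ := by rw [hc₂]; positivity
  have e : (c₁ + c₂) / r ^ 2 * (D + θ * (r ^ 2 + r ^ 3) * (Mv / r)) =
      (c₁ + c₂) * (1 / r ^ 2 * D) + (c₁ + c₂) * R := by
    rw [hR]
    field_simp
    ring
  rw [← hc₁, ← hc₂, ← hD, e]
  calc _ ≤ 64 / r ^ 2 * sZ * ((Λ + 1) * D) +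
      2 * ((48 + 4 * κ) / r ^ 2 * cY * ((Real.pi * Λ + 1) * D)) + 2 * ((8 * cB * cA + 2) * R) := by
        gcongr
    _ = c₁ * (1 / r ^ 2 * D) + c₂ * R := by
        rw [hc₁, hc₂]
        ring
    _ ≤ _ := by
        gcongr <;> linarith

variable {W : Type*} [NormedAddCommGroup W] [InnerProductSpace ℝ W]

/-- Hessian bounds of an integrand of linear growth, up to a quadratic perturbation. -/
structure HasLinearGrowthBounds (Λ ε : ℝ) (g : W → ℝ) : Prop where
  contDiff : ContDiff ℝ 2 g
  eps_pos : 0 < ε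
  lower : ∀ P ξ, ε * ‖ξ‖ ^ 2 ≤ fderiv ℝ (fderiv ℝ g) P ξ ξ
  upper : ∀ P ξ, fderiv ℝ (fderiv ℝ g) P ξ ξ ≤ (Λ / Real.sqrt (1 + ‖P‖ ^ 2) + ε) * ‖ξ‖ ^ 2
  stress : ∀ P, ‖fderiv ℝ g P - fderiv ℝ g 0‖ ≤ Real.pi * Λ + ε * ‖P‖

variable {Λ ε κ : ℝ} {g : W → ℝ}

theorem HasLinearGrowthBounds.hasHessBounds (h : HasLinearGrowthBounds Λ ε g) (hΛ : 0 < Λ) :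
    HasHessBounds ε (Λ + ε) g := by
  refine ⟨h.contDiff, h.eps_pos.le, h.lower, fun P ξ => (h.upper P ξ).trans ?_,
    (add_pos hΛ h.eps_pos).le⟩
  have h1 : 1 ≤ Real.sqrt (1 + ‖P‖ ^ 2) := Real.one_le_sqrt.2 (by linarith [sq_nonneg ‖P‖])
  have := div_le_self hΛ.le h1
  gcongr

/-- Since |P|² ≤ |P|√(1+|P|²), the decay of the Hessian turns an expression quadratic in P into one
of linear growth. Only the regularising part stays quadratic, and it carries the factor ε. -/
theorem HasLinearGrowthBounds.hess_le (h : HasLinearGrowthBounds Λ ε g) (hΛ : 0 < Λ) {P Y : W} {m : ℝ}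
    (hY : ‖Y‖ ≤ m * ‖P‖) :
    fderiv ℝ (fderiv ℝ g) P Y Y ≤ m ^ 2 * (Λ * ‖P‖ + ε * ‖P‖ ^ 2) := by
  refine (h.upper P Y).trans ?_
  have hs : ‖P‖ ≤ Real.sqrt (1 + ‖P‖ ^ 2) := Real.le_sqrt_of_sq_le (by linarith)
  have hs1 : 0 < Real.sqrt (1 + ‖P‖ ^ 2) := Real.sqrt_pos.2 (by positivity)
  have h1 : Λ / Real.sqrt (1 + ‖P‖ ^ 2) * ‖P‖ ≤ Λ := by
    rw [div_mul_eq_mul_div, div_le_iff₀ hs1]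
    exact mul_le_mul_of_nonneg_left hs hΛ.le
  have hε := h.eps_pos
  calc (Λ / Real.sqrt (1 + ‖P‖ ^ 2) + ε) * ‖Y‖ ^ 2
      ≤ (Λ / Real.sqrt (1 + ‖P‖ ^ 2) + ε) * (m * ‖P‖) ^ 2 := by gcongr
    _ = m ^ 2 * ((Λ / Real.sqrt (1 + ‖P‖ ^ 2) * ‖P‖) * ‖P‖ + ε * ‖P‖ ^ 2) := by ring
    _ ≤ _ := by gcongr

theorem norm_sum_sum_smul_le (T : Fin 2 → Fin 2 → W →L[ℝ] W) {c : Fin 2 → Fin 2 → ℝ} {M : ℝ}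
    (hM : ∀ k l, |c k l| ≤ M) (y : W) :
    ‖∑ k, ∑ l, c k l • T k l y‖ ≤ M * (∑ k, ∑ l, ‖T k l‖) * ‖y‖ := by
  refine (norm_sum_le _ _).trans ?_
  rw [Finset.mul_sum, Finset.sum_mul]
  refine Finset.sum_le_sum fun k _ => (norm_sum_le _ _).trans ?_
  rw [Finset.mul_sum, Finset.sum_mul]
  refine Finset.sum_le_sum fun l _ => ?_
  rw [norm_smul, Real.norm_eq_abs, mul_assoc]
  exact mul_le_mul (hM k l) ((T k l).le_opNorm y) (norm_nonneg _) ((abs_nonneg _).trans (hM k l))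

variable {Ω : Set E} {a : Fin 2 → E →L[ℝ] W} {b : Fin 2 → W →L[ℝ] E} {θ : ℝ}
  {v : E → E} {P : E → W} {G : Fin 2 → E → W} {x₀ : E} {r : ℝ} {ρ : E → ℝ}

theorem integrable_hess_mul_pow_four (hg : HasLinearGrowthBounds Λ ε g) (hΛ : 0 < Λ)
    (hP : MemLp P 2)
    (hGm : ∀ k K, IsCompact K → K ⊆ Ω → MemLp (K.indicator (G k)) 2)
    (hρ : IsCutoff κ Ω x₀ r ρ) (k : Fin 2) {X : E → W} (hX : MemLp X 2)
    (hX0 : ∀ x, x ∉ tsupport ρ → X x = 0) :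
    Integrable fun x => fderiv ℝ (fderiv ℝ g) (P x) (G k x) (ρ x ^ 4 • G k x + X x) := by
  set K := tsupport ρ with hK
  have hKc : IsCompact K := hρ.test.2.1
  have hΓ := hGm k K hKc hρ.test.2.2
  have hH : MemLp (fun x => fderiv ℝ (fderiv ℝ g) (P x) (K.indicator (G k) x)) 2 :=
    memLp_clm_apply (((contDiff_fderiv hg.contDiff).continuous_fderiv
      one_ne_zero).comp_aestronglyMeasurable hP.1) (fun x => (hg.hasHessBounds hΛ).norm_hess_le _) hΓ
  have hqΓ : MemLp (fun x => ρ x ^ 4 • K.indicator (G k) x) 2 := by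
    refine MemLp.of_le_mul (c := 1) hΓ
      ((hρ.test.continuous.pow 4).aestronglyMeasurable.smul hΓ.1) (Eventually.of_forall fun x => ?_)
    rw [norm_smul, Real.norm_of_nonneg (pow_nonneg (hρ.nonneg x) 4)]
    exact mul_le_mul_of_nonneg_right (pow_le_one₀ (hρ.nonneg x) (hρ.le_one x)) (norm_nonneg _)
  refine (integrable_bilin (ContinuousLinearMap.id ℝ (W →L[ℝ] ℝ)) hH (hqΓ.add hX)).congr
    (Eventually.of_forall fun x => ?_)
  by_cases hx : x ∈ K
  · simp [Set.indicator_of_mem hx]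
  · simp [hX0 x hx, image_eq_zero_of_notMem_tsupport hx]

/-- The constant in the second order estimate. -/
noncomputable def secondOrderConst (a : Fin 2 → E →L[ℝ] W) (b : Fin 2 → W →L[ℝ] E) (Λ κ : ℝ) : ℝ :=
  64 * (∑ k, (∑ l, ‖coeffZ a b k l‖) ^ 2) * (Λ + 1) +
    2 * ((48 + 4 * κ) * (∑ k, ∑ l, ‖coeffY a b k l‖) * (Real.pi * Λ + 1)) +
    2 * (8 * (∑ k, ‖b k‖) * (∑ l, ‖a l‖) + 2)

theorem secondOrderConst_pos (hΛ : 0 < Λ) (hκ : 0 < κ) : 0 < secondOrderConst a b Λ κ := by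
  unfold secondOrderConst
  have := Real.pi_pos
  positivity

variable [FiniteDimensional ℝ W]

/-- The second order estimate for almost solutions. -/
theorem IsAlmostSolution.second_order_estimate (h : IsAlmostSolution Ω a g θ v P) (hΩ : IsOpen Ω)
    (hab : FactorsLaplacian a b) (hΛ : 0 < Λ) (hκ : 0 < κ) (hg : HasLinearGrowthBounds Λ ε g)
    (hθ : 0 ≤ θ) (hGw : ∀ k, WeakOp Ω (pdCoeff W k) P (G k))
    (hGm : ∀ k K, IsCompact K → K ⊆ Ω → MemLp (K.indicator (G k)) 2)
    (hr : 0 < r) (hρ : IsCutoff κ Ω x₀ r ρ) :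
    (∀ k, Integrable fun x => ρ x ^ 4 * fderiv ℝ (fderiv ℝ g) (P x) (G k x) (G k x)) ∧
    ∑ k, ∫ x, ρ x ^ 4 * fderiv ℝ (fderiv ℝ g) (P x) (G k x) (G k x) ≤
      secondOrderConst a b Λ κ / r ^ 2 *
        ((∫ x in Metric.ball x₀ (2 * r), ‖P x‖) + ε * (∫ x in Metric.ball x₀ (2 * r), ‖P x‖ ^ 2) +
          θ * (r ^ 2 + r ^ 3) * ∫ x in Metric.ball x₀ (2 * r), ‖v x‖ / r) := by
  have hb := hg.hasHessBounds hΛ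
  set B := Metric.ball x₀ (2 * r) with hB
  have hBm : MeasurableSet B := measurableSet_ball
  have hε := hg.eps_pos
  set q : E → ℝ := fun y => ρ y ^ 4 with hq
  have hqt : IsTest Ω q := hρ.test.pow_four
  set H : E → W →L[ℝ] W →L[ℝ] ℝ := fun x => fderiv ℝ (fderiv ℝ g) (P x) with hH
  have hZm : ∀ k, MemLp (fun x => ∑ l, pd l q x • coeffZ a b k l (P x)) 2 := fun k =>
    memLp_finsetSum _ fun l _ => by
      obtain ⟨C, hC0, hC⟩ := (hqt.pd l).bounded
      refine MemLp.of_le_mul (c := C * ‖coeffZ a b k l‖) h.memLp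
        ((hqt.pd l).continuous.aestronglyMeasurable.smul
          ((coeffZ a b k l).continuous.comp_aestronglyMeasurable h.memLp.1))
        (Eventually.of_forall fun x => ?_)
      rw [norm_smul, mul_assoc]
      exact mul_le_mul (hC x) ((coeffZ a b k l).le_opNorm _) (norm_nonneg _) hC0
  have hqs : tsupport q ⊆ tsupport ρ := closure_mono fun x hx hx' => hx (by simp [hq, hx'])
  have hZ0 : ∀ k x, x ∉ tsupport ρ → ∑ l, pd l q x • coeffZ a b k l (P x) = 0 := fun k x hx =>
    Finset.sum_eq_zero fun l _ => by
      rw [pd_eq_zero_of_notMem fun hx' => hx (hqs hx'), zero_smul]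
  have hGG : ∀ k, Integrable fun x => ρ x ^ 4 * H x (G k x) (G k x) := fun k => by
    have := integrable_hess_mul_pow_four hg hΛ h.memLp hGm hρ k (X := 0) MemLp.zero (fun _ _ => rfl)
    simpa using this
  refine ⟨hGG, ?_⟩
  have hGX := fun k => integrable_hess_mul_pow_four hg hΛ h.memLp hGm hρ k (hZm k) (hZ0 k)
  have hP1 : IntegrableOn (fun x => ‖P x‖) B := by
    have : IsFiniteMeasure (volume.restrict B) := ⟨by simpa using measure_ball_lt_top⟩
    exact ((h.memLp.restrict B).integrable (by norm_num)).norm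
  have hP2 : IntegrableOn (fun x => ‖P x‖ ^ 2) B := (integrable_norm_sq h.memLp).integrableOn
  have hv1 : IntegrableOn (fun x => ‖v x‖) B := h.integrable.norm.integrableOn
  set M₁ := ∫ x in B, ‖P x‖ with hM₁
  set M₂ := ∫ x in B, ‖P x‖ ^ 2 with hM₂
  set Mv := ∫ x in B, ‖v x‖ with hMv
  have hM₁0 : 0 ≤ M₁ := integral_nonneg fun x => norm_nonneg _
  have hM₂0 : 0 ≤ M₂ := integral_nonneg fun x => sq_nonneg _
  have hMv0 : 0 ≤ Mv := integral_nonneg fun x => norm_nonneg _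
  have hD : ∀ c : ℝ, IntegrableOn (fun x => c * ‖P x‖ + ε * ‖P x‖ ^ 2) B := fun c =>
    (hP1.const_mul c).add (hP2.const_mul ε)
  have hDi : ∀ c : ℝ, ∫ x, B.indicator (fun x => c * ‖P x‖ + ε * ‖P x‖ ^ 2) x =
      c * M₁ + ε * M₂ := fun c => by
    rw [integral_indicator hBm, integral_add (hP1.const_mul c) (hP2.const_mul ε),
      integral_const_mul, integral_const_mul]
  set cZ : Fin 2 → ℝ := fun k => ∑ l, ‖coeffZ a b k l‖ with hcZ
  set cY := ∑ k, ∑ l, ‖coeffY a b k l‖ with hcY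
  set cA := ∑ l, ‖a l‖ with hcA
  have hcZ0 : ∀ k, 0 ≤ cZ k := fun k => Finset.sum_nonneg fun _ _ => norm_nonneg _
  have hcY0 : 0 ≤ cY := Finset.sum_nonneg fun _ _ => Finset.sum_nonneg fun _ _ => norm_nonneg _
  have hcA0 : 0 ≤ cA := Finset.sum_nonneg fun _ _ => norm_nonneg _
  -- One writes ∂ₗρ⁴ = ρ²·(4ρ ∂ₗρ). The factor ρ² joins ∂ₖP in Young's inequality for the Hessian
  -- form, which absorbs half of the main term; the remaining field Y is bounded by a multiple of
  -- |P|/r.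
  have hpt : ∀ k x, 1 / 2 * (ρ x ^ 4 * H x (G k x) (G k x)) ≤
      H x (G k x) (ρ x ^ 4 • G k x + ∑ l, pd l q x • coeffZ a b k l (P x)) +
        1 / 2 * ((8 / r * cZ k) ^ 2 * B.indicator (fun x => Λ * ‖P x‖ + ε * ‖P x‖ ^ 2) x) := by
    intro k x
    set Y : W := ∑ l, (4 * ρ x * pd l ρ x) • coeffZ a b k l (P x) with hY
    have eZ : ∑ l, pd l q x • coeffZ a b k l (P x) = ρ x ^ 2 • Y := by
      rw [hY, Finset.smul_sum]
      refine Finset.sum_congr rfl fun l _ => ?_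
      rw [hq, pd_pow_four hρ.test.1, smul_smul]
      congr 1
      ring
    have hYY : H x Y Y ≤ (8 / r * cZ k) ^ 2 *
        B.indicator (fun x => Λ * ‖P x‖ + ε * ‖P x‖ ^ 2) x := by
      by_cases hx : x ∈ B
      · rw [Set.indicator_of_mem hx]
        refine hg.hess_le hΛ ?_
        refine (norm_sum_le _ _).trans ?_
        rw [hcZ, Finset.mul_sum, Finset.sum_mul]
        refine Finset.sum_le_sum fun l _ => ?_
        rw [norm_smul, mul_assoc (8 / r)]
        refine mul_le_mul ?_ ((coeffZ a b k l).le_opNorm _) (norm_nonneg _) (by positivity)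
        rw [norm_mul, Real.norm_of_nonneg (by linarith [hρ.nonneg x]), Real.norm_eq_abs]
        calc 4 * ρ x * |pd l ρ x| ≤ 4 * (2 / r) :=
              mul_le_mul (by linarith [hρ.le_one x]) (hρ.abs_pd_le l x) (abs_nonneg _) (by norm_num)
          _ = 8 / r := by ring
      · have : Y = 0 := by simp [hY, hρ.eq_zero hx]
        simp [this, Set.indicator_of_notMem hx]
    have h1 := bilin_le_half_add_half (H x) (hess_symm hg.contDiff _) (hb.nonneg _)
      (ρ x ^ 2 • G k x) Y
    have h2 := (abs_le.1 h1).1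
    rw [eZ]
    simp only [map_add, map_smul, _root_.smul_apply, smul_eq_mul] at h2 ⊢
    nlinarith
  have hI : ∀ k, 1 / 2 * (∫ x, ρ x ^ 4 * H x (G k x) (G k x)) ≤
      (∫ x, H x (G k x) (ρ x ^ 4 • G k x + ∑ l, pd l q x • coeffZ a b k l (P x))) +
        1 / 2 * ((8 / r * cZ k) ^ 2 * (Λ * M₁ + ε * M₂)) := fun k => by
    have i2 := (((hD Λ).integrable_indicator hBm).const_mul ((8 / r * cZ k) ^ 2)).const_mul (1 / 2)
    rw [← hDi, ← integral_const_mul, ← integral_const_mul ((8 / r * cZ k) ^ 2),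
      ← integral_const_mul (1 / 2), ← integral_add (hGX k) i2]
    exact integral_mono ((hGG k).const_mul _) ((hGX k).add i2) (hpt k)
  -- The zeroth order term contains no Hessian, so the bound πΛ + ε|P| for the stress itself is
  -- used. Since πΛ depends neither on the growth constants of f nor on its Lipschitz constant,
  -- neither does the final constant.
  have hS : |∫ x, (fderiv ℝ g (P x) - fderiv ℝ g 0)
      (∑ k, ∑ l, pd k (pd l q) x • coeffY a b k l (P x))| ≤
      (48 + 4 * κ) / r ^ 2 * cY * (Real.pi * Λ * M₁ + ε * M₂) := by
    rw [← hDi, ← integral_const_mul, ← Real.norm_eq_abs]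
    refine norm_integral_le_of_norm_le (((hD _).integrable_indicator hBm).const_mul _)
      (Eventually.of_forall fun x => ?_)
    by_cases hx : x ∈ B
    · rw [Set.indicator_of_mem hx]
      calc _ ≤ (Real.pi * Λ + ε * ‖P x‖) * ((48 + 4 * κ) / r ^ 2 * cY * ‖P x‖) := by
            refine ContinuousLinearMap.le_of_opNorm_le_of_le _ (hg.stress _) ?_
            exact norm_sum_sum_smul_le _ (fun k l => hρ.abs_pd_pd_pow_four_le k l x) _
        _ = _ := by ring
    · have : ∀ k l, pd k (pd l q) x = 0 := fun k l => by
        rw [hq, pd_pd_pow_four hρ.test.1, hρ.eq_zero hx]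
        ring
      simp [this, Set.indicator_of_notMem hx]
  have hvB : ∫ x, B.indicator (fun x => ‖v x‖) x = Mv := integral_indicator hBm
  have hT : ∀ k, ∫ x, ‖b k (∑ l, pd l q x • a l (v x))‖ ≤ ‖b k‖ * (cA * (8 / r)) * Mv := fun k => by
    rw [← hvB, ← integral_const_mul]
    refine integral_mono_of_nonneg (Eventually.of_forall fun x => norm_nonneg _)
      ((hv1.integrable_indicator hBm).const_mul _) (Eventually.of_forall fun x => ?_)
    by_cases hx : x ∈ B
    · simp only [Set.indicator_of_mem hx]
      refine ((b k).le_opNorm _).trans ?_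
      rw [mul_assoc]
      exact mul_le_mul_of_nonneg_left
        (norm_sum_smul_le a (fun l => hρ.abs_pd_pow_four_le l x) (v x)) (norm_nonneg _)
    · have : ∀ l, pd l q x = 0 := fun l => by
        rw [hq, pd_pow_four hρ.test.1, hρ.eq_zero hx]
        ring
      simp [this, Set.indicator_of_notMem hx]
  have hU : ∫ x, ‖q x • v x‖ ≤ Mv := by
    rw [← hvB]
    refine integral_mono_of_nonneg (Eventually.of_forall fun x => norm_nonneg _)
      (hv1.integrable_indicator hBm) (Eventually.of_forall fun x => ?_)
    by_cases hx : x ∈ B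
    · simp only [Set.indicator_of_mem hx, norm_smul, hq,
        Real.norm_of_nonneg (pow_nonneg (hρ.nonneg x) 4)]
      exact mul_le_of_le_one_left (norm_nonneg _) (pow_le_one₀ (hρ.nonneg x) (hρ.le_one x))
    · simp [hq, hρ.eq_zero hx, Set.indicator_of_notMem hx]
  have hmain := (abs_le.1 (h.abs_second_order_le hΩ hab hb hGw hGm hqt)).2
  have hS' := (abs_le.1 hS).1
  have hIs := Finset.sum_le_sum fun k (_ : k ∈ Finset.univ) => hI k
  have hTs := Finset.sum_le_sum fun k (_ : k ∈ Finset.univ) => hT k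
  rw [← Finset.mul_sum, Finset.sum_add_distrib] at hIs
  have hZs : ∑ k, 1 / 2 * ((8 / r * cZ k) ^ 2 * (Λ * M₁ + ε * M₂)) =
      32 / r ^ 2 * (∑ k, cZ k ^ 2) * (Λ * M₁ + ε * M₂) := by
    rw [Finset.mul_sum, Finset.sum_mul]
    refine Finset.sum_congr rfl fun k _ => ?_
    ring
  have hBs : ∑ k, ‖b k‖ * (cA * (8 / r)) * Mv = (∑ k, ‖b k‖) * (cA * (8 / r)) * Mv := by
    have : ∀ c : ℝ, ∑ k, ‖b k‖ * c * Mv = (∑ k, ‖b k‖) * c * Mv := fun c => by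
      rw [Finset.sum_mul, Finset.sum_mul]
    exact this _
  rw [hZs] at hIs
  rw [hBs] at hTs
  have hUs : ∑ _k : Fin 2, ∫ x, ‖q x • v x‖ ≤ 2 * Mv := by
    rw [Fin.sum_univ_two]
    linarith
  set cB := ∑ k, ‖b k‖ with hcB
  have hcB0 : 0 ≤ cB := Finset.sum_nonneg fun _ _ => norm_nonneg _
  set sZ := ∑ k, cZ k ^ 2 with hsZ
  have hsZ0 : 0 ≤ sZ := Finset.sum_nonneg fun _ _ => sq_nonneg _
  have hN := mul_le_mul_of_nonneg_left (add_le_add hTs hUs) hθ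
  have hvr : ∫ x in B, ‖v x‖ / r = Mv / r := by
    rw [integral_div]
  rw [hvr]
  have htot : ∑ k, ∫ x, ρ x ^ 4 * H x (G k x) (G k x) ≤
      64 / r ^ 2 * sZ * (Λ * M₁ + ε * M₂) +
      2 * ((48 + 4 * κ) / r ^ 2 * cY * (Real.pi * Λ * M₁ + ε * M₂)) +
      2 * (θ * (cB * (cA * (8 / r)) * Mv + 2 * Mv)) := by
    have e : 64 / r ^ 2 * sZ * (Λ * M₁ + ε * M₂) = 2 * (32 / r ^ 2 * sZ * (Λ * M₁ + ε * M₂)) := by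
      ring
    rw [e]
    linarith
  rw [secondOrderConst]
  exact second_order_arith hΛ hκ hε hθ hr hsZ0 hcY0 hcA0 hcB0 hM₁0 hM₂0 hMv0 htot

end SecondOrderEstimate

end WSO

namespace WSO

/-! ### The algebra of `ℂ`-elliptic projections of `2 × 2` matrices -/

section Algebra

theorem exists_eq_tensor_of_det_eq_zero (Z : Fin 2 × Fin 2 → ℂ)
    (hZ : Z (0, 0) * Z (1, 1) - Z (0, 1) * Z (1, 0) = 0) :
    ∃ v ξ : Fin 2 → ℂ, ξ ≠ 0 ∧ ∀ p, Z p = v p.1 * ξ p.2 := by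
  by_cases h00 : Z (0, 0) = 0
  · by_cases h01 : Z (0, 1) = 0
    · by_cases h1 : Z (1, 0) = 0 ∧ Z (1, 1) = 0
      · refine ⟨0, fun _ => 1, fun h => by simpa using congrFun h 0, fun ⟨i, j⟩ => ?_⟩
        fin_cases i <;> fin_cases j <;> simp [h00, h01, h1.1, h1.2]
      · refine ⟨![0, 1], ![Z (1, 0), Z (1, 1)], fun h => h1 ⟨?_, ?_⟩, fun ⟨i, j⟩ => ?_⟩
        · simpa using congrFun h 0
        · simpa using congrFun h 1
        · fin_cases i <;> fin_cases j <;> simp [h00, h01]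
    · refine ⟨![1, Z (1, 1) / Z (0, 1)], ![Z (0, 0), Z (0, 1)],
        fun h => h01 (by simpa using congrFun h 1), fun ⟨i, j⟩ => ?_⟩
      have h10 : Z (1, 0) = 0 := by
        simpa [h00, h01] using hZ
      fin_cases i <;> fin_cases j <;> simp [h00, h10]
      field_simp
  · refine ⟨![1, Z (1, 0) / Z (0, 0)], ![Z (0, 0), Z (0, 1)],
      fun h => h00 (by simpa using congrFun h 0), fun ⟨i, j⟩ => ?_⟩
    fin_cases i <;> fin_cases j <;> simp
    · field_simp
    · field_simp
      linear_combination hZ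

variable {A : Mat →L[ℝ] Mat}

/-- The kernel of a `ℂ`-elliptic projection contains no real and imaginary parts of complex matrices
of rank one. -/
theorem IsCElliptic.eq_zero (h : IsCElliptic A) {X Y : Mat} (hX : A X = 0) (hY : A Y = 0)
    (hdet : ((X (0, 0) : ℂ) + Complex.I * Y (0, 0)) * (X (1, 1) + Complex.I * Y (1, 1)) -
      (X (0, 1) + Complex.I * Y (0, 1)) * (X (1, 0) + Complex.I * Y (1, 0)) = 0) :
    X = 0 ∧ Y = 0 := by
  obtain ⟨v, ξ, hξ, hv⟩ := exists_eq_tensor_of_det_eq_zero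
    (fun p => (X p : ℂ) + Complex.I * Y p) hdet
  have eX : tensRe v ξ = X := by
    ext p
    simp only [tensRe, ← hv p]
    simp
  have eY : tensIm v ξ = Y := by
    ext p
    simp only [tensIm, ← hv p]
    simp
  have hv0 : v = 0 := h ξ hξ (by
    funext p
    have z1 : tensRe 0 ξ = 0 := by ext p; simp [tensRe]
    have z2 : tensIm 0 ξ = 0 := by ext p; simp [tensIm]
    simp [complexSymbol, eX, eY, hX, hY, z1, z2])
  subst hv0
  refine ⟨?_, ?_⟩
  · rw [← eX]
    ext p
    simp [tensRe]
  · rw [← eY]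
    ext p
    simp [tensIm]

/-- The determinant of a matrix. -/
def det (M : Mat) : ℝ := M (0, 0) * M (1, 1) - M (0, 1) * M (1, 0)

theorem IsCElliptic.det_ne_zero (h : IsCElliptic A) {M : Mat} (hM : A M = 0) (hM0 : M ≠ 0) :
    det M ≠ 0 := fun hd => hM0 (h.eq_zero hM (map_zero A) (by
  have : (det M : ℂ) = 0 := by exact_mod_cast hd
  simpa [det] using this)).1

/-- The polynomial t ↦ det(N + tM) has leading coefficient det M ≠ 0 and therefore a complex root.
There N + tM has complex rank at most one, and its real and imaginary parts lie in the kernel, so it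
vanishes. Ellipticity over ℝ would not suffice, since the root need not be real. -/
theorem IsCElliptic.exists_smul_eq (h : IsCElliptic A) {M N : Mat} (hM : A M = 0) (hM0 : M ≠ 0)
    (hN : A N = 0) : ∃ t : ℝ, N = t • M := by
  have hd := h.det_ne_zero hM hM0
  have hdC : (det M : ℂ) ≠ 0 := by exact_mod_cast hd
  obtain ⟨t, ht⟩ := exists_quadratic_eq_zero hdC (b := (N (0, 0) * M (1, 1) + M (0, 0) * N (1, 1) -
    N (0, 1) * M (1, 0) - M (0, 1) * N (1, 0) : ℂ)) (c := (det N : ℂ))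
    (IsAlgClosed.exists_eq_mul_self _)
  have hx := h.eq_zero (X := N + t.re • M) (Y := t.im • M) (by simp [hN, hM]) (by simp [hM]) (by
    have e : ∀ p, (((N + t.re • M) p : ℝ) : ℂ) + Complex.I * (((t.im • M) p : ℝ) : ℂ) =
        N p + t * M p := fun p => by
      conv_rhs => rw [← Complex.re_add_im t]
      simp only [PiLp.add_apply, PiLp.smul_apply, smul_eq_mul]
      push_cast
      ring
    rw [e, e, e, e]
    rw [← ht]
    simp only [det]
    push_cast
    ring)
  refine ⟨-t.re, ?_⟩
  rw [neg_smul]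
  exact eq_neg_of_add_eq_zero_left hx.1

/-- The entries of the cofactor matrix. -/
def cof (Q : Mat) (m k : Fin 2) : ℝ := (if m = k then 1 else -1) * Q (m + 1, k + 1)

/-- The map `Q ↦ Q eₖ - K cof(Q) eₖ`. -/
def leftFactor (K : Fin 2 → Fin 2 → ℝ) (k : Fin 2) : Mat →ₗ[ℝ] E where
  toFun Q := WithLp.toLp 2 fun i => Q (i, k) - ∑ m, K i m * cof Q m k
  map_add' Q R := by
    ext i
    simp only [cof, PiLp.add_apply, Fin.sum_univ_two]
    ring
  map_smul' c Q := by
    ext i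
    simp only [cof, PiLp.smul_apply, Fin.sum_univ_two, smul_eq_mul, RingHom.id_apply]
    ring

/-- The k-th column of cof(x ⊗ eₗ) is antisymmetric in k and l, which expresses that cofactors of
gradients are divergence free. So K drops out of the symmetrised sum. -/
theorem leftFactor_tens (K : Fin 2 → Fin 2 → ℝ) (k l : Fin 2) (x : E) :
    leftFactor K k (tens x (EuclideanSpace.single l 1)) +
      leftFactor K l (tens x (EuclideanSpace.single k 1)) = if k = l then (2 : ℝ) • x else 0 := by
  ext i
  fin_cases k <;> fin_cases l <;>
    simp [leftFactor, tens, cof, Fin.sum_univ_two] <;> ring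

/-- From Mᵀ cof(M) = det(M) I one gets K cof(M) = M for K = M Mᵀ / det M. -/
theorem leftFactor_self (M : Mat) (hM : det M ≠ 0) (k : Fin 2) :
    leftFactor (fun i m => (∑ n, M (i, n) * M (m, n)) / det M) k M = 0 := by
  ext i
  fin_cases k <;> fin_cases i <;>
    simp [leftFactor, cof, Fin.sum_univ_two] <;> field_simp <;> simp only [det] <;> ring

/-- The coefficients of the operator `u ↦ 𝒜[Du]`. -/
noncomputable def symbolMap (A : Mat →L[ℝ] Mat) (k : Fin 2) : E →L[ℝ] RA A :=
  LinearMap.toContinuousLinearMap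
    { toFun := fun x => part A (tens x (EuclideanSpace.single k 1))
      map_add' := fun x y => by
        rw [part, part, part, ← map_add]
        congr 1
        ext p
        simp only [tens, PiLp.add_apply, add_mul]
      map_smul' := fun c x => by
        rw [part, part, RingHom.id_apply, ← map_smul]
        congr 1
        ext p
        simp only [tens, PiLp.smul_apply, smul_eq_mul, mul_assoc] }

theorem symbolMap_apply (k : Fin 2) (x : E) :
    symbolMap A k x = part A (tens x (EuclideanSpace.single k 1)) := rfl

theorem part_tens (v ξ : E) : part A (tens v ξ) = ∑ k, ξ k • symbolMap A k v := by
  simp only [symbolMap_apply, part, ← map_smul, ← map_sum]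
  congr 1
  ext ⟨i, j⟩
  fin_cases j <;> simp [tens, Fin.sum_univ_two, mul_comm]

/-- If the left factors vanish on the kernel of the projection, they do not distinguish Q from its
image, as the two differ by an element of the kernel. So they can be evaluated on the range. When
the kernel is trivial, K = 0 does; otherwise K is built from a matrix that spans it. -/
theorem exists_factorsLaplacian (hA : IsIdempotentElem A) (h : IsCElliptic A) :
    ∃ b : Fin 2 → RA A →L[ℝ] E, FactorsLaplacian (symbolMap A) b := by
  have hK : ∃ K : Fin 2 → Fin 2 → ℝ, ∀ k N, A N = 0 → leftFactor K k N = 0 := by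
    by_cases hker : ∃ M, A M = 0 ∧ M ≠ 0
    · obtain ⟨M, hM, hM0⟩ := hker
      refine ⟨fun i m => (∑ n, M (i, n) * M (m, n)) / det M, fun k N hN => ?_⟩
      obtain ⟨t, rfl⟩ := h.exists_smul_eq hM hM0 hN
      rw [map_smul, leftFactor_self M (h.det_ne_zero hM hM0) k, smul_zero]
    · push Not at hker
      exact ⟨0, fun k N hN => by rw [hker N hN, map_zero]⟩
  obtain ⟨K, hK⟩ := hK
  refine ⟨fun k => LinearMap.toContinuousLinearMap ((leftFactor K k).comp (RA A).subtype),
    fun k l x => ?_⟩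
  have hAA : ∀ Q, leftFactor K k (A Q) = leftFactor K k Q ∧ leftFactor K l (A Q) = leftFactor K l Q :=
    fun Q => by
      have h0 : A (A Q - Q) = 0 := by
        rw [map_sub, sub_eq_zero]
        exact congrArg (fun T : Mat →L[ℝ] Mat => T Q) hA
      constructor
      · rw [← sub_eq_zero, ← map_sub, hK k _ h0]
      · rw [← sub_eq_zero, ← map_sub, hK l _ h0]
  rw [← leftFactor_tens K k l x]
  exact congrArg₂ _ (hAA _).1 (hAA _).2

/-- A space that carries an elliptic system of first order has dimension at least two. -/
theorem FactorsLaplacian.exists_orthogonal {W : Type*} [NormedAddCommGroup W] [InnerProductSpace ℝ W]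
    {a : Fin 2 → E →L[ℝ] W} {b : Fin 2 → W →L[ℝ] E} (hab : FactorsLaplacian a b) (ξ : W) :
    ∃ η : W, ‖η‖ = 1 ∧ inner ℝ ξ η = 0 := by
  have hinj : ∀ x, a 0 x = 0 → x = 0 := fun x hx => by
    have := hab 0 0 x
    simpa [hx] using this.symm
  -- One linear condition on the plane has a nontrivial solution, and `a 0` is injective.
  have hx : ∃ x : E, x ≠ 0 ∧ inner ℝ ξ (a 0 x) = 0 := by
    set e : Fin 2 → E := fun k => EuclideanSpace.single k 1 with he
    by_cases h0 : inner ℝ ξ (a 0 (e 0)) = 0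
    · exact ⟨e 0, fun h => by simpa [he] using congrArg (fun y : E => y 0) h, h0⟩
    · refine ⟨inner ℝ ξ (a 0 (e 0)) • e 1 - inner ℝ ξ (a 0 (e 1)) • e 0, fun h => h0 ?_, ?_⟩
      · simpa [he] using congrArg (fun y : E => y 1) h
      · simp only [map_sub, map_smul, inner_sub_right, inner_smul_right]
        ring
  obtain ⟨x, hx0, hx⟩ := hx
  have hne : ‖a 0 x‖ ≠ 0 := fun h => hx0 (hinj x (norm_eq_zero.1 h))
  refine ⟨‖a 0 x‖⁻¹ • a 0 x, ?_, ?_⟩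
  · rw [norm_smul, norm_inv, norm_norm, inv_mul_cancel₀ hne]
  · rw [inner_smul_right, hx, mul_zero]

end Algebra

end WSO

namespace WSO

open Filter Topology

/-! ### The space `W^{𝔸,1}` -/

section WeakOperators

variable {F F' : Type*} [NormedAddCommGroup F] [NormedSpace ℝ F]
  [NormedAddCommGroup F'] [NormedSpace ℝ F'] {U : Set E} {L : Fin 2 → F →L[ℝ] F'}

theorem locallyIntegrableOn_clm {u : E → F} (hu : LocallyIntegrableOn u U) (T : F →L[ℝ] F') :
    LocallyIntegrableOn (fun x => T (u x)) U := fun x hx => by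
  obtain ⟨s, hs, hi⟩ := hu x hx
  exact ⟨s, hs, T.integrable_comp hi⟩

theorem IsTest.integrable_sum_pd_smul {φ : E → ℝ} (hφ : IsTest U φ) {u : E → F}
    (hu : LocallyIntegrableOn u U) : Integrable fun x => ∑ k, WSO.pd k φ x • L k (u x) :=
  integrable_finsetSum _ fun k _ => (hφ.pd k).integrable_smul_of_locallyIntegrableOn
    (locallyIntegrableOn_clm hu (L k))

theorem WeakOp.add {u u' : E → F} {g g' : E → F'} (h : WeakOp U L u g) (h' : WeakOp U L u' g')
    (hu : LocallyIntegrableOn u U) (hu' : LocallyIntegrableOn u' U) (hg : LocallyIntegrableOn g U)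
    (hg' : LocallyIntegrableOn g' U) : WeakOp U L (fun x => u x + u' x) (fun x => g x + g' x) := by
  intro φ hφ
  simp only [map_add, smul_add, Finset.sum_add_distrib]
  rw [integral_add (hφ.integrable_smul_of_locallyIntegrableOn hg)
      (hφ.integrable_smul_of_locallyIntegrableOn hg'),
    integral_add (hφ.integrable_sum_pd_smul hu) (hφ.integrable_sum_pd_smul hu'), h φ hφ, h' φ hφ]
  abel

theorem WeakOp.const_smul {u : E → F} {g : E → F'} (h : WeakOp U L u g) (c : ℝ) :
    WeakOp U L (fun x => c • u x) (fun x => c • g x) := by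
  intro φ hφ
  simp only [map_smul, smul_comm _ c, ← Finset.smul_sum]
  rw [integral_smul, integral_smul, h φ hφ, smul_neg]

theorem WeakOp.sub {u u' : E → F} {g g' : E → F'} (h : WeakOp U L u g) (h' : WeakOp U L u' g')
    (hu : LocallyIntegrableOn u U) (hu' : LocallyIntegrableOn u' U) (hg : LocallyIntegrableOn g U)
    (hg' : LocallyIntegrableOn g' U) : WeakOp U L (fun x => u x - u' x) (fun x => g x - g' x) := by
  have h1 := h.add (h'.const_smul (-1)) hu (hu'.smul (-1)) hg (hg'.smul (-1))
  simpa only [neg_smul, one_smul, ← sub_eq_add_neg] using h1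

theorem weakOp_gradA {W : Type*} [NormedAddCommGroup W] [InnerProductSpace ℝ W]
    {a : Fin 2 → E →L[ℝ] W} {V : Set E} {u : E → E} (hu : IsTest V u) :
    WeakOp U a u (gradA a u) := by
  intro φ hφ
  have i1 : ∀ k, Integrable fun x => φ x • a k (pd k u x) := fun k =>
    (hφ.smul_left ((a k).contDiff.comp (contDiff_pd hu.1 k))).integrable
  have i2 : ∀ k, Integrable fun x => pd k φ x • a k (u x) := fun k =>
    ((hφ.pd k).smul_left ((a k).contDiff.comp hu.1)).integrable
  simp only [gradA, Finset.smul_sum]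
  rw [integral_finsetSum _ fun k _ => i1 k, integral_finsetSum _ fun k _ => i2 k,
    ← Finset.sum_neg_distrib]
  refine Finset.sum_congr rfl fun k _ => ?_
  have := integral_smul_pd hφ.of_le_one (hu.clm (a k)).of_le_one hφ.2.1 k
  simpa only [pd_clm (a k) (differentiable_of_smooth hu.1 _)] using this

theorem HasWeakPartial.weakOp {Ω : Set E} {k : Fin 2} {W : Type*} [NormedAddCommGroup W]
    [InnerProductSpace ℝ W] {u g : E → W} (h : HasWeakPartial Ω k u g) :
    WeakOp Ω (pdCoeff W k) u g := by
  rw [weakOp_pdCoeff_iff]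
  intro φ hφ
  rw [← hφ.setIntegral_smul, ← (hφ.pd k).setIntegral_smul, h.2.2 φ hφ]

/-- Weak partial derivatives give `∑ₖ aₖ ∂ₖ u`. -/
theorem weakOp_of_hasWeakPartial {Ω : Set E} {W : Type*} [NormedAddCommGroup W]
    [InnerProductSpace ℝ W] [CompleteSpace W] {a : Fin 2 → E →L[ℝ] W} {u : E → E} {g : Fin 2 → E → E}
    (h : ∀ k, HasWeakPartial Ω k u (g k)) : WeakOp Ω a u (fun x => ∑ k, a k (g k x)) := by
  intro φ hφ
  simp only [Finset.smul_sum]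
  rw [integral_finsetSum _ fun k _ => hφ.integrable_smul_of_locallyIntegrableOn
      (locallyIntegrableOn_clm (h k).2.1 (a k)),
    integral_finsetSum _ fun k _ => (hφ.pd k).integrable_smul_of_locallyIntegrableOn
      (locallyIntegrableOn_clm (h k).1 (a k)), ← Finset.sum_neg_distrib]
  refine Finset.sum_congr rfl fun k _ => ?_
  have h1 := congrArg (a k) (weakOp_pdCoeff_iff.1 (h k).weakOp φ hφ)
  rw [map_neg, ← (a k).integral_comp_comm (hφ.integrable_smul_of_locallyIntegrableOn (h k).2.1),
    ← (a k).integral_comp_comm ((hφ.pd k).integrable_smul_of_locallyIntegrableOn (h k).1)] at h1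
  simpa only [map_smul] using h1

end WeakOperators

/-! ### Weak 𝒜-derivatives and the spaces with and without zero boundary values. -/

section SpaceWA

variable {A : Mat →L[ℝ] Mat} {Ω : Set E}

theorem hasWeakA_iff {v : E → E} {P : E → RA A} :
    HasWeakA A Ω v P ↔ LocallyIntegrableOn v Ω ∧ LocallyIntegrableOn P Ω ∧
      WeakOp Ω (symbolMap A) v P := by
  refine and_congr_right fun _ => and_congr_right fun _ => forall₂_congr fun φ hφ => ?_
  have e1 : ∀ x, part A (tens (v x) (gradient φ x)) = ∑ k, pd k φ x • symbolMap A k (v x) := fun x => by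
    simp only [part_tens, gradient_apply_eq_pd]
  have e2 : ∫ x in Ω, part A (tens (v x) (gradient φ x)) =
      ∫ x, ∑ k, pd k φ x • symbolMap A k (v x) := by
    simp only [e1]
    refine setIntegral_eq_integral_of_forall_compl_eq_zero fun x hx => ?_
    simp [(hφ.pd _).eq_zero_of_notMem hx]
  rw [e2, hφ.setIntegral_smul]

theorem HasWeakA.ad {v : E → E} {P : E → RA A} (h : HasWeakA A Ω v P) :
    HasWeakA A Ω v (AD A Ω v) := by
  have hex : ∃ P, HasWeakA A Ω v P := ⟨P, h⟩
  rw [AD, dif_pos hex]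
  exact hex.choose_spec

theorem HasWeakA.ae_eq (hΩ : IsOpen Ω) {v : E → E} {P : E → RA A} (h : HasWeakA A Ω v P) :
    AD A Ω v =ᵐ[volume.restrict Ω] P := by
  have h1 := hasWeakA_iff.1 h
  have h2 := hasWeakA_iff.1 h.ad
  rw [EventuallyEq, ae_restrict_iff' hΩ.measurableSet]
  exact WeakOp.ae_eq hΩ h2.2.2 h1.2.2 h2.2.1 h1.2.1

theorem HasWeakA.sub {v w : E → E} {P Q : E → RA A} (h : HasWeakA A Ω v P) (h' : HasWeakA A Ω w Q) :
    HasWeakA A Ω (v - w) (P - Q) := by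
  rw [hasWeakA_iff] at *
  exact ⟨h.1.sub h'.1, h.2.1.sub h'.2.1, h.2.2.sub h'.2.2 h.1 h'.1 h.2.1 h'.2.1⟩

theorem HasWeakA.add {v w : E → E} {P Q : E → RA A} (h : HasWeakA A Ω v P) (h' : HasWeakA A Ω w Q) :
    HasWeakA A Ω (v + w) (P + Q) := by
  rw [hasWeakA_iff] at *
  exact ⟨h.1.add h'.1, h.2.1.add h'.2.1, h.2.2.add h'.2.2 h.1 h'.1 h.2.1 h'.2.1⟩

theorem IsTest.hasWeakA {φ : E → E} (hφ : IsTest Ω φ) :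
    HasWeakA A Ω φ (WSO.gradA (symbolMap A) φ) :=
  hasWeakA_iff.2 ⟨hφ.integrable.integrableOn.locallyIntegrableOn,
    (IsTest.gradA (a := symbolMap A) hφ).integrable.integrableOn.locallyIntegrableOn, weakOp_gradA hφ⟩

theorem HasWeakA.memWA1 (hΩ : IsOpen Ω) {v : E → E} {P : E → RA A} (h : HasWeakA A Ω v P)
    (hv : IntegrableOn v Ω) (hP : IntegrableOn P Ω) : MemWA1 A Ω v :=
  ⟨hv, h.ad, hP.congr (h.ae_eq hΩ).symm⟩

theorem normWA1_eq (hΩ : IsOpen Ω) {v : E → E} {P : E → RA A} (h : HasWeakA A Ω v P) :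
    normWA1 A Ω v = eLpNorm v 1 (volume.restrict Ω) + eLpNorm P 1 (volume.restrict Ω) := by
  rw [normWA1, eLpNorm_congr_ae (h.ae_eq hΩ)]

theorem IsTest.memWA10 (hΩ : IsOpen Ω) {φ : E → E} (hφ : IsTest Ω φ) : MemWA10 A Ω φ := by
  refine ⟨hφ.hasWeakA.memWA1 hΩ hφ.integrable.integrableOn
      (IsTest.gradA (a := symbolMap A) hφ).integrable.integrableOn,
    fun ε hε => ⟨φ, hφ, ?_⟩⟩
  have h0 : eLpNorm (0 : E → RA A) 1 (volume.restrict Ω) = 0 := eLpNorm_zero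
  rw [normWA1_eq hΩ (hφ.hasWeakA.sub hφ.hasWeakA), sub_self, sub_self, eLpNorm_zero, zero_add]
  exact h0.trans_lt hε

theorem MemWA10.add_test (hΩ : IsOpen Ω) {z φ : E → E} (hz : MemWA10 A Ω z) (hφ : IsTest Ω φ) :
    MemWA10 A Ω (z + φ) := by
  refine ⟨(hz.1.2.1.add hφ.hasWeakA).memWA1 hΩ (hz.1.1.add hφ.integrable.integrableOn)
    (hz.1.2.2.add (IsTest.gradA (a := symbolMap A) hφ).integrable.integrableOn), fun ε hε => ?_⟩
  obtain ⟨ψ, hψ, hlt⟩ := hz.2 ε hε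
  refine ⟨fun x => ψ x + φ x, hψ.add hφ, ?_⟩
  have e : (z + φ - fun x => ψ x + φ x) = z - ψ := by
    funext x
    simp
  rwa [e]

/-- Functions in `W^{𝔸,1}_0`, extended by zero. -/
theorem MemWA10.weakOp_indicator (hΩ : IsOpen Ω) {z : E → E} {Q : E → RA A} (hz : MemWA10 A Ω z)
    (hQ : HasWeakA A Ω z Q) :
    WeakOp Set.univ (symbolMap A) (Ω.indicator z) (Ω.indicator Q) := by
  have hQi : IntegrableOn Q Ω := hz.1.2.2.congr (hQ.ae_eq hΩ)
  have hm := hΩ.measurableSet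
  -- Test functions satisfy the weak identity on the whole plane, and their convergence in the norm
  -- of W^{𝔸,1} is convergence in L¹ of the plane to the extensions by zero. So the identity passes
  -- to the limit and no boundary term appears.
  have hchoose : ∀ n : ℕ, ∃ φ : E → E, IsTest Ω φ ∧
      normWA1 A Ω (z - φ) < ((n : ℝ≥0∞) + 1)⁻¹ := fun n =>
    hz.2 _ (ENNReal.inv_pos.2 (by simp))
  choose φ hφ hφn using hchoose
  have hlim : Tendsto (fun n : ℕ => ((n : ℝ≥0∞) + 1)⁻¹) atTop (𝓝 0) := by
    have h1 := (tendsto_add_atTop_iff_nat 1).2 ENNReal.tendsto_inv_nat_nhds_zero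
    simpa using h1
  have hconv : Tendsto (fun n => normWA1 A Ω (z - φ n)) atTop (𝓝 0) :=
    tendsto_of_tendsto_of_tendsto_of_le_of_le tendsto_const_nhds hlim (fun _ => zero_le)
      fun n => (hφn n).le
  have hN := fun n => normWA1_eq hΩ (hQ.sub (hφ n).hasWeakA)
  have hind : ∀ {H : Type} [NormedAddCommGroup H] {X : E → H} {Y : E → H},
      (∀ x, x ∉ Ω → X x = 0) → eLpNorm (fun x => X x - Ω.indicator Y x) 1 =
        eLpNorm (Y - X) 1 (volume.restrict Ω) := fun {H} _ {X Y} hX => by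
    rw [← eLpNorm_indicator_eq_eLpNorm_restrict hm, ← eLpNorm_neg]
    congr 1
    funext x
    by_cases hx : x ∈ Ω
    · simp [Set.indicator_of_mem hx]
    · simp [Set.indicator_of_notMem hx, hX x hx]
  have t1 : LpTendsto 1 φ (Ω.indicator z) := by
    refine ⟨fun n => (hφ n).memLp 1,
      memLp_one_iff_integrable.2 ((integrable_indicator_iff hm).2 hz.1.1), ?_⟩
    refine tendsto_of_tendsto_of_tendsto_of_le_of_le tendsto_const_nhds hconv (fun _ => zero_le)
      fun n => ?_
    simp only
    rw [hind fun x hx => (hφ n).eq_zero_of_notMem hx, hN]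
    exact le_self_add
  have t2 : LpTendsto 1 (fun n => gradA (symbolMap A) (φ n)) (Ω.indicator Q) := by
    refine ⟨fun n => (hφ n).gradA.memLp 1,
      memLp_one_iff_integrable.2 ((integrable_indicator_iff hm).2 hQi), ?_⟩
    refine tendsto_of_tendsto_of_tendsto_of_le_of_le tendsto_const_nhds hconv (fun _ => zero_le)
      fun n => ?_
    simp only
    rw [hind fun x hx => (hφ n).gradA.eq_zero_of_notMem hx, hN]
    exact le_add_of_nonneg_left zero_le
  intro ψ hψ
  obtain ⟨C, _, hC⟩ := hψ.bounded
  have hC1 := fun k => (hψ.pd k).bounded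
  choose C1 _ hC1 using hC1
  have l1 := (t2.smul hψ.continuous.aestronglyMeasurable hC).tendsto_integral
  have l2 := (LpTendsto.sum le_rfl Finset.univ fun k => (t1.clm (symbolMap A k)).smul
    (hψ.pd k).continuous.aestronglyMeasurable (hC1 k)).tendsto_integral.neg
  refine tendsto_nhds_unique l1 (l2.congr fun n => ?_)
  exact (weakOp_gradA (hφ n) ψ hψ).symm

end SpaceWA

end WSO

namespace WSO

open Filter Topology

/-! ### Gradient bounds for mollifications -/

section GradientBound

variable {W : Type*} [NormedAddCommGroup W] [InnerProductSpace ℝ W] [FiniteDimensional ℝ W]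
  {Ω : Set E} {a : Fin 2 → E →L[ℝ] W} {b : Fin 2 → W →L[ℝ] E}

theorem isTest_moll (hb : Bornology.IsBounded Ω) {z : E → E} (hz : Integrable z)
    (hz0 : ∀ x, x ∉ Ω → z x = 0) (n : ℕ) : IsTest Set.univ (moll n z) := by
  have hK : IsCompact (Metric.cthickening 1 (closure Ω)) :=
    (Metric.isCompact_of_isClosed_isBounded isClosed_closure hb.closure).cthickening
  refine IsTest.of_compact (contDiff_moll n hz.locallyIntegrable) hK (Set.subset_univ _)
    fun x hx => moll_eq_zero fun t ht => hz0 t fun htΩ => hx ?_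
  refine Metric.mem_cthickening_of_dist_le x t _ _ (subset_closure htΩ) ?_
  rw [dist_comm]
  exact (Metric.mem_ball.1 ht).le.trans (bumpSeq_rOut_le n)

/-- Korn's inequality is at hand only for compactly supported fields. It is applied to
mollifications of the part `z` with zero boundary values, which satisfies its weak equation across
the boundary; the gradient of the other part `u` is square integrable by assumption. -/
theorem FactorsLaplacian.exists_grad_bound (hab : FactorsLaplacian a b)
    (hΩ : IsOpen Ω) (hb : Bornology.IsBounded Ω) {z u : E → E} {Q : E → W} {g : Fin 2 → E → E}
    (hz : Integrable z) (hz0 : ∀ x, x ∉ Ω → z x = 0) (hzw : WeakOp Set.univ a z Q) (hQ : MemLp Q 2)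
    (hu : Integrable u) (hg : ∀ k, MemLp (g k) 2) (hgw : ∀ k, WeakOp Ω (pdCoeff E k) u (g k))
    {K : Set E} (hK : IsCompact K) (hKΩ : K ⊆ Ω) :
    ∃ C : ℝ, 0 ≤ C ∧ ∀ k, ∀ᶠ n in atTop, ∫ x in K, ‖pd k (moll n (z + u)) x‖ ^ 2 ≤ C := by
  set B := ∑ k, ‖b k‖ ^ 2 with hB
  have hB0 : 0 ≤ B := Finset.sum_nonneg fun k _ => sq_nonneg _
  have hn : ∀ k, 0 ≤ ∫ x, ‖g k x‖ ^ 2 := fun k => integral_nonneg fun x => sq_nonneg _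
  have hzl := hz.locallyIntegrable
  have hul := hu.locallyIntegrable
  refine ⟨2 * (B * ((∫ x, ‖Q x‖ ^ 2) + 1)) + 2 * ∑ k, ((∫ x, ‖g k x‖ ^ 2) + 1), ?_, fun k => ?_⟩
  · have h1 : 0 ≤ ∫ x, ‖Q x‖ ^ 2 := integral_nonneg fun x => sq_nonneg _
    have h2 : 0 ≤ ∑ k, ((∫ x, ‖g k x‖ ^ 2) + 1) :=
      Finset.sum_nonneg fun k _ => by linarith [hn k]
    positivity
  obtain ⟨δ, hδ, hδΩ⟩ := hK.exists_cthickening_subset_open hΩ hKΩ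
  have t1 := (lpTendsto_moll (by norm_num) (by norm_num) hQ).tendsto_integral_norm_sq
  have t2 := (lpTendsto_moll (by norm_num) (by norm_num) (hg k)).tendsto_integral_norm_sq
  filter_upwards [t1.eventually (gt_mem_nhds (lt_add_one _)),
    t2.eventually (gt_mem_nhds (lt_add_one _)),
    tendsto_bumpSeq_rOut.eventually (gt_mem_nhds hδ)] with n h1 h2 h3
  have hzt := isTest_moll hb hz hz0 n
  have hzQ : ∀ x, gradA a (moll n z) x = moll n Q x := fun x => hzw.moll_eq hzl (Set.subset_univ _)
  have hkorn := hab.korn hzt k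
  simp only [hzQ] at hkorn
  have hug : ∀ x ∈ K, pd k (moll n u) x = moll n (g k) x := fun x hx => by
    have := (hgw k).moll_eq hul (n := n) (x := x) fun y hy => hδΩ
      (Metric.mem_cthickening_of_dist_le y x _ _ hx ((Metric.mem_closedBall.1 hy).trans h3.le))
    rwa [sum_pdCoeff] at this
  have hsum : ∀ x, pd k (moll n (z + u)) x = pd k (moll n z) x + pd k (moll n u) x := fun x => by
    rw [moll_add n hzl hul]
    exact pd_add (differentiable_of_smooth hzt.1 x)
      (differentiable_of_smooth (contDiff_moll n hul) x) k
  have i1 : Integrable fun x => ‖pd k (moll n z) x‖ ^ 2 := integrable_norm_sq ((hzt.pd k).memLp 2)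
  have i2 : Integrable fun x => ‖moll n (g k) x‖ ^ 2 :=
    integrable_norm_sq (memLp_moll n (by norm_num) (by norm_num) (hg k))
  have hle : ∫ x in K, ‖pd k (moll n (z + u)) x‖ ^ 2 ≤
      ∫ x in K, (2 * ‖pd k (moll n z) x‖ ^ 2 + 2 * ‖moll n (g k) x‖ ^ 2) := by
    refine integral_mono_of_nonneg (Eventually.of_forall fun x => sq_nonneg _)
      ((i1.const_mul 2).add (i2.const_mul 2)).integrableOn ?_
    refine (ae_restrict_iff' hK.measurableSet).2 (Eventually.of_forall fun x hx => ?_)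
    simp only [hsum, hug x hx]
    have h4 := norm_add_le (pd k (moll n z) x) (moll n (g k) x)
    have h5 := pow_le_pow_left₀ (norm_nonneg _) h4 2
    nlinarith [sq_nonneg (‖pd k (moll n z) x‖ - ‖moll n (g k) x‖)]
  have hle2 : ∫ x in K, (2 * ‖pd k (moll n z) x‖ ^ 2 + 2 * ‖moll n (g k) x‖ ^ 2) ≤
      ∫ x, (2 * ‖pd k (moll n z) x‖ ^ 2 + 2 * ‖moll n (g k) x‖ ^ 2) :=
    setIntegral_le_integral ((i1.const_mul 2).add (i2.const_mul 2))
      (Eventually.of_forall fun x => by positivity)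
  rw [integral_add (i1.const_mul 2) (i2.const_mul 2), integral_const_mul, integral_const_mul] at hle2
  have h6 : B * ∫ x, ‖moll n Q x‖ ^ 2 ≤ B * ((∫ x, ‖Q x‖ ^ 2) + 1) :=
    mul_le_mul_of_nonneg_left h1.le hB0
  have h7 : (∫ x, ‖g k x‖ ^ 2) + 1 ≤ ∑ k, ((∫ x, ‖g k x‖ ^ 2) + 1) :=
    Finset.single_le_sum (f := fun k => (∫ x, ‖g k x‖ ^ 2) + 1)
      (fun k _ => by linarith [hn k]) (Finset.mem_univ k)
  linarith

end GradientBound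

/-! ### The regularised integrand -/

section RegularisedIntegrand

variable {W : Type*} [NormedAddCommGroup W] [InnerProductSpace ℝ W]

theorem contDiff_add_norm_sq {f : W → ℝ} (hf : ContDiff ℝ 2 f) (s : ℝ) :
    ContDiff ℝ 2 fun P => f P + s * (1 + ‖P‖ ^ 2) :=
  hf.add (contDiff_const.mul (contDiff_const.add (contDiff_norm_sq ℝ)))

theorem fderiv_add_norm_sq {f : W → ℝ} (hf : ContDiff ℝ 2 f) (s : ℝ) :
    fderiv ℝ (fun P => f P + s * (1 + ‖P‖ ^ 2)) = fun P => fderiv ℝ f P + (2 * s) • innerSL ℝ P := by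
  funext P
  have h := (hf.differentiable two_ne_zero P).hasFDerivAt.add
    (((hasStrictFDerivAt_norm_sq P).hasFDerivAt.const_add 1).const_mul s)
  refine (h.fderiv).trans ?_
  ext ξ
  simp
  ring

theorem fderiv_fderiv_add_norm_sq {f : W → ℝ} (hf : ContDiff ℝ 2 f) (s : ℝ) (P ξ : W) :
    fderiv ℝ (fderiv ℝ fun P => f P + s * (1 + ‖P‖ ^ 2)) P ξ ξ =
      fderiv ℝ (fderiv ℝ f) P ξ ξ + 2 * s * ‖ξ‖ ^ 2 := by
  rw [fderiv_add_norm_sq hf]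
  set J : W →L[ℝ] W →L[ℝ] ℝ := innerSL ℝ with hJ
  have h : HasFDerivAt (fun P => fderiv ℝ f P + (2 * s) • J P)
      (fderiv ℝ (fderiv ℝ f) P + (2 * s) • J) P :=
    ((contDiff_fderiv hf).differentiable one_ne_zero P).hasFDerivAt.add (J.hasFDerivAt.const_smul (2 * s))
  have e : (fun P => fderiv ℝ f P + (2 * s) • innerSL ℝ P) = fun P => fderiv ℝ f P + (2 * s) • J P :=
    rfl
  have hξ : J ξ ξ = ‖ξ‖ ^ 2 := real_inner_self_eq_norm_sq ξ
  rw [e, h.fderiv]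
  simp only [_root_.add_apply, _root_.smul_apply, smul_eq_mul, hξ]

theorem hasLinearGrowthBounds_add_norm_sq {f : W → ℝ} {Λ s : ℝ} (hΛ : 0 < Λ) (hs : 0 < s)
    (hf : ContDiff ℝ 2 f)
    (hH : ∀ P ξ, 0 ≤ fderiv ℝ (fderiv ℝ f) P ξ ξ ∧
      fderiv ℝ (fderiv ℝ f) P ξ ξ ≤ Λ * (‖ξ‖ ^ 2 / Real.sqrt (1 + ‖P‖ ^ 2)))
    (hdim : ∀ ξ : W, ∃ η : W, ‖η‖ = 1 ∧ inner ℝ ξ η = 0) :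
    HasLinearGrowthBounds Λ (2 * s) fun P => f P + s * (1 + ‖P‖ ^ 2) := by
  refine ⟨contDiff_add_norm_sq hf s, by positivity, fun P ξ => ?_, fun P ξ => ?_, fun P => ?_⟩
  · rw [fderiv_fderiv_add_norm_sq hf]
    linarith [(hH P ξ).1]
  · rw [fderiv_fderiv_add_norm_sq hf]
    have e : (Λ / Real.sqrt (1 + ‖P‖ ^ 2) + 2 * s) * ‖ξ‖ ^ 2 =
        Λ * (‖ξ‖ ^ 2 / Real.sqrt (1 + ‖P‖ ^ 2)) + 2 * s * ‖ξ‖ ^ 2 := by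
      ring
    rw [e]
    linarith [(hH P ξ).2]
  · have h1 := norm_fderiv_sub_fderiv_zero_le hΛ.le hf (fun P ξ => (hH P ξ).1)
      (fun P ξ => (hH P ξ).2) hdim P
    rw [fderiv_add_norm_sq hf]
    simp only [map_zero, smul_zero, add_zero]
    have e : fderiv ℝ f P + (2 * s) • innerSL ℝ P - fderiv ℝ f 0 =
        (fderiv ℝ f P - fderiv ℝ f 0) + (2 * s) • innerSL ℝ P := by
      abel
    rw [e]
    refine (norm_add_le _ _).trans (add_le_add h1 ?_)
    rw [norm_smul, innerSL_apply_norm, Real.norm_of_nonneg (by positivity)]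

variable {A : Mat →L[ℝ] Mat} {f : RA A → ℝ} {Λ c : ℝ} {j : ℕ}

/-- The Hessian of s|P|² is 2s times the identity; with s = 1/(2cj²) this gives ε = 1/(cj²). -/
theorem IsAdmissible.hasLinearGrowthBounds (hf : IsAdmissible Λ f) (hΛ : 0 < Λ) (hc : 0 < c)
    (hj : 1 ≤ j) (hdim : ∀ ξ : RA A, ∃ η : RA A, ‖η‖ = 1 ∧ inner ℝ ξ η = 0) :
    HasLinearGrowthBounds Λ (1 / (c * (j : ℝ) ^ 2)) (regIntegrand f c j) := by
  have hj' : (0 : ℝ) < j := by exact_mod_cast hj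
  have h := hasLinearGrowthBounds_add_norm_sq hΛ (s := 1 / (2 * c * (j : ℝ) ^ 2)) (by positivity)
    hf.contDiff hf.hess hdim
  have e : 2 * (1 / (2 * c * (j : ℝ) ^ 2)) = 1 / (c * (j : ℝ) ^ 2) := by
    field_simp
  rw [e] at h
  exact h

theorem IsAdmissible.nonneg (hf : IsAdmissible Λ f) (P : RA A) : 0 ≤ f P := by
  obtain ⟨c₁, c₂, h1, -, h⟩ := hf.growth
  exact (mul_nonneg h1.le (norm_nonneg P)).trans (h P).1

theorem le_regIntegrand (hf : IsAdmissible Λ f) (P : RA A) :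
    1 / (2 * c * (j : ℝ) ^ 2) * (1 + ‖P‖ ^ 2) ≤ regIntegrand f c j P :=
  le_add_of_nonneg_left (hf.nonneg P)

theorem regIntegrand_nonneg (hf : IsAdmissible Λ f) (hc : 0 < c) (P : RA A) :
    0 ≤ regIntegrand f c j P :=
  add_nonneg (hf.nonneg P) (by positivity)

theorem integrableOn_regIntegrand {Ω : Set E} (hb : Bornology.IsBounded Ω) (hf : IsAdmissible Λ f)
    (hc : 0 < c) {Q : E → RA A} (hQ : MemLp Q 2 (volume.restrict Ω)) :
    IntegrableOn (fun x => regIntegrand f c j (Q x)) Ω := by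
  obtain ⟨c₁, c₂, h1, h2, h⟩ := hf.growth
  have : IsFiniteMeasure (volume.restrict Ω) := ⟨by simpa using hb.measure_lt_top⟩
  have i1 : Integrable (fun x => ‖Q x‖) (volume.restrict Ω) := (hQ.integrable (by norm_num)).norm
  have i2 := integrable_norm_sq hQ
  have hcont : Continuous (regIntegrand f c j) := (contDiff_add_norm_sq hf.contDiff _).continuous
  refine Integrable.mono' ((((integrable_const 1).add i1).const_mul c₂).add
    (((integrable_const 1).add i2).const_mul (1 / (2 * c * (j : ℝ) ^ 2))))
    (hcont.comp_aestronglyMeasurable hQ.1) (Eventually.of_forall fun x => ?_)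
  rw [Real.norm_of_nonneg (regIntegrand_nonneg hf hc _)]
  exact add_le_add (h _).2 le_rfl

theorem energy_eq_ofReal {Ω : Set E} (hb : Bornology.IsBounded Ω)
    (hf : IsAdmissible Λ f) (hc : 0 < c) {w : E → E} {Q : E → RA A}
    (hw : AD A Ω w =ᵐ[volume.restrict Ω] Q) (hQ : MemLp Q 2 (volume.restrict Ω)) :
    energy A Ω (regIntegrand f c j) w = ENNReal.ofReal (∫ x in Ω, regIntegrand f c j (Q x)) := by
  rw [ofReal_integral_eq_lintegral_ofReal (integrableOn_regIntegrand hb hf hc hQ)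
    (Eventually.of_forall fun x => regIntegrand_nonneg hf hc _)]
  exact lintegral_congr_ae (hw.mono fun x hx => by simp only [hx])

/-- Since f ≥ 0, the regularised integrand dominates a positive multiple of |P|². -/
theorem memLp_of_energy_lt_top {Ω : Set E} (hf : IsAdmissible Λ f) (hc : 0 < c) (hj : 1 ≤ j)
    {w : E → E} (hm : AEStronglyMeasurable (AD A Ω w) (volume.restrict Ω))
    (h : energy A Ω (regIntegrand f c j) w < ⊤) : MemLp (AD A Ω w) 2 (volume.restrict Ω) := by
  have hj' : (0 : ℝ) < j := by exact_mod_cast hj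
  rw [memLp_two_iff_integrable_sq_norm hm]
  refine ⟨hm.norm.pow 2, ?_⟩
  set s := 1 / (2 * c * (j : ℝ) ^ 2) with hs
  have hs0 : 0 < s := by positivity
  refine lt_of_le_of_lt (b := ENNReal.ofReal s⁻¹ * energy A Ω (regIntegrand f c j) w) ?_
    (ENNReal.mul_lt_top ENNReal.ofReal_lt_top h)
  rw [energy, ← lintegral_const_mul' _ _ ENNReal.ofReal_ne_top]
  refine lintegral_mono fun x => ?_
  rw [← ENNReal.ofReal_mul (inv_nonneg.2 hs0.le), Real.enorm_of_nonneg (sq_nonneg _)]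
  refine ENNReal.ofReal_le_ofReal ?_
  rw [inv_mul_eq_div, le_div_iff₀ hs0]
  have := le_regIntegrand (c := c) (j := j) hf (AD A Ω w x)
  rw [← hs] at this
  linarith

end RegularisedIntegrand

end WSO

namespace WSO

open Filter Topology

/-! ### Ekeland points are almost solutions -/

section Ekeland

theorem negSobNorm_const_smul_le {F : Type*} [NormedAddCommGroup F] [NormedSpace ℝ F] {k : ℕ}
    {Ω : Set E} {c : ℝ} (hc : c ≠ 0) (φ : E → F) :
    negSobNorm k Ω (fun x => c • φ x) ≤ ENNReal.ofReal |c| * negSobNorm k Ω φ := by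
  have h0 : ENNReal.ofReal |c| ≠ 0 := by
    rw [Ne, ENNReal.ofReal_eq_zero, not_le]
    exact abs_pos.2 hc
  unfold negSobNorm
  rw [ENNReal.mul_iInf_of_ne h0 ENNReal.ofReal_ne_top]
  refine le_iInf fun T => ?_
  rw [ENNReal.mul_iInf_of_ne h0 ENNReal.ofReal_ne_top]
  refine le_iInf fun hT => (iInf₂_le (fun α x => c • T α x) ⟨hT.1.smul c, fun α hα =>
    (hT.2.1 α hα).smul c, fun ψ hψ => ?_⟩).trans (le_of_eq ?_)
  · rw [Finset.mul_sum]
    refine Finset.sum_congr rfl fun α _ => ?_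
    rw [← Real.enorm_eq_ofReal_abs]
    exact eLpNorm_const_smul c (T α) 1 _
  · simp only [smul_comm _ c]
    rw [integral_smul, hT.2.2 ψ hψ, Finset.smul_sum]
    refine Finset.sum_congr rfl fun α _ => ?_
    rw [integral_smul, smul_comm]

/-- Dividing by |t| for both signs of t and letting t → 0. The penalty is of first order in t, so in
place of I = 0 only an inequality results. -/
theorem abs_le_of_forall_perturbation {I C M : ℝ}
    (h : ∀ t : ℝ, t ≠ 0 → 0 ≤ t * I + C * t ^ 2 + |t| * M) : |I| ≤ M := by
  have hC : ∀ s : ℝ, 0 < s → |I| ≤ M + C * s := fun s hs => by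
    rw [abs_le]
    have h1 := h s hs.ne'
    have h2 := h (-s) (neg_ne_zero.2 hs.ne')
    rw [abs_neg, abs_of_pos hs] at h2
    rw [abs_of_pos hs] at h1
    have e1 : s * I + C * s ^ 2 + s * M = s * (I + C * s + M) := by ring
    have e2 : -s * I + C * (-s) ^ 2 + s * M = s * (-I + C * s + M) := by ring
    rw [e1] at h1
    rw [e2] at h2
    have h1' := nonneg_of_mul_nonneg_right h1 hs
    have h2' := nonneg_of_mul_nonneg_right h2 hs
    constructor <;> linarith
  have ht : Tendsto (fun s : ℝ => M + C * s) (𝓝[>] 0) (𝓝 M) := by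
    have : Tendsto (fun s : ℝ => M + C * s) (𝓝 0) (𝓝 (M + C * 0)) :=
      (continuous_const.add (continuous_const.mul continuous_id)).tendsto 0
    rw [mul_zero, add_zero] at this
    exact this.mono_left nhdsWithin_le_nhds
  exact ge_of_tendsto ht (eventually_nhdsWithin_of_forall fun s hs => hC s hs)

theorem gradA_const_smul {W : Type*} [NormedAddCommGroup W] [InnerProductSpace ℝ W]
    {a : Fin 2 → E →L[ℝ] W} {φ : E → E} (hφ : ContDiff ℝ ∞ φ) (t : ℝ) (x : E) :
    gradA a (fun y => t • φ y) x = t • gradA a φ x := by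
  simp only [gradA, pd_const_smul t (differentiable_of_smooth hφ x), map_smul, Finset.smul_sum]

/-- This allows the constant Dg(0) to be subtracted from the stress. -/
theorem integral_clm_gradA {W : Type*} [NormedAddCommGroup W] [InnerProductSpace ℝ W]
    {a : Fin 2 → E →L[ℝ] W} {Ω : Set E} {φ : E → E} (hφ : IsTest Ω φ) (T : W →L[ℝ] ℝ) :
    ∫ x, T (gradA a φ x) = 0 := by
  simp only [gradA, map_sum]
  rw [integral_finsetSum _ fun k _ => (((hφ.pd k).clm (a k)).clm T).integrable]
  refine Finset.sum_eq_zero fun k _ => ?_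
  rw [← integral_pd_eq_zero ((hφ.clm (a k)).clm T).of_le_one ((hφ.clm (a k)).clm T).2.1 k]
  refine integral_congr_ae (Eventually.of_forall fun x => ?_)
  simp only
  rw [pd_clm T (differentiable_of_smooth (hφ.clm (a k)).1 x),
    pd_clm (a k) (differentiable_of_smooth hφ.1 x)]

theorem setIntegral_fderiv_gradA {W : Type*} [NormedAddCommGroup W] [InnerProductSpace ℝ W]
    {a : Fin 2 → E →L[ℝ] W} {g : W → ℝ} {lam L : ℝ} {Ω : Set E} (hm : MeasurableSet Ω)
    (hg : HasHessBounds lam L g) {P : E → W} (hP : MemLp P 2 (volume.restrict Ω)) {φ : E → E}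
    (hφ : IsTest Ω φ) :
    IntegrableOn (fun x => fderiv ℝ g (P x) (gradA a φ x)) Ω ∧
    ∫ x in Ω, fderiv ℝ g (P x) (gradA a φ x) =
      ∫ x, (fderiv ℝ g (Ω.indicator P x) - fderiv ℝ g 0) (gradA a φ x) := by
  set X := gradA a φ with hX
  have hXt : IsTest Ω X := hφ.gradA
  have hσm : MemLp (fun x => fderiv ℝ g (Ω.indicator P x) - fderiv ℝ g 0) 2 :=
    memLp_stress hg ((memLp_indicator_iff_restrict hm).2 hP)
  have iσ : Integrable fun x => (fderiv ℝ g (Ω.indicator P x) - fderiv ℝ g 0) (X x) :=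
    integrable_bilin (ContinuousLinearMap.id ℝ (W →L[ℝ] ℝ)) hσm (hXt.memLp 2)
  have i0 : Integrable fun x => fderiv ℝ g 0 (X x) := (hXt.clm (fderiv ℝ g 0)).integrable
  have eσ : ∀ x, fderiv ℝ g (Ω.indicator P x) (X x) =
      (fderiv ℝ g (Ω.indicator P x) - fderiv ℝ g 0) (X x) + fderiv ℝ g 0 (X x) := fun x => by
    simp
  have iD : Integrable fun x => fderiv ℝ g (Ω.indicator P x) (X x) := by
    simp only [eσ]
    exact iσ.add i0
  refine ⟨iD.integrableOn.congr_fun (fun x hx => by simp only [Set.indicator_of_mem hx]) hm, ?_⟩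
  have e1 : ∫ x in Ω, fderiv ℝ g (P x) (X x) = ∫ x in Ω, fderiv ℝ g (Ω.indicator P x) (X x) :=
    setIntegral_congr_fun hm fun x hx => by simp only [Set.indicator_of_mem hx]
  rw [e1, setIntegral_eq_integral_of_forall_compl_eq_zero fun x hx => by
    rw [hXt.eq_zero_of_notMem hx, map_zero]]
  simp only [eσ]
  rw [integral_add iσ i0, integral_clm_gradA hφ, add_zero]

variable {A : Mat →L[ℝ] Mat} {Ω : Set E} {f : RA A → ℝ} {Λ c : ℝ} {j : ℕ}
  {b : Fin 2 → RA A →L[ℝ] E} {ub v : E → E}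

theorem regEnergy_of_mem (h : v ∈ dirichletClass A Ω ub) :
    regEnergy A Ω f c j ub v = energy A Ω (regIntegrand f c j) v := if_pos h

theorem mem_dirichletClass_of_regEnergy_lt_top (h : regEnergy A Ω f c j ub v < ⊤) :
    v ∈ dirichletClass A Ω ub := by
  by_contra hv
  rw [regEnergy, if_neg hv] at h
  exact lt_irrefl _ h

theorem MemW12.exists_hasWeakA (hu : MemW12 Ω ub) :
    ∃ (g : Fin 2 → E → E) (U : E → RA A), (∀ k, MemLp (g k) 2 (volume.restrict Ω)) ∧
      (∀ k, HasWeakPartial Ω k ub (g k)) ∧ MemLp U 2 (volume.restrict Ω) ∧ HasWeakA A Ω ub U := by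
  choose g hg hgw using hu.2
  have hU : ∀ k, MemLp (fun x => symbolMap A k (g k x)) 2 (volume.restrict Ω) := fun k =>
    (symbolMap A k).comp_memLp' (hg k)
  refine ⟨g, fun x => ∑ k, symbolMap A k (g k x), hg, hgw, memLp_finsetSum _ fun k _ => hU k,
    hasWeakA_iff.2 ⟨(hgw 0).1, ?_, weakOp_of_hasWeakPartial hgw⟩⟩
  have h := (locallyIntegrableOn_clm (hgw 0).2.1 (symbolMap A 0)).add
    (locallyIntegrableOn_clm (hgw 1).2.1 (symbolMap A 1))
  simp only [Fin.sum_univ_two]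
  exact h

/-- The Euler-Lagrange inequality at an Ekeland point. -/
theorem abs_integral_stress_le (hΩ : IsOpen Ω) (hb : Bornology.IsBounded Ω) (hf : IsAdmissible Λ f)
    (hΛ : 0 < Λ) (hc : 0 < c) (hg : HasLinearGrowthBounds Λ (1 / (c * (j : ℝ) ^ 2)) (regIntegrand f c j))
    (hv : v ∈ dirichletClass A Ω ub) (hvA : MemWA1 A Ω v)
    (hv2 : MemLp (AD A Ω v) 2 (volume.restrict Ω))
    (hmin : ∀ w : E → E, regEnergy A Ω f c j ub v ≤
      regEnergy A Ω f c j ub w + ENNReal.ofReal (1 / (j : ℝ)) * negSobNorm 2 Ω (v - w))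
    {φ : E → E} {N : ℝ} (hφ : IsTest Ω φ) (hN : 0 ≤ N) (hφN : negSobNorm 2 Ω φ ≤ ENNReal.ofReal N) :
    |∫ x, (fderiv ℝ (regIntegrand f c j) (Ω.indicator (AD A Ω v) x) -
      fderiv ℝ (regIntegrand f c j) 0) (gradA (symbolMap A) φ x)| ≤ 1 / (j : ℝ) * N := by
  set g := regIntegrand f c j with hgdef
  set P := AD A Ω v with hP
  set X := gradA (symbolMap A) φ with hX
  have hXt : IsTest Ω X := hφ.gradA
  have hm := hΩ.measurableSet
  have hgb := hg.hasHessBounds hΛ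
  have hX2 : MemLp X 2 (volume.restrict Ω) := (hXt.memLp 2).restrict Ω
  have hj0 : (0 : ℝ) ≤ 1 / (j : ℝ) := by positivity
  obtain ⟨iD', eI⟩ := setIntegral_fderiv_gradA (a := symbolMap A) hm hgb hv2 hφ
  rw [← hX] at iD' eI
  have iX : IntegrableOn (fun x => ‖X x‖ ^ 2) Ω := integrable_norm_sq hX2
  rw [← eI]
  -- The competitors are v + tφ, which stay in the Dirichlet class. The constant C is the second
  -- order Taylor remainder, with the upper Hessian bound Λ + ε for the regularised integrand.
  refine abs_le_of_forall_perturbation (C := (Λ + 1 / (c * (j : ℝ) ^ 2)) * ∫ x in Ω, ‖X x‖ ^ 2)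
    fun t ht => ?_
  have htφ := hφ.const_smul t
  set w : E → E := v + fun x => t • φ x with hw
  have hwc : w ∈ dirichletClass A Ω ub := by
    have h1 : w - ub = (v - ub) + fun x => t • φ x := by
      rw [hw]
      abel
    rw [dirichletClass, Set.mem_ofPred_eq, h1]
    exact MemWA10.add_test hΩ hv htφ
  have hgr : gradA (symbolMap A) (fun x => t • φ x) = fun x => t • X x :=
    funext fun x => gradA_const_smul hφ.1 t x
  have hwA : HasWeakA A Ω w (P + fun x => t • X x) := by
    rw [← hgr]
    exact hvA.2.1.add htφ.hasWeakA
  have hQ2 : MemLp (P + fun x => t • X x) 2 (volume.restrict Ω) := hv2.add (hX2.const_smul t)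
  have hE := hmin w
  rw [regEnergy_of_mem hv, regEnergy_of_mem hwc,
    energy_eq_ofReal hb hf hc (hwA.ae_eq hΩ) hQ2,
    energy_eq_ofReal hb hf hc (Filter.EventuallyEq.rfl) hv2] at hE
  have hvw : v - w = fun x => (-t) • φ x := by
    funext x
    simp [hw]
  have hneg : negSobNorm 2 Ω (v - w) ≤ ENNReal.ofReal (|t| * N) := by
    rw [hvw, ENNReal.ofReal_mul (abs_nonneg t)]
    refine (negSobNorm_const_smul_le (neg_ne_zero.2 ht) φ).trans ?_
    rw [abs_neg]
    exact mul_le_mul_right hφN _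
  have hnn : ∀ Q : E → RA A, 0 ≤ ∫ x in Ω, g (Q x) := fun Q =>
    integral_nonneg fun x => regIntegrand_nonneg hf hc _
  have hE2 : ∫ x in Ω, g (P x) ≤ (∫ x in Ω, g ((P + fun x => t • X x) x)) + 1 / (j : ℝ) * (|t| * N) := by
    have h3 := hE.trans (add_le_add le_rfl (mul_le_mul_right hneg (ENNReal.ofReal (1 / (j : ℝ)))))
    rw [← ENNReal.ofReal_mul hj0, ← ENNReal.ofReal_add (hnn _) (by positivity)] at h3
    exact (ENNReal.ofReal_le_ofReal_iff (add_nonneg (hnn _) (by positivity))).1 h3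
  have iP : IntegrableOn (fun x => g (P x)) Ω := integrableOn_regIntegrand hb hf hc hv2
  have hT : ∫ x in Ω, g ((P + fun x => t • X x) x) ≤
      ∫ x in Ω, (g (P x) + t * fderiv ℝ g (P x) (X x) +
        (Λ + 1 / (c * (j : ℝ) ^ 2)) * (t ^ 2 * ‖X x‖ ^ 2)) := by
    refine integral_mono (integrableOn_regIntegrand hb hf hc hQ2)
      ((iP.add (iD'.const_mul t)).add ((iX.const_mul (t ^ 2)).const_mul _)) fun x => ?_
    have := hgb.le_taylor (P x) (t • X x)
    rw [map_smul, norm_smul, mul_pow, Real.norm_eq_abs, sq_abs] at this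
    exact this
  rw [integral_add (Integrable.fun_add iP (iD'.const_mul t)) ((iX.const_mul (t ^ 2)).const_mul _),
    integral_add iP (iD'.const_mul t), integral_const_mul, integral_const_mul, integral_const_mul] at hT
  linarith

/-- An Ekeland point of the regularised functional is an almost solution of its Euler-Lagrange
system. -/
theorem isAlmostSolution_of_ekeland (hΩ : IsOpen Ω) (hb : Bornology.IsBounded Ω)
    (hab : FactorsLaplacian (symbolMap A) b) (hf : IsAdmissible Λ f) (hΛ : 0 < Λ) (hc : 0 < c)
    (hj : 1 ≤ j) (hub : MemW12 Ω ub) (hfin : regEnergy A Ω f c j ub v < ⊤)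
    (hmin : ∀ w : E → E, regEnergy A Ω f c j ub v ≤
      regEnergy A Ω f c j ub w + ENNReal.ofReal (1 / (j : ℝ)) * negSobNorm 2 Ω (v - w)) :
    MemWA1 A Ω v ∧ MemLp (AD A Ω v) 2 (volume.restrict Ω) ∧
      IsAlmostSolution Ω (symbolMap A) (regIntegrand f c j) (1 / (j : ℝ)) (Ω.indicator v)
        (Ω.indicator (AD A Ω v)) := by
  have hm := hΩ.measurableSet
  have : IsFiniteMeasure (volume.restrict Ω) := ⟨by simpa using hb.measure_lt_top⟩
  have hv := mem_dirichletClass_of_regEnergy_lt_top hfin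
  have hz : MemWA10 A Ω (v - ub) := hv
  obtain ⟨g, U, hg, hgw, hU2, hU⟩ := hub.exists_hasWeakA (A := A)
  have hubi : IntegrableOn ub Ω := hub.1.integrable (by norm_num)
  have hvA : MemWA1 A Ω v := by
    have h1 := hz.1.2.1.add hU
    have h2 := hz.1.1.add hubi
    rw [sub_add_cancel] at h1 h2
    exact h1.memWA1 hΩ h2 (hz.1.2.2.add (hU2.integrable (by norm_num)))
  have hv2 : MemLp (AD A Ω v) 2 (volume.restrict Ω) := by
    rw [regEnergy_of_mem hv] at hfin
    exact memLp_of_energy_lt_top hf hc hj hvA.2.2.aestronglyMeasurable hfin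
  have hgr := hf.hasLinearGrowthBounds hΛ hc hj hab.exists_orthogonal
  refine ⟨hvA, hv2, (integrable_indicator_iff hm).2 hvA.1, (memLp_indicator_iff_restrict hm).2 hv2,
    (hasWeakA_iff.1 hvA.2.1).2.2.congr (fun x hx => (Set.indicator_of_mem hx _).symm)
      fun x hx => (Set.indicator_of_mem hx _).symm,
    fun φ N hφ hN hφN => abs_integral_stress_le hΩ hb hf hΛ hc hgr hv hvA hv2 hmin hφ hN hφN,
    fun K hK hKΩ => ?_⟩
  have hQ : HasWeakA A Ω (v - ub) (AD A Ω v - U) := hvA.2.1.sub hU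
  have e : Ω.indicator v = Ω.indicator (v - ub) + Ω.indicator ub := by
    rw [← Set.indicator_add', sub_add_cancel]
  rw [e]
  exact hab.exists_grad_bound hΩ hb ((integrable_indicator_iff hm).2 hz.1.1)
    (fun x hx => Set.indicator_of_notMem hx _) (hz.weakOp_indicator hΩ hQ)
    ((memLp_indicator_iff_restrict hm).2 (hv2.sub hU2)) ((integrable_indicator_iff hm).2 hubi)
    (fun k => (memLp_indicator_iff_restrict hm).2 (hg k))
    (fun k => (hgw k).weakOp.congr (fun x hx => (Set.indicator_of_mem hx _).symm)
      fun x hx => (Set.indicator_of_mem hx _).symm) hK hKΩ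

theorem one_le_Aconst (ut : E → E) : 1 ≤ Aconst A Ω ut :=
  le_add_of_nonneg_right (integral_nonneg fun x => by positivity)

/-- The function ũ_j is a competitor of finite regularised energy at finite distance from v_j.
Finiteness of the energy then forces v_j into the Dirichlet class, and everything known about v_j
starts from there. -/
theorem IsEkelandSequence.regEnergy_lt_top (hΩ : IsOpen Ω) (hb : Bornology.IsBounded Ω)
    (hf : IsAdmissible Λ f) {u₀ : E → E} {u ub v : ℕ → E → E}
    (h : IsEkelandSequence A Ω f u₀ u ub v) (hj : 1 ≤ j) :
    regEnergy A Ω f (Aconst A Ω (utilde u₀ u ub j)) j (ub j) (v j) < ⊤ := by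
  have hc : 0 < Aconst A Ω (utilde u₀ u ub j) := zero_lt_one.trans_le (one_le_Aconst _)
  obtain ⟨g, U, hg, hgw, hU2, hU⟩ := (h.boundary_mem j hj).exists_hasWeakA (A := A)
  have hψ := h.smooth j hj
  have hcls : utilde u₀ u ub j ∈ dirichletClass A Ω (ub j) := by
    rw [dirichletClass, Set.mem_ofPred_eq, utilde, add_sub_cancel_right]
    exact hψ.memWA10 hΩ
  have hut : HasWeakA A Ω (utilde u₀ u ub j) (gradA (symbolMap A) (u j - u₀) + U) :=
    hψ.hasWeakA.add hU
  have hut2 : MemLp (gradA (symbolMap A) (u j - u₀) + U) 2 (volume.restrict Ω) :=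
    ((IsTest.gradA (a := symbolMap A) hψ).memLp 2 |>.restrict Ω).add hU2
  refine (h.ekeland_min j hj (utilde u₀ u ub j)).trans_lt (ENNReal.add_lt_top.2 ⟨?_, ?_⟩)
  · rw [regEnergy_of_mem hcls, energy_eq_ofReal hb hf hc (hut.ae_eq hΩ) hut2]
    exact ENNReal.ofReal_lt_top
  · exact ENNReal.mul_lt_top ENNReal.ofReal_lt_top
      ((h.ekeland_close j hj).trans_lt ENNReal.ofReal_lt_top)

end Ekeland

end WSO

namespace WSO

open Filter Topology

/-! ### Weak derivatives and estimates in terms of the original functions -/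

section Conclusion

variable {W : Type*} [NormedAddCommGroup W] {Ω : Set E}

theorem memL2loc_of_memLp_indicator {G : E → W}
    (hG : ∀ K, IsCompact K → K ⊆ Ω → MemLp (K.indicator G) 2) : MemL2loc Ω G := fun K hK hKΩ =>
  (memLp_indicator_iff_restrict hK.measurableSet).1 (hG K hK hKΩ)

theorem MemL2loc.locallyIntegrableOn (hΩ : IsOpen Ω) {G : E → W} (hG : MemL2loc Ω G) :
    LocallyIntegrableOn G Ω :=
  (locallyIntegrableOn_iff hΩ.isLocallyClosed).2 fun K hKΩ hK => by
    have : IsFiniteMeasure (volume.restrict K) := ⟨by simpa using hK.measure_lt_top⟩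
    exact (hG K hK hKΩ).integrable (by norm_num)

variable [InnerProductSpace ℝ W]

theorem hasWeakPartial_of_weakOp_indicator (hΩ : IsOpen Ω) {P G : E → W} {k : Fin 2}
    (hP : IntegrableOn P Ω) (hG : MemL2loc Ω G) (h : WeakOp Ω (pdCoeff W k) (Ω.indicator P) G) :
    HasWeakPartial Ω k P G := by
  refine ⟨hP.locallyIntegrableOn, hG.locallyIntegrableOn hΩ, fun φ hφ => ?_⟩
  have h' := h.congr (u' := P) (fun x hx => Set.indicator_of_mem hx _) fun x _ => rfl
  rw [hφ.setIntegral_smul, (hφ.pd k).setIntegral_smul, weakOp_pdCoeff_iff.1 h' φ hφ]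

/-- The second order estimate for an almost solution that is extended by zero. -/
theorem IsAlmostSolution.second_order_estimate_ball [FiniteDimensional ℝ W]
    {a : Fin 2 → E →L[ℝ] W} {b : Fin 2 → W →L[ℝ] E} {g : W → ℝ} {Λ ε κ r θ : ℝ} {v : E → E}
    {P : E → W} {G : Fin 2 → E → W} {x₀ : E} {ρ : E → ℝ}
    (h : IsAlmostSolution Ω a g θ (Ω.indicator v) (Ω.indicator P)) (hΩ : IsOpen Ω)
    (hab : FactorsLaplacian a b) (hΛ : 0 < Λ) (hκ : 0 < κ) (hg : HasLinearGrowthBounds Λ ε g)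
    (hθ : 0 ≤ θ) (hGw : ∀ k, WeakOp Ω (pdCoeff W k) (Ω.indicator P) (G k))
    (hGm : ∀ k K, IsCompact K → K ⊆ Ω → MemLp (K.indicator (G k)) 2)
    (hr : 0 < r) (hball : Metric.ball x₀ (2 * r) ⊆ Ω) (hρ : IsCutoff κ Ω x₀ r ρ) :
    (∀ k, IntegrableOn (fun x => ρ x ^ 4 * fderiv ℝ (fderiv ℝ g) (P x) (G k x) (G k x))
      (Metric.ball x₀ (2 * r))) ∧
    ∑ k, ∫ x in Metric.ball x₀ (2 * r), ρ x ^ 4 * fderiv ℝ (fderiv ℝ g) (P x) (G k x) (G k x) ≤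
      secondOrderConst a b Λ κ / r ^ 2 *
        ((∫ x in Metric.ball x₀ (2 * r), ‖P x‖) + ε * (∫ x in Metric.ball x₀ (2 * r), ‖P x‖ ^ 2) +
          θ * (r ^ 2 + r ^ 3) * ∫ x in Metric.ball x₀ (2 * r), ‖v x‖ / r) := by
  obtain ⟨hi, hle⟩ := h.second_order_estimate hΩ hab hΛ hκ hg hθ hGw hGm hr hρ
  have hm : MeasurableSet (Metric.ball x₀ (2 * r)) := measurableSet_ball
  have hPe : ∀ x ∈ Metric.ball x₀ (2 * r), Ω.indicator P x = P x := fun x hx =>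
    Set.indicator_of_mem (hball hx) _
  have hve : ∀ x ∈ Metric.ball x₀ (2 * r), Ω.indicator v x = v x := fun x hx =>
    Set.indicator_of_mem (hball hx) _
  have e1 : ∀ k, ∫ x in Metric.ball x₀ (2 * r), ρ x ^ 4 *
      fderiv ℝ (fderiv ℝ g) (P x) (G k x) (G k x) =
      ∫ x, ρ x ^ 4 * fderiv ℝ (fderiv ℝ g) (Ω.indicator P x) (G k x) (G k x) := fun k => by
    refine Eq.trans ?_ (setIntegral_eq_integral_of_forall_compl_eq_zero
      (s := Metric.ball x₀ (2 * r)) fun x hx => by rw [hρ.eq_zero hx]; ring)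
    exact setIntegral_congr_fun hm fun x hx => by simp only [hPe x hx]
  have e2 : ∫ x in Metric.ball x₀ (2 * r), ‖Ω.indicator P x‖ =
      ∫ x in Metric.ball x₀ (2 * r), ‖P x‖ :=
    setIntegral_congr_fun hm fun x hx => by simp only [hPe x hx]
  have e3 : ∫ x in Metric.ball x₀ (2 * r), ‖Ω.indicator P x‖ ^ 2 =
      ∫ x in Metric.ball x₀ (2 * r), ‖P x‖ ^ 2 :=
    setIntegral_congr_fun hm fun x hx => by simp only [hPe x hx]
  have e4 : ∫ x in Metric.ball x₀ (2 * r), ‖Ω.indicator v x‖ / r =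
      ∫ x in Metric.ball x₀ (2 * r), ‖v x‖ / r :=
    setIntegral_congr_fun hm fun x hx => by simp only [hve x hx]
  refine ⟨fun k => (hi k).integrableOn.congr_fun (fun x hx => by simp only [hPe x hx]) hm, ?_⟩
  simp only [e1]
  rwa [e2, e3, e4] at hle

end Conclusion

end WSO

/-! ### The main theorem. -/

open WSO in
theorem mainTheorem3 (A : Mat →L[ℝ] Mat) (hA : IsIdempotentElem A) (hell : IsCElliptic A)
    (Λ κ : ℝ) (hΛ : 0 < Λ) (hκ : 0 < κ) :
    ∃ c : ℝ, 0 < c ∧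
      ∀ (Ω : Set E) (f : RA A → ℝ) (u₀ : E → E) (u ub v : ℕ → E → E),
        IsOpen Ω → Bornology.IsBounded Ω → IsAdmissible Λ f →
        IsEkelandSequence A Ω f u₀ u ub v →
        ∀ j : ℕ, 1 ≤ j →
          MemWA1 A Ω (v j) ∧ MemLp (AD A Ω (v j)) 2 (volume.restrict Ω) ∧
          ∃ G : Fin 2 → E → RA A,
            (∀ k, HasWeakPartial Ω k (AD A Ω (v j)) (G k) ∧ MemL2loc Ω (G k)) ∧
            ∀ (x₀ : E) (r : ℝ) (ρ : E → ℝ), 0 < r → Metric.ball x₀ (2 * r) ⊆ Ω →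
              IsCutoff κ Ω x₀ r ρ →
              (∀ k, IntegrableOn
                (fun x => ρ x ^ 4 *
                  hessForm (regIntegrand f (Aconst A Ω (utilde u₀ u ub j)) j)
                    (AD A Ω (v j) x) (G k x))
                (Metric.ball x₀ (2 * r))) ∧
              ∑ k, ∫ x in Metric.ball x₀ (2 * r),
                  ρ x ^ 4 *
                    hessForm (regIntegrand f (Aconst A Ω (utilde u₀ u ub j)) j)
                      (AD A Ω (v j) x) (G k x)
                ≤ c / r ^ 2 *
                  ((∫ x in Metric.ball x₀ (2 * r), ‖AD A Ω (v j) x‖)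
                    + 1 / (Aconst A Ω (utilde u₀ u ub j) * (j : ℝ) ^ 2) *
                        (∫ x in Metric.ball x₀ (2 * r), (1 + ‖AD A Ω (v j) x‖ ^ 2))
                    + (1 + r ^ 2 / (j : ℝ) + r ^ 3 / (j : ℝ)) *
                        (∫ x in Metric.ball x₀ (2 * r), ‖v j x‖ / r)) := by
  obtain ⟨b, hab⟩ := exists_factorsLaplacian hA hell
  refine ⟨secondOrderConst (symbolMap A) b Λ κ, secondOrderConst_pos hΛ hκ,
    fun Ω f u₀ u ub v hΩ hb hf h j hj => ?_⟩
  have hc : 0 < Aconst A Ω (utilde u₀ u ub j) := zero_lt_one.trans_le (one_le_Aconst _)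
  have hj' : (0 : ℝ) < j := by exact_mod_cast hj
  have hθ : (0 : ℝ) ≤ 1 / (j : ℝ) := by positivity
  have hg := hf.hasLinearGrowthBounds hΛ hc hj hab.exists_orthogonal
  obtain ⟨hv, hv2, hsol⟩ := isAlmostSolution_of_ekeland hΩ hb hab hf hΛ hc hj (h.boundary_mem j hj)
    (h.regEnergy_lt_top hΩ hb hf hj) (h.ekeland_min j hj)
  choose G hGw hGm using fun k =>
    hsol.exists_weakOp hΩ hb hab (hg.hasHessBounds hΛ) hg.eps_pos hθ k
  have hGl := fun k => memL2loc_of_memLp_indicator (hGm k)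
  refine ⟨hv, hv2, G, fun k =>
    ⟨hasWeakPartial_of_weakOp_indicator hΩ hv.2.2 (hGl k) (hGw k), hGl k⟩,
    fun x₀ r ρ hr hball hρ => ?_⟩
  obtain ⟨hi, hle⟩ := hsol.second_order_estimate_ball hΩ hab hΛ hκ hg hθ hGw hGm hr hball hρ
  refine ⟨hi, hle.trans ?_⟩
  have hsq : IntegrableOn (fun x => ‖AD A Ω (v j) x‖ ^ 2) (Metric.ball x₀ (2 * r)) :=
    (integrable_norm_sq hv2).mono_measure (Measure.restrict_mono hball le_rfl)
  have hone : ∫ x in Metric.ball x₀ (2 * r), ‖AD A Ω (v j) x‖ ^ 2 ≤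
      ∫ x in Metric.ball x₀ (2 * r), (1 + ‖AD A Ω (v j) x‖ ^ 2) :=
    integral_mono hsq ((integrableOn_const measure_ball_lt_top.ne).add hsq) fun x => by
      simp
  have hvr : 0 ≤ ∫ x in Metric.ball x₀ (2 * r), ‖v j x‖ / r :=
    integral_nonneg fun x => by positivity
  -- The estimate obtained has the smaller factor (r² + r³)/j in front of the integral of |v_j|/r;
  -- the summand 1 is slack.
  have hcoef : 1 / (j : ℝ) * (r ^ 2 + r ^ 3) ≤ 1 + r ^ 2 / (j : ℝ) + r ^ 3 / (j : ℝ) := by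
    have e : 1 / (j : ℝ) * (r ^ 2 + r ^ 3) = r ^ 2 / (j : ℝ) + r ^ 3 / (j : ℝ) := by ring
    linarith
  have hC := secondOrderConst_pos (a := symbolMap A) (b := b) hΛ hκ
  gcongr
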